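/- Let $A,B\in\mathbb R$, $\mathcal H=L^2(\mathbb R^2)$ with inner product $\langle f,g\rangle=\int\overline f g$, and let $\mathcal D=\mathcal S(\mathbb R^2)$ be the Schwartz space. Let $x_j$ and $p_j=-i\partial_j$ ($j=1,2$) be the self-adjoint position and momentum operators and $$H=\tfrac12(p_1^2+x_1^2)+\tfrac12(p_2^2+x_2^2)+i[A(x_1+x_2)+B(p_1+p_2)].$$ Put $C=iA-B$, $D=iA+B$, $a_j=\frac1{\sqrt2}(x_j+ip_j+C)$, $b_j=\frac1{\sqrt2}(x_j-ip_j+D)$, $N_j=b_ja_j$, $c_j=\frac1{\sqrt2}(x_j+ip_j)$ (with natural domains; $\dagger$ denotes the Hilbert space adjoint). (1) The operators $a_j,b_j$ are $\mathcal D$-pseudo-bosonic: $\mathcal D$ is dense in $\mathcal H$ and stable under $a_j,b_j,a_j^\dagger,b_j^\dagger$, and $[a_j,b_k]f=\delta_{jk}f$, $[a_j,a_k]f=[b_j,b_k]f=0$ for all $f\in\mathcal D$. Constants $N,N'\in\mathbb C$ with $\langle\varphi_{0,0},\Psi_{0,0}\rangle=1$ exist, where $\varphi_{0,0}=Ne^{-\frac12(x_1^2+x_2^2)-C(x_1+x_2)}$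 and $\Psi_{0,0}=N'e^{-\frac12(x_1^2+x_2^2)-\overline D(x_1+x_2)}$. For all such constants, $\varphi_{0,0}$ and $\Psi_{0,0}$ are non-zero elements of $\mathcal D$ with $a_j\varphi_{0,0}=0$, $b_j^\dagger\Psi_{0,0}=0$, and the vectors $\varphi_{n}=\frac{1}{\sqrt{n_1!n_2!}}b_1^{n_1}b_2^{n_2}\varphi_{0,0}$ and $\Psi_{n}=\frac{1}{\sqrt{n_1!n_2!}}(a_1^\dagger)^{n_1}(a_2^\dagger)^{n_2}\Psi_{0,0}$, $n=(n_1,n_2)\in\mathbb N_0^2$, lie in $\mathcal D$. (2) $Hf=(N_1+N_2+(A^2+B^2+1))f$ for all $f\in\mathcal D$. (3) Let $\Phi_{0,0}=\pi^{-1/2}e^{-\frac12(x_1^2+x_2^2)}$ and $\Phi_n=\frac{1}{\sqrt{n_1!n_2!}}(c_1^\dagger)^{n_1}(c_2^\dagger)^{n_2}\Phi_{0,0}$. Then $c_j\Phi_{0,0}=0$ and $(\Phi_n)$ is an orthonormal basis of $\mathcal H$. The closure of $-A(p_1+p_2)+B(x_1+x_2)$ is self-adjoint, and its exponential $T=e^{-A(p_1+p_2)+B(x_1+x_2)}$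 in the sense of the functional calculus is a well-defined self-adjoint, injective operator with dense range, unbounded if $(A,B)\neq(0,0)$. All $\Phi_n$ lie in $D(T)\cap D(T^{-1})$, and for a suitable choice of $N,N'$ with $\langle\varphi_{0,0},\Psi_{0,0}\rangle=1$ one has $\varphi_n=T\Phi_n$ and $\Psi_n=T^{-1}\Phi_n$ for all $n$. (4) For all $N,N'$ with $\langle\varphi_{0,0},\Psi_{0,0}\rangle=1$, the families $(\varphi_n)$ and $(\Psi_n)$ are $\mathcal G$-quasi bases for $\mathcal G=D(T)\cap D(T^{-1})$: $\mathcal G$ is dense, contains all $\varphi_n,\Psi_n$, and for all $f,g\in\mathcal G$ $$\langle f,g\rangle=\sum_n\langle f,\varphi_n\rangle\langle\Psi_n,g\rangle=\sum_n\langle f,\Psi_n\rangle\langle\varphi_n,g\rangle .$$ (5) Let $\Theta=T^{-2}$. Then $\Theta=e^{2A(p_1+p_2)-2B(x_1+x_2)}$ is self-adjoint and injective, and $\Psi_n=\Theta\varphi_n$ for all $n$, with $N,N'$ as chosen in (3). For every $f\in\mathcal D\cap D(\Theta)$ with $\Theta f\in\mathcal D$ one has $a_jf=\Theta^{-1}b_j^\dagger\Theta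 f$ and $N_jf=\Theta^{-1}N_j^\dagger\Theta f$. Moreover there is a dense subspace $\mathcal D_0\subseteq\mathcal D$ that contains all $\varphi_n$ and $\Psi_n$ (for all $N,N'$), is stable under $a_j,b_j,a_j^\dagger,b_j^\dagger,\Theta,\Theta^{-1}$, and on which therefore $(a_j,b_j)$ are $\mathcal D_0$-pseudo-bosonic and $a_j=\Theta^{-1}b_j^\dagger\Theta$, i.e. $(a_j,b_j^\dagger)$ are $\Theta$-conjugate. -/

import Mathlib

open MeasureTheory
open scoped SchwartzMap LinearPMap LineDeriv

noncomputable section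

namespace PB

/-! ### Unbounded operators on a complex Hilbert space -/

section Operators

variable {E : Type*} [NormedAddCommGroup E] [InnerProductSpace ℂ E]

/-- The product `L M` of two unbounded operators, with its natural domain
`{f ∈ D(M) : M f ∈ D(L)}`. -/
def opMul (L M : E →ₗ.[ℂ] E) : E →ₗ.[ℂ] E where
  domain := (L.domain.comap M.toFun).map M.domain.subtype
  toFun :=
    { toFun := fun x => L ⟨M ⟨x.1, by
          obtain ⟨y, -, hxy⟩ := x.2
          exact hxy ▸ y.2⟩, by
          obtain ⟨x, y, hy, rfl⟩ := x
          exact hy⟩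
      map_add' := fun x y => by
        rw [← L.map_add]
        congr 1
        apply Subtype.ext
        exact M.map_add ⟨x.1, _⟩ ⟨y.1, _⟩
      map_smul' := fun c x => by
        rw [RingHom.id_apply, ← L.map_smul]
        congr 1
        apply Subtype.ext
        exact M.map_smul c ⟨x.1, _⟩ }

/-- The everywhere defined operator `c 𝟙`. -/
def scalarOp (c : ℂ) : E →ₗ.[ℂ] E := (c • LinearMap.id : E →ₗ[ℂ] E).toPMap ⊤

open Classical in
/-- `L f` for `f ∈ D(L)`, extended by `0` outside `D(L)`. -/
def app (L : E →ₗ.[ℂ] E) (f : E) : E :=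
  if h : f ∈ L.domain then L ⟨f, h⟩ else 0

/-- `𝒟 ⊆ D(L)` and `L 𝒟 ⊆ 𝒟`. -/
def StableUnder (𝒟 : Submodule ℂ E) (L : E →ₗ.[ℂ] E) : Prop :=
  ∀ f ∈ 𝒟, ∃ g ∈ 𝒟, (f, g) ∈ L.graph

variable [CompleteSpace E]

/-- The families `(a j)`, `(b j)` are `𝒟`-pseudo-bosonic: `𝒟` is dense and stable under all `a j`,
`b j` and their adjoints, and `[a j, b k] f = δ_{jk} f`, `[a j, a k] f = [b j, b k] f = 0` for all
`f ∈ 𝒟`. -/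
structure IsPseudoBosonic {ι : Type*} [DecidableEq ι] (𝒟 : Submodule ℂ E)
    (a b : ι → (E →ₗ.[ℂ] E)) : Prop where
  dense : Dense (𝒟 : Set E)
  stable_a : ∀ j, StableUnder 𝒟 (a j)
  stable_b : ∀ j, StableUnder 𝒟 (b j)
  stable_a_adj : ∀ j, StableUnder 𝒟 (a j)†
  stable_b_adj : ∀ j, StableUnder 𝒟 (b j)†
  comm_ab : ∀ j k, ∀ f ∈ 𝒟,
    (f, if j = k then f else 0) ∈ (opMul (a j) (b k) - opMul (b k) (a j)).graph
  comm_aa : ∀ j k, ∀ f ∈ 𝒟, (f, 0) ∈ (opMul (a j) (a k) - opMul (a k) (a j)).graph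
  comm_bb : ∀ j k, ∀ f ∈ 𝒟, (f, 0) ∈ (opMul (b j) (b k) - opMul (b k) (b j)).graph

/-- The families `φ`, `ψ` are `𝒢`-quasi bases: `𝒢` is a dense subspace containing both families,
and `⟨f,g⟩ = ∑ₙ ⟨f,φₙ⟩⟨ψₙ,g⟩ = ∑ₙ ⟨f,ψₙ⟩⟨φₙ,g⟩` for all `f, g ∈ 𝒢`. -/
structure IsQuasiBases {ι : Type*} (𝒢 : Submodule ℂ E) (φ ψ : ι → E) : Prop where
  dense : Dense (𝒢 : Set E)
  mem_left : ∀ n, φ n ∈ 𝒢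
  mem_right : ∀ n, ψ n ∈ 𝒢
  hasSum_left : ∀ f ∈ 𝒢, ∀ g ∈ 𝒢,
    HasSum (fun n => inner ℂ f (φ n) * inner ℂ (ψ n) g) (inner ℂ f g)
  hasSum_right : ∀ f ∈ 𝒢, ∀ g ∈ 𝒢,
    HasSum (fun n => inner ℂ f (ψ n) * inner ℂ (φ n) g) (inner ℂ f g)

/-- `L f = Θ⁻¹ M Θ f`, both sides being defined. -/
def Intertwines (Θ L M : E →ₗ.[ℂ] E) (f : E) : Prop :=
  ∃ h, (f, h) ∈ L.graph ∧ (f, h) ∈ (opMul Θ.inverse (opMul M Θ)).graph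

/-- `(a, c)` are `Θ`-conjugate on `𝒟`: `Θ` is self-adjoint and invertible, `Θ` and `Θ⁻¹` leave `𝒟`
invariant, and `a f = Θ⁻¹ c Θ f` for all `f ∈ 𝒟`. -/
structure IsConjugate (𝒟 : Submodule ℂ E) (Θ a c : E →ₗ.[ℂ] E) : Prop where
  selfAdjoint : IsSelfAdjoint Θ
  injective : LinearMap.ker Θ.toFun = ⊥
  stable : StableUnder 𝒟 Θ
  stable_inv : StableUnder 𝒟 Θ.inverse
  conj : ∀ f ∈ 𝒟, Intertwines Θ a c f

end Operators

/-! ### Functional calculus of self-adjoint operators -/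

/-- The maximal operator of multiplication by the real function `g` in `L²(μ)`, with domain
`{f ∈ L² : g f ∈ L²}`. -/
def mulOp {α : Type*} [MeasurableSpace α] (μ : Measure α) (g : α → ℝ) :
    Lp ℂ 2 μ →ₗ.[ℂ] Lp ℂ 2 μ where
  domain :=
    { carrier := {f | MemLp (fun x => (g x : ℂ) * f x) 2 μ}
      add_mem' := by
        intro f h hf hh
        refine (memLp_congr_ae ?_).mp (MemLp.add hf hh)
        filter_upwards [Lp.coeFn_add f h] with x hx
        simp only [hx, Pi.add_apply]
        ring
      zero_mem' := by
        refine (memLp_congr_ae ?_).mp (MemLp.zero (ε := ℂ) (p := 2) (μ := μ))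
        filter_upwards [Lp.coeFn_zero ℂ 2 μ] with x hx
        simp only [hx, Pi.zero_apply, mul_zero]
      smul_mem' := by
        intro c f hf
        refine (memLp_congr_ae ?_).mp (MemLp.const_smul hf c)
        filter_upwards [Lp.coeFn_smul c f] with x hx
        simp only [hx, Pi.smul_apply, smul_eq_mul]
        ring }
  toFun :=
    { toFun := fun f => MemLp.toLp _ f.2
      map_add' := by
        intro f h
        rw [← MemLp.toLp_add]
        refine MemLp.toLp_congr _ _ ?_
        filter_upwards [Lp.coeFn_add f.1 h.1] with x hx
        simp only [Submodule.coe_add, hx, Pi.add_apply]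
        ring
      map_smul' := by
        intro c f
        rw [RingHom.id_apply, ← MemLp.toLp_const_smul]
        refine MemLp.toLp_congr _ _ ?_
        filter_upwards [Lp.coeFn_smul c f.1] with x hx
        simp only [Submodule.coe_smul, hx, Pi.smul_apply, smul_eq_mul]
        ring }

/-- `S = F(K)` in the sense of the functional calculus of self-adjoint operators: a unitary map
onto some `L²(μ)` turns `K` into multiplication by a real measurable function `g` and `S` into
multiplication by `F ∘ g`. In particular `K` is self-adjoint. -/
def IsFunctionOf {E : Type*} [NormedAddCommGroup E] [InnerProductSpace ℂ E]
    (F : ℝ → ℝ) (K S : E →ₗ.[ℂ] E) : Prop :=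
  ∃ (α : Type) (_ : MeasurableSpace α) (μ : Measure α) (_ : SigmaFinite μ) (g : α → ℝ)
    (U : E ≃ₗᵢ[ℂ] Lp ℂ 2 μ), Measurable g ∧
    (∀ f h, (f, h) ∈ K.graph ↔ (U f, U h) ∈ (mulOp μ g).graph) ∧
    (∀ f h, (f, h) ∈ S.graph ↔ (U f, U h) ∈ (mulOp μ (fun y => F (g y))).graph)

/-! ### Position and momentum in `L²(ℝ²)` -/

/-- The plane `ℝ²`. -/
abbrev Plane : Type := EuclideanSpace ℝ (Fin 2)

/-- The Hilbert space `L²(ℝ²)`. -/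
abbrev Hil : Type := Lp ℂ 2 (volume : Measure Plane)

/-- The embedding of `𝒮(ℝ²)` in `L²(ℝ²)`. -/
def embed : 𝓢(Plane, ℂ) →ₗ[ℂ] Hil :=
  (SchwartzMap.toLpCLM ℂ ℂ 2 (volume : Measure Plane)).toLinearMap

theorem embed_injective : Function.Injective embed :=
  SchwartzMap.injective_toLp 2 (volume : Measure Plane)

/-- `𝒮(ℝ²)` as a subspace of `L²(ℝ²)`. -/
def schwartz : Submodule ℂ Hil := LinearMap.range embed

/-- The operator in `L²(ℝ²)` with domain `𝒮(ℝ²)` given by a linear map of `𝒮(ℝ²)`. -/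
def ofSchwartz (L : 𝓢(Plane, ℂ) →ₗ[ℂ] 𝓢(Plane, ℂ)) : Hil →ₗ.[ℂ] Hil where
  domain := schwartz
  toFun := embed ∘ₗ L ∘ₗ (LinearEquiv.ofInjective embed embed_injective).symm.toLinearMap

/-- The self-adjoint position operator `x_j`. -/
def xOp (j : Fin 2) : Hil →ₗ.[ℂ] Hil := mulOp volume (fun y : Plane => y j)

/-- The self-adjoint momentum operator `p_j`, the closure of `-i ∂_j` on `𝒮(ℝ²)`. -/
def pOp (j : Fin 2) : Hil →ₗ.[ℂ] Hil :=
  (ofSchwartz (-Complex.I •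
    (LineDeriv.lineDerivOpCLM ℂ 𝓢(Plane, ℂ) (EuclideanSpace.single j (1 : ℝ))).toLinearMap)).closure

/-! ### The model -/

/-- `H = ½(p₁²+x₁²) + ½(p₂²+x₂²) + i[A(x₁+x₂) + B(p₁+p₂)]`. -/
def hamiltonian (A B : ℝ) : Hil →ₗ.[ℂ] Hil :=
  (1 / 2 : ℂ) • (opMul (pOp 0) (pOp 0) + opMul (xOp 0) (xOp 0)) +
  (1 / 2 : ℂ) • (opMul (pOp 1) (pOp 1) + opMul (xOp 1) (xOp 1)) +
  Complex.I • ((A : ℂ) • (xOp 0 + xOp 1) + (B : ℂ) • (pOp 0 + pOp 1))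

/-- `C = iA - B`. -/
def constC (A B : ℝ) : ℂ := Complex.I * A - B

/-- `D = iA + B`. -/
def constD (A B : ℝ) : ℂ := Complex.I * A + B

/-- `a_j = (x_j + i p_j + C)/√2`. -/
def aOp (A B : ℝ) (j : Fin 2) : Hil →ₗ.[ℂ] Hil :=
  (1 / (√2 : ℝ) : ℂ) • (xOp j + Complex.I • pOp j + scalarOp (constC A B))

/-- `b_j = (x_j - i p_j + D)/√2`. -/
def bOp (A B : ℝ) (j : Fin 2) : Hil →ₗ.[ℂ] Hil :=
  (1 / (√2 : ℝ) : ℂ) • (xOp j - Complex.I • pOp j + scalarOp (constD A B))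

/-- `N_j = b_j a_j`. -/
def num (A B : ℝ) (j : Fin 2) : Hil →ₗ.[ℂ] Hil := opMul (bOp A B j) (aOp A B j)

/-- The bosonic operator `c_j = (x_j + i p_j)/√2`. -/
def cOp (j : Fin 2) : Hil →ₗ.[ℂ] Hil := (1 / (√2 : ℝ) : ℂ) • (xOp j + Complex.I • pOp j)

/-- The function `N exp(-½(x₁²+x₂²) - k(x₁+x₂))`. -/
def gaussFun (N k : ℂ) (y : Plane) : ℂ :=
  N * Complex.exp (-(1 / 2 : ℂ) * ((y 0 : ℂ) ^ 2 + (y 1 : ℂ) ^ 2) - k * ((y 0 : ℂ) + (y 1 : ℂ)))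

theorem memLp_gaussFun (N k : ℂ) : MemLp (gaussFun N k) 2 (volume : Measure Plane) := by
  have hcont : Continuous (gaussFun N k) := by
    unfold gaussFun
    fun_prop
  rw [memLp_two_iff_integrable_sq_norm hcont.aestronglyMeasurable]
  have h := (GaussianFourier.integrable_cexp_neg_mul_sq_norm_add (V := Plane) (b := 1) (by simp)
    (-2 * (k.re : ℂ)) (!₂[1, 1] : Plane)).norm.const_mul (‖N‖ ^ 2)
  refine h.congr (Filter.Eventually.of_forall fun y => ?_)
  have hre (r : ℝ) : ((r : ℂ) ^ 2).re = r ^ 2 := by rw [← Complex.ofReal_pow, Complex.ofReal_re]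
  have hn : ‖y‖ ^ 2 = y 0 ^ 2 + y 1 ^ 2 := by
    rw [EuclideanSpace.real_norm_sq_eq, Fin.sum_univ_two]
  simp only [gaussFun, norm_mul, mul_pow, Complex.norm_exp, ← Real.exp_nat_mul]
  congr 2
  simp [hre, hn, PiLp.inner_apply, Fin.sum_univ_two]
  ring

/-- The element of `L²(ℝ²)` given by `N exp(-½(x₁²+x₂²) - k(x₁+x₂))`. -/
def gauss (N k : ℂ) : Hil := (memLp_gaussFun N k).toLp _

/-- `(n₁! n₂!)^{-1/2} L₁^{n₁} L₂^{n₂} v`. -/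
def tower (L : Fin 2 → (Hil →ₗ.[ℂ] Hil)) (v : Hil) (n : ℕ × ℕ) : Hil :=
  (1 / (√(n.1.factorial * n.2.factorial) : ℝ) : ℂ) • (app (L 0))^[n.1] ((app (L 1))^[n.2] v)

/-- `φ_n = (n₁! n₂!)^{-1/2} b₁^{n₁} b₂^{n₂} φ_{0,0}`, `φ_{0,0} = N e^{-½(x₁²+x₂²) - C(x₁+x₂)}`. -/
def phi (A B : ℝ) (N : ℂ) : ℕ × ℕ → Hil := tower (bOp A B) (gauss N (constC A B))

/-- `Ψ_n = (n₁! n₂!)^{-1/2} (a₁†)^{n₁} (a₂†)^{n₂} Ψ_{0,0}`,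
`Ψ_{0,0} = N' e^{-½(x₁²+x₂²) - D̄(x₁+x₂)}`. -/
def psi (A B : ℝ) (N' : ℂ) : ℕ × ℕ → Hil :=
  tower (fun j => (aOp A B j)†) (gauss N' (starRingEnd ℂ (constD A B)))

/-- The oscillator eigenfunctions `Φ_n = (n₁! n₂!)^{-1/2} (c₁†)^{n₁} (c₂†)^{n₂} Φ_{0,0}`,
`Φ_{0,0} = π^{-1/2} e^{-½(x₁²+x₂²)}`. -/
def bigPhi : ℕ × ℕ → Hil := tower (fun j => (cOp j)†) (gauss (1 / (√Real.pi : ℝ) : ℂ) 0)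

/-- The closure of `-A(p₁+p₂) + B(x₁+x₂)`. -/
def generator (A B : ℝ) : Hil →ₗ.[ℂ] Hil :=
  ((-A : ℂ) • (pOp 0 + pOp 1) + (B : ℂ) • (xOp 0 + xOp 1)).closure

end PB

end

open PB

noncomputable section

namespace PB

/-!
Write `K = -A(p₁ + p₂) + B(x₁ + x₂)` and `T = exp K`. A unitary map `W` of `L²(ℝ²)`, composed of a
quadratic phase and a Fourier transform, turns `K` into multiplication by a real linear function,
so that every `exp(tK)` is multiplication by a positive function there. Since `W` conjugates
`x_j ± i p_j` into a first order operator with constant coefficients, conjugation by `exp(tK)`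
adds constants to `x_j + i p_j` and `x_j - i p_j`, namely `tC` and `tD`. The vacuum
`exp(-½(x₁² + x₂²) - k(x₁ + x₂))` is, up to a factor, the only Schwartz function annihilated by all
`x_j + i p_j + k`. Hence `exp(tK)` maps the oscillator vacuum to a multiple of the one with
`k = tC`, and the oscillator eigenfunctions to the ladder of the displaced operators, so that
`T Φ_n = φ_n` and `T⁻¹ Φ_n = Ψ_n` for suitable constants.

Since `T` is symmetric, the quasi-basis property is Parseval's identity for `(Φ_n)`, applied to
`T f` and `T⁻¹ g`. With `t = -2` the constants `C` and `D` become `-C` and `-D`, which is the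
relation `a_j = Θ⁻¹ b_j† Θ`. The subspace `𝒟₀` consists of the Schwartz functions that all
`exp(tK)` map to Schwartz functions; it contains the displaced Gaussians and is stable under
`x_j` and `p_j`, which makes it dense.
-/

/-! ### Graphs of unbounded operators -/

section Graph

variable {R E F : Type*} [Ring R] [AddCommGroup E] [Module R E] [AddCommGroup F] [Module R F]

theorem mem_graph_iff_exists_apply_eq {L : E →ₗ.[R] F} {f : E} {g : F} :
    (f, g) ∈ L.graph ↔ ∃ hf : f ∈ L.domain, L ⟨f, hf⟩ = g := by
  simp

theorem mem_graph_add_iff {L M : E →ₗ.[R] F} {f : E} {k : F} :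
    (f, k) ∈ (L + M).graph ↔ ∃ g h, (f, g) ∈ L.graph ∧ (f, h) ∈ M.graph ∧ g + h = k := by
  simp only [mem_graph_iff_exists_apply_eq]
  constructor
  · rintro ⟨hf, rfl⟩
    exact ⟨_, _, ⟨hf.1, rfl⟩, ⟨hf.2, rfl⟩, rfl⟩
  · rintro ⟨_, _, ⟨hL, rfl⟩, ⟨hM, rfl⟩, rfl⟩
    exact ⟨⟨hL, hM⟩, rfl⟩

theorem mem_graph_sub_iff {L M : E →ₗ.[R] F} {f : E} {k : F} :
    (f, k) ∈ (L - M).graph ↔ ∃ g h, (f, g) ∈ L.graph ∧ (f, h) ∈ M.graph ∧ g - h = k := by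
  simp only [mem_graph_iff_exists_apply_eq]
  constructor
  · rintro ⟨hf, rfl⟩
    exact ⟨_, _, ⟨hf.1, rfl⟩, ⟨hf.2, rfl⟩, rfl⟩
  · rintro ⟨_, _, ⟨hL, rfl⟩, ⟨hM, rfl⟩, rfl⟩
    exact ⟨⟨hL, hM⟩, rfl⟩

theorem mem_graph_smul_iff {M : Type*} [Monoid M] [DistribMulAction M F] [SMulCommClass R M F]
    {L : E →ₗ.[R] F} {c : M} {f : E} {k : F} :
    (f, k) ∈ (c • L).graph ↔ ∃ g, (f, g) ∈ L.graph ∧ c • g = k := by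
  simp only [mem_graph_iff_exists_apply_eq]
  constructor
  · rintro ⟨hf, rfl⟩
    exact ⟨_, ⟨hf, rfl⟩, rfl⟩
  · rintro ⟨_, ⟨hf, rfl⟩, rfl⟩
    exact ⟨hf, rfl⟩

theorem linearPMap_ext_graph {L M : E →ₗ.[R] F}
    (h : ∀ f g, (f, g) ∈ L.graph ↔ (f, g) ∈ M.graph) : L = M :=
  LinearPMap.eq_of_eq_graph (SetLike.ext fun ⟨f, g⟩ => h f g)

theorem mem_graph_inverse_iff {L : E →ₗ.[R] F} (hL : LinearMap.ker L.toFun = ⊥) {f : E} {g : F} :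
    (g, f) ∈ L.inverse.graph ↔ (f, g) ∈ L.graph := by
  rw [LinearPMap.inverse_graph hL]
  simp

theorem ker_eq_bot_of_graph {L : E →ₗ.[R] F} (h : ∀ f, (f, 0) ∈ L.graph → f = 0) :
    LinearMap.ker L.toFun = ⊥ := by
  rw [LinearMap.ker_eq_bot']
  intro f hf
  have hmem := L.mem_graph f
  rw [← LinearPMap.toFun_eq_coe, hf] at hmem
  exact Subtype.ext (h _ hmem)

end Graph

section Operators

variable {E : Type*} [NormedAddCommGroup E] [InnerProductSpace ℂ E]

theorem mem_graph_scalarOp_iff {c : ℂ} {f g : E} :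
    (f, g) ∈ (scalarOp c : E →ₗ.[ℂ] E).graph ↔ c • f = g := by
  rw [mem_graph_iff_exists_apply_eq]
  exact ⟨fun ⟨_, h⟩ => h, fun h => ⟨trivial, h⟩⟩

theorem mem_graph_opMul_iff {L M : E →ₗ.[ℂ] E} {f k : E} :
    (f, k) ∈ (opMul L M).graph ↔ ∃ g, (f, g) ∈ M.graph ∧ (g, k) ∈ L.graph := by
  simp only [mem_graph_iff_exists_apply_eq]
  constructor
  · rintro ⟨⟨x, hx, rfl⟩, rfl⟩
    exact ⟨M x, ⟨x.2, rfl⟩, hx, rfl⟩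
  · rintro ⟨_, ⟨hf, rfl⟩, hg, rfl⟩
    exact ⟨⟨⟨f, hf⟩, hg, rfl⟩, rfl⟩

theorem app_eq_of_mem_graph {L : E →ₗ.[ℂ] E} {f g : E} (h : (f, g) ∈ L.graph) : app L f = g := by
  have hf := LinearPMap.mem_domain_of_mem_graph h
  rw [app, dif_pos hf]
  exact ((LinearPMap.image_iff hf).2 h).symm

end Operators

/-! ### Adjoint relations, symmetric operators and their closures -/

section Adjoint

variable {𝕜 E F : Type*} [RCLike 𝕜] [NormedAddCommGroup E] [InnerProductSpace 𝕜 E]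
  [NormedAddCommGroup F] [InnerProductSpace 𝕜 F]

theorem mem_adjoint_iff_inner_eq {G : Submodule 𝕜 (E × F)} {f : F} {g : E} :
    (f, g) ∈ G.adjoint ↔ ∀ u v, (u, v) ∈ G → inner 𝕜 v f = inner 𝕜 u g := by
  simp only [Submodule.mem_adjoint_iff, sub_eq_zero]

theorem mem_adjoint_topologicalClosure {G : Submodule 𝕜 (E × F)} {p : F × E}
    (hp : p ∈ G.adjoint) : p ∈ G.topologicalClosure.adjoint := by
  rw [mem_adjoint_iff_inner_eq] at hp ⊢
  intro u v huv
  have hclosed : IsClosed {q : E × F | inner 𝕜 q.2 p.1 = inner 𝕜 q.1 p.2} :=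
    isClosed_eq (by fun_prop) (by fun_prop)
  exact closure_minimal (fun q hq => hp q.1 q.2 hq) hclosed huv

variable [CompleteSpace E]

theorem isSelfAdjoint_of_graph_adjoint {L : E →ₗ.[𝕜] E} (hL : Dense (L.domain : Set E))
    (h : L.graph.adjoint = L.graph) : IsSelfAdjoint L :=
  LinearPMap.isSelfAdjoint_def.2
    (LinearPMap.eq_of_eq_graph ((LinearPMap.adjoint_graph_eq_graph_adjoint hL).trans h))

theorem graph_adjoint_of_isSelfAdjoint {L : E →ₗ.[𝕜] E} (hL : IsSelfAdjoint L) :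
    L.graph.adjoint = L.graph := by
  rw [← LinearPMap.adjoint_graph_eq_graph_adjoint hL.dense_domain,
    LinearPMap.isSelfAdjoint_def.1 hL]

theorem isClosable_of_graph_le_adjoint {L : E →ₗ.[𝕜] E} (hL : Dense (L.domain : Set E))
    (h : L.graph ≤ L.graph.adjoint) : L.IsClosable := by
  refine (LinearPMap.adjoint_isClosed hL).isClosable.leIsClosable (LinearPMap.le_of_le_graph ?_)
  rwa [LinearPMap.adjoint_graph_eq_graph_adjoint hL]

end Adjoint

section Core

variable {E : Type*} [NormedAddCommGroup E] [InnerProductSpace ℂ E]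

theorem norm_add_I_smul_sq_of_inner_comm {f h : E} (hfh : inner ℂ h f = inner ℂ f h) :
    ‖h + Complex.I • f‖ ^ 2 = ‖h‖ ^ 2 + ‖f‖ ^ 2 := by
  have him : (inner ℂ h f).im = 0 := by
    rw [← Complex.conj_eq_iff_im, inner_conj_symm, hfh]
  rw [norm_add_sq (𝕜 := ℂ), inner_smul_right, norm_smul]
  simp [him]

/-- The basic criterion for essential self-adjointness: `‖h + i f‖² = ‖h‖² + ‖f‖²` on the graph of a
symmetric operator, so approximating `h + i f` approximates `f` and `h` separately. -/
theorem graph_le_topologicalClosure_of_dense {M : E →ₗ.[ℂ] E}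
    (hM : M.graph ≤ M.graph.adjoint) {G : Submodule ℂ (E × E)} (hG : G ≤ M.graph)
    (hdense : Dense ((fun p : E × E => p.2 + Complex.I • p.1) '' G)) :
    M.graph ≤ G.topologicalClosure := by
  rintro ⟨f, h⟩ hfh
  refine Metric.mem_closure_iff.2 fun ε hε => ?_
  obtain ⟨_, ⟨⟨u, v⟩, huv, rfl⟩, hlt⟩ := Metric.mem_closure_iff.1 (hdense (h + Complex.I • f)) ε hε
  refine ⟨(u, v), huv, ?_⟩
  have hmem : (f - u, h - v) ∈ M.graph := M.graph.sub_mem hfh (hG huv)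
  have hsq := norm_add_I_smul_sq_of_inner_comm
    (mem_adjoint_iff_inner_eq.1 (hM hmem) _ _ hmem)
  have hdiff : h - v + Complex.I • (f - u) = h + Complex.I • f - (v + Complex.I • u) := by
    rw [smul_sub]
    abel
  rw [hdiff, ← dist_eq_norm] at hsq
  have hlt_sq := pow_lt_pow_left₀ hlt dist_nonneg two_ne_zero
  rw [Prod.dist_eq, dist_eq_norm, dist_eq_norm]
  exact max_lt (lt_of_pow_lt_pow_left₀ 2 hε.le (by nlinarith [sq_nonneg ‖h - v‖]))
    (lt_of_pow_lt_pow_left₀ 2 hε.le (by nlinarith [sq_nonneg ‖f - u‖]))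

end Core

/-! ### Operators that restrict to a common core -/

section ActsAs

variable {S E : Type*} [AddCommGroup S] [Module ℂ S] [NormedAddCommGroup E]
  [InnerProductSpace ℂ E] {ι : S →ₗ[ℂ] E} {L M : E →ₗ.[ℂ] E}
  {ℓ ℓ' m m' : Module.End ℂ S}

/-- `L` extends the linear map `ℓ` of a space `S` embedded by `ι`, and the formal adjoint of `L`
extends `ℓ'`. -/
structure ActsAs (ι : S →ₗ[ℂ] E) (L : E →ₗ.[ℂ] E) (ℓ ℓ' : Module.End ℂ S) : Prop where
  mem_graph : ∀ f, (ι f, ι (ℓ f)) ∈ L.graph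
  mem_adjoint : ∀ f, (ι f, ι (ℓ' f)) ∈ L.graph.adjoint

namespace ActsAs

theorem add (hL : ActsAs ι L ℓ ℓ') (hM : ActsAs ι M m m') :
    ActsAs ι (L + M) (ℓ + m) (ℓ' + m') where
  mem_graph f := mem_graph_add_iff.2 ⟨_, _, hL.mem_graph f, hM.mem_graph f, (map_add ι _ _).symm⟩
  mem_adjoint f := mem_adjoint_iff_inner_eq.2 fun u w huw => by
    obtain ⟨v₁, v₂, h₁, h₂, rfl⟩ := mem_graph_add_iff.1 huw
    rw [inner_add_left, mem_adjoint_iff_inner_eq.1 (hL.mem_adjoint f) _ _ h₁,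
      mem_adjoint_iff_inner_eq.1 (hM.mem_adjoint f) _ _ h₂, ← inner_add_right, ← map_add]
    rfl

theorem sub (hL : ActsAs ι L ℓ ℓ') (hM : ActsAs ι M m m') :
    ActsAs ι (L - M) (ℓ - m) (ℓ' - m') where
  mem_graph f := mem_graph_sub_iff.2 ⟨_, _, hL.mem_graph f, hM.mem_graph f, (map_sub ι _ _).symm⟩
  mem_adjoint f := mem_adjoint_iff_inner_eq.2 fun u w huw => by
    obtain ⟨v₁, v₂, h₁, h₂, rfl⟩ := mem_graph_sub_iff.1 huw
    rw [inner_sub_left, mem_adjoint_iff_inner_eq.1 (hL.mem_adjoint f) _ _ h₁,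
      mem_adjoint_iff_inner_eq.1 (hM.mem_adjoint f) _ _ h₂, ← inner_sub_right, ← map_sub]
    rfl

theorem smul (c : ℂ) (hL : ActsAs ι L ℓ ℓ') :
    ActsAs ι (c • L) (c • ℓ) (starRingEnd ℂ c • ℓ') where
  mem_graph f := mem_graph_smul_iff.2 ⟨_, hL.mem_graph f, (map_smul ι c _).symm⟩
  mem_adjoint f := mem_adjoint_iff_inner_eq.2 fun u w huw => by
    obtain ⟨v, huv, rfl⟩ := mem_graph_smul_iff.1 huw
    rw [inner_smul_left, mem_adjoint_iff_inner_eq.1 (hL.mem_adjoint f) _ _ huv,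
      ← inner_smul_right, ← map_smul]
    rfl

theorem scalarOp (ι : S →ₗ[ℂ] E) (c : ℂ) :
    ActsAs ι (scalarOp c) (c • 1) (starRingEnd ℂ c • 1) where
  mem_graph f := mem_graph_scalarOp_iff.2 (map_smul ι c f).symm
  mem_adjoint f := mem_adjoint_iff_inner_eq.2 fun u w huw => by
    rw [← mem_graph_scalarOp_iff.1 huw, inner_smul_left, ← inner_smul_right, ← map_smul]
    rfl

theorem opMul (hL : ActsAs ι L ℓ ℓ') (hM : ActsAs ι M m m') :
    ActsAs ι (opMul L M) (ℓ * m) (m' * ℓ') where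
  mem_graph f := mem_graph_opMul_iff.2 ⟨_, hM.mem_graph f, hL.mem_graph _⟩
  mem_adjoint f := mem_adjoint_iff_inner_eq.2 fun u w huw => by
    obtain ⟨v, huv, hvw⟩ := mem_graph_opMul_iff.1 huw
    rw [mem_adjoint_iff_inner_eq.1 (hL.mem_adjoint f) _ _ hvw,
      mem_adjoint_iff_inner_eq.1 (hM.mem_adjoint _) _ _ huv]
    rfl

theorem app_iterate (hL : ActsAs ι L ℓ ℓ') (n : ℕ) (f : S) :
    (app L)^[n] (ι f) = ι ((ℓ ^ n) f) := by
  induction n generalizing f with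
  | zero => rfl
  | succ n ih =>
    rw [Function.iterate_succ_apply, app_eq_of_mem_graph (hL.mem_graph f), ih, pow_succ]
    rfl

theorem stableUnder (hL : ActsAs ι L ℓ ℓ') {p : Submodule ℂ S} (hp : ∀ f ∈ p, ℓ f ∈ p) :
    StableUnder (p.map ι) L := by
  rintro _ ⟨f, hf, rfl⟩
  exact ⟨_, Submodule.mem_map_of_mem (hp f hf), hL.mem_graph f⟩

theorem inner_map_left (hL : ActsAs ι L ℓ ℓ') (f g : S) :
    inner ℂ (ι (ℓ f)) (ι g) = inner ℂ (ι f) (ι (ℓ' g)) :=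
  mem_adjoint_iff_inner_eq.1 (hL.mem_adjoint g) _ _ (hL.mem_graph f)

theorem dense_domain (hι : DenseRange ι) (hL : ActsAs ι L ℓ ℓ') : Dense (L.domain : Set E) :=
  hι.mono (by
    rintro _ ⟨f, rfl⟩
    exact LinearPMap.mem_domain_of_mem_graph (hL.mem_graph f))

theorem adjoint [CompleteSpace E] (hι : DenseRange ι) (hL : ActsAs ι L ℓ ℓ') :
    ActsAs ι L† ℓ' ℓ where
  mem_graph f := by
    rw [LinearPMap.adjoint_graph_eq_graph_adjoint (hL.dense_domain hι)]
    exact hL.mem_adjoint f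
  mem_adjoint f := by
    rw [LinearPMap.adjoint_graph_eq_graph_adjoint (hL.dense_domain hι)]
    refine mem_adjoint_iff_inner_eq.2 fun u v huv => ?_
    rw [← inner_conj_symm, ← mem_adjoint_iff_inner_eq.1 huv _ _ (hL.mem_graph f),
      inner_conj_symm]

theorem closure (hL : ActsAs ι L ℓ ℓ') (hclosable : L.IsClosable) :
    ActsAs ι L.closure ℓ ℓ' where
  mem_graph f := LinearPMap.le_graph_of_le L.le_closure (hL.mem_graph f)
  mem_adjoint f := by
    rw [← hclosable.graph_closure_eq_closure_graph]
    exact mem_adjoint_topologicalClosure (hL.mem_adjoint f)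

theorem closure_eq [CompleteSpace E] {M : E →ₗ.[ℂ] E} (hL : ActsAs ι L ℓ ℓ)
    (hM : IsSelfAdjoint M)
    (hcore : M.graph ≤ (LinearMap.range (ι.prod (ι ∘ₗ ℓ))).topologicalClosure) :
    L.closure = M := by
  have hLM : L ≤ M := by
    refine LinearPMap.le_of_le_graph fun ⟨f, g⟩ hfg => ?_
    have hadj : (f, g) ∈ (LinearMap.range (ι.prod (ι ∘ₗ ℓ))).adjoint := by
      refine mem_adjoint_iff_inner_eq.2 ?_
      rintro _ _ ⟨u, ⟨⟩⟩
      change inner ℂ (ι (ℓ u)) f = inner ℂ (ι u) g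
      rw [← inner_conj_symm, ← mem_adjoint_iff_inner_eq.1 (hL.mem_adjoint u) _ _ hfg,
        inner_conj_symm]
    rw [← graph_adjoint_of_isSelfAdjoint hM]
    exact mem_adjoint_iff_inner_eq.2 fun u v huv =>
      mem_adjoint_iff_inner_eq.1 (mem_adjoint_topologicalClosure hadj) u v (hcore huv)
  have hclosable : L.IsClosable := hM.isClosed.isClosable.leIsClosable hLM
  refine LinearPMap.eq_of_eq_graph (le_antisymm ?_ ?_) <;>
    rw [← hclosable.graph_closure_eq_closure_graph]
  · exact Submodule.topologicalClosure_minimal _ (LinearPMap.le_graph_of_le hLM) hM.isClosed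
  · refine hcore.trans (Submodule.topologicalClosure_mono ?_)
    rintro _ ⟨u, rfl⟩
    exact hL.mem_graph u

end ActsAs

theorem isPseudoBosonic_map [CompleteSpace E] {κ : Type*} [DecidableEq κ] (hι : DenseRange ι)
    {a b : κ → (E →ₗ.[ℂ] E)} {α α' β β' : κ → Module.End ℂ S}
    (ha : ∀ j, ActsAs ι (a j) (α j) (α' j)) (hb : ∀ j, ActsAs ι (b j) (β j) (β' j))
    (hαβ : ∀ j k, ⁅α j, β k⁆ = if j = k then 1 else 0)
    (hαα : ∀ j k, ⁅α j, α k⁆ = 0) (hββ : ∀ j k, ⁅β j, β k⁆ = 0)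
    {p : Submodule ℂ S} (hp : Dense (p.map ι : Set E))
    (hα : ∀ j, ∀ f ∈ p, α j f ∈ p) (hβ : ∀ j, ∀ f ∈ p, β j f ∈ p)
    (hα' : ∀ j, ∀ f ∈ p, α' j f ∈ p) (hβ' : ∀ j, ∀ f ∈ p, β' j f ∈ p) :
    IsPseudoBosonic (p.map ι) a b where
  dense := hp
  stable_a j := (ha j).stableUnder (hα j)
  stable_b j := (hb j).stableUnder (hβ j)
  stable_a_adj j := ((ha j).adjoint hι).stableUnder (hα' j)
  stable_b_adj j := ((hb j).adjoint hι).stableUnder (hβ' j)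
  comm_ab j k := by
    rintro _ ⟨f, -, rfl⟩
    have h := (((ha j).opMul (hb k)).sub ((hb k).opMul (ha j))).mem_graph f
    rw [← Ring.lie_def, hαβ] at h
    split_ifs at h ⊢
    · exact h
    · simpa using h
  comm_aa j k := by
    rintro _ ⟨f, -, rfl⟩
    have h := (((ha j).opMul (ha k)).sub ((ha k).opMul (ha j))).mem_graph f
    rwa [← Ring.lie_def, hαα, LinearMap.zero_apply, map_zero] at h
  comm_bb j k := by
    rintro _ ⟨f, -, rfl⟩
    have h := (((hb j).opMul (hb k)).sub ((hb k).opMul (hb j))).mem_graph f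
    rwa [← Ring.lie_def, hββ, LinearMap.zero_apply, map_zero] at h

end ActsAs

/-! ### Transport of operators along unitary maps -/

section Pullback

variable {E F : Type*} [NormedAddCommGroup E] [InnerProductSpace ℂ E]
  [NormedAddCommGroup F] [InnerProductSpace ℂ F]

/-- The operator `U⁻¹ M U`, with domain `U⁻¹ D(M)`. -/
def pullback (U : E ≃ₗᵢ[ℂ] F) (M : F →ₗ.[ℂ] F) : E →ₗ.[ℂ] E where
  domain := M.domain.comap U.toLinearEquiv.toLinearMap
  toFun := U.symm.toLinearEquiv.toLinearMap ∘ₗ M.toFun ∘ₗ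
    U.toLinearEquiv.toLinearMap.submoduleComap M.domain

theorem mem_graph_pullback_iff {U : E ≃ₗᵢ[ℂ] F} {M : F →ₗ.[ℂ] F} {f g : E} :
    (f, g) ∈ (pullback U M).graph ↔ (U f, U g) ∈ M.graph := by
  simp only [mem_graph_iff_exists_apply_eq]
  exact exists_congr fun hf => U.symm_apply_eq

theorem dense_domain_pullback {U : E ≃ₗᵢ[ℂ] F} {M : F →ₗ.[ℂ] F} (hM : Dense (M.domain : Set F)) :
    Dense ((pullback U M).domain : Set E) :=
  hM.preimage U.toHomeomorph.isOpenMap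

theorem mem_adjoint_graph_pullback_iff {U : E ≃ₗᵢ[ℂ] F} {M : F →ₗ.[ℂ] F} {f g : E} :
    (f, g) ∈ (pullback U M).graph.adjoint ↔ (U f, U g) ∈ M.graph.adjoint := by
  simp only [mem_adjoint_iff_inner_eq, mem_graph_pullback_iff]
  refine U.toEquiv.forall_congr fun u => U.toEquiv.forall_congr fun v => ?_
  simp

theorem isSelfAdjoint_pullback [CompleteSpace E] [CompleteSpace F] (U : E ≃ₗᵢ[ℂ] F)
    {M : F →ₗ.[ℂ] F} (hM : IsSelfAdjoint M) : IsSelfAdjoint (pullback U M) := by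
  refine isSelfAdjoint_of_graph_adjoint (dense_domain_pullback hM.dense_domain) ?_
  ext ⟨f, g⟩
  rw [mem_adjoint_graph_pullback_iff, mem_graph_pullback_iff, graph_adjoint_of_isSelfAdjoint hM]

end Pullback

/-! ### Multiplication operators and their exponentials -/

section MulOp

variable {α : Type*} [MeasurableSpace α] {μ : Measure α}

theorem mem_graph_mulOp_iff {g : α → ℝ} {f h : Lp ℂ 2 μ} :
    (f, h) ∈ (mulOp μ g).graph ↔ h =ᵐ[μ] fun x => (g x : ℂ) * f x := by
  rw [mem_graph_iff_exists_apply_eq]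
  constructor
  · rintro ⟨hf, rfl⟩
    exact MemLp.coeFn_toLp hf
  · intro hh
    have hf : MemLp (fun x => (g x : ℂ) * f x) 2 μ := (memLp_congr_ae hh).1 (Lp.memLp h)
    exact ⟨hf, Lp.ext ((MemLp.coeFn_toLp hf).trans hh.symm)⟩

theorem exists_mem_graph_mulOp_of_memLp {g : α → ℝ} {f : Lp ℂ 2 μ}
    (hf : MemLp (fun x => (g x : ℂ) * f x) 2 μ) : ∃ h, (f, h) ∈ (mulOp μ g).graph :=
  ⟨hf.toLp _, mem_graph_mulOp_iff.2 hf.coeFn_toLp⟩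

theorem exists_mem_graph_mulOp_of_bounded {g : α → ℝ} (hg : Measurable g) {C : ℝ}
    (hC : ∀ x, |g x| ≤ C) (f : Lp ℂ 2 μ) : ∃ h, (f, h) ∈ (mulOp μ g).graph := by
  refine exists_mem_graph_mulOp_of_memLp (MemLp.of_le_mul (Lp.memLp f)
    ((Complex.measurable_ofReal.comp hg).aestronglyMeasurable.mul (Lp.aestronglyMeasurable f))
    (c := C) (Filter.Eventually.of_forall fun x => ?_))
  rw [norm_mul, Complex.norm_real, Real.norm_eq_abs]
  exact mul_le_mul_of_nonneg_right (hC x) (norm_nonneg _)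

theorem graph_mulOp_le_adjoint (g : α → ℝ) : (mulOp μ g).graph ≤ (mulOp μ g).graph.adjoint := by
  rintro ⟨f, h⟩ hfh
  refine mem_adjoint_iff_inner_eq.2 fun u v huv => ?_
  rw [mem_graph_mulOp_iff] at hfh huv
  rw [L2.inner_def, L2.inner_def]
  refine integral_congr_ae ?_
  filter_upwards [hfh, huv] with x h1 h2
  rw [h1, h2]
  simp only [RCLike.inner_apply, map_mul, Complex.conj_ofReal]
  ring

theorem inner_mulOp_comm {g : α → ℝ} {f h u v : Lp ℂ 2 μ} (hfh : (f, h) ∈ (mulOp μ g).graph)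
    (huv : (u, v) ∈ (mulOp μ g).graph) : inner ℂ v f = inner ℂ u h :=
  mem_adjoint_iff_inner_eq.1 (graph_mulOp_le_adjoint g hfh) u v huv

theorem ae_eq_on_of_inner_eq {g : α → ℝ} (hg : Measurable g) {s : Set α} (hs : MeasurableSet s)
    {C : ℝ} (hC : ∀ x ∈ s, |g x| ≤ C) {f h : Lp ℂ 2 μ}
    (H : ∀ u v : Lp ℂ 2 μ, (u, v) ∈ (mulOp μ g).graph → (∀ᵐ x ∂μ, u x ≠ 0 → x ∈ s) →
      inner ℂ v f = inner ℂ u h) :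
    ∀ᵐ x ∂μ, x ∈ s → h x = (g x : ℂ) * f x := by
  have hg_bdd : ∀ x, |s.indicator g x| ≤ |C| := fun x => by
    by_cases hx : x ∈ s
    · simpa [hx] using (hC x hx).trans (le_abs_self C)
    · simp [hx]
  have h1_bdd : ∀ x, |s.indicator (1 : α → ℝ) x| ≤ 1 := fun x => by
    by_cases hx : x ∈ s <;> simp [hx]
  have cutMul := exists_mem_graph_mulOp_of_bounded (μ := μ) (hg.indicator hs) hg_bdd
  have cut := exists_mem_graph_mulOp_of_bounded (μ := μ) (measurable_one.indicator hs) h1_bdd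
  obtain ⟨f', hf'⟩ := cutMul f
  obtain ⟨h', hh'⟩ := cut h
  have heq : f' = h' := ext_inner_left ℂ fun w => by
    obtain ⟨v, hv⟩ := cutMul w
    obtain ⟨u, hu⟩ := cut w
    have huv : (u, v) ∈ (mulOp μ g).graph := by
      rw [mem_graph_mulOp_iff]
      filter_upwards [mem_graph_mulOp_iff.1 hv, mem_graph_mulOp_iff.1 hu] with x hvx hux
      rw [hvx, hux]
      by_cases hx : x ∈ s <;> simp [hx]
    rw [← inner_mulOp_comm hf' hv, ← inner_mulOp_comm hh' hu]
    refine H u v huv ?_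
    filter_upwards [mem_graph_mulOp_iff.1 hu] with x hux
    contrapose!
    intro hx
    rw [hux, Set.indicator_of_notMem hx, Complex.ofReal_zero, zero_mul]
  filter_upwards [mem_graph_mulOp_iff.1 hf', mem_graph_mulOp_iff.1 hh'] with x hf'x hh'x hx
  rw [← heq, hf'x, Set.indicator_of_mem hx, Set.indicator_of_mem hx, Pi.one_apply,
    Complex.ofReal_one, one_mul] at hh'x
  exact hh'x.symm

theorem mem_graph_mulOp_of_truncated {g k : α → ℝ} (hg : Measurable g) (hk : Measurable k)
    (hb : ∀ n : ℕ, ∃ C, ∀ x, |k x| ≤ n → |g x| ≤ C) {f h : Lp ℂ 2 μ}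
    (H : ∀ u v : Lp ℂ 2 μ, (u, v) ∈ (mulOp μ g).graph →
      (∃ n : ℕ, ∀ᵐ x ∂μ, u x ≠ 0 → |k x| ≤ n) → inner ℂ v f = inner ℂ u h) :
    (f, h) ∈ (mulOp μ g).graph := by
  have hcut : ∀ n : ℕ, ∀ᵐ x ∂μ, |k x| ≤ n → h x = (g x : ℂ) * f x := fun n => by
    obtain ⟨C, hC⟩ := hb n
    exact ae_eq_on_of_inner_eq (s := {x | |k x| ≤ n}) hg (measurableSet_le hk.abs measurable_const)
      hC fun u v huv hu => H u v huv ⟨n, hu⟩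
  rw [mem_graph_mulOp_iff]
  filter_upwards [ae_all_iff.2 hcut] with x hx
  obtain ⟨n, hn⟩ := exists_nat_ge |k x|
  exact hx n hn

theorem dense_domain_mulOp {g : α → ℝ} (hg : Measurable g) :
    Dense ((mulOp μ g).domain : Set (Lp ℂ 2 μ)) := by
  rw [Submodule.dense_iff_topologicalClosure_eq_top, Submodule.topologicalClosure_eq_top_iff,
    Submodule.eq_bot_iff]
  intro k hk
  have h0 : ((0 : Lp ℂ 2 μ), k) ∈ (mulOp μ g).graph := by
    refine mem_graph_mulOp_of_truncated hg hg (fun n => ⟨n, fun _ h => h⟩) fun u v huv _ => ?_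
    rw [inner_zero_right, (Submodule.mem_orthogonal _ _).1 hk u
      (LinearPMap.mem_domain_of_mem_graph huv)]
  exact LinearPMap.graph_fst_eq_zero_snd _ h0 rfl

theorem isSelfAdjoint_mulOp {g : α → ℝ} (hg : Measurable g) : IsSelfAdjoint (mulOp μ g) :=
  isSelfAdjoint_of_graph_adjoint (dense_domain_mulOp hg) <|
    le_antisymm (fun ⟨_, _⟩ hfh => mem_graph_mulOp_of_truncated hg hg (fun n => ⟨n, fun _ h => h⟩)
      fun u v huv _ => mem_adjoint_iff_inner_eq.1 hfh u v huv) (graph_mulOp_le_adjoint g)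

theorem norm_sq_eq_integral_norm_sq (f : Lp ℂ 2 μ) : ‖f‖ ^ 2 = ∫ x, ‖f x‖ ^ 2 ∂μ := by
  have h : (‖f‖ : ℂ) ^ 2 = ∫ x, ((‖f x‖ ^ 2 : ℝ) : ℂ) ∂μ := by
    refine (inner_self_eq_norm_sq_to_K (𝕜 := ℂ) f).symm.trans ?_
    rw [L2.inner_def]
    exact integral_congr_ae (Filter.Eventually.of_forall fun x => by
      simp only [inner_self_eq_norm_sq_to_K, Complex.coe_algebraMap, Complex.ofReal_pow])
  rw [integral_complex_ofReal] at h
  exact_mod_cast h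

theorem norm_ae_eq_of_norm_le {f h : Lp ℂ 2 μ} (hle : ∀ᵐ x ∂μ, ‖f x‖ ≤ ‖h x‖)
    (hnorm : ‖h‖ ≤ ‖f‖) : ∀ᵐ x ∂μ, ‖f x‖ = ‖h x‖ := by
  have hint (k : Lp ℂ 2 μ) : Integrable (fun x => ‖k x‖ ^ 2) μ :=
    (memLp_two_iff_integrable_sq_norm (Lp.aestronglyMeasurable k)).1 (Lp.memLp k)
  have hnonneg : ∀ᵐ x ∂μ, 0 ≤ ‖h x‖ ^ 2 - ‖f x‖ ^ 2 := by
    filter_upwards [hle] with x hx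
    exact sub_nonneg.2 (pow_le_pow_left₀ (norm_nonneg _) hx 2)
  have hzero : ∫ x, (‖h x‖ ^ 2 - ‖f x‖ ^ 2) ∂μ = 0 := by
    refine le_antisymm ?_ (integral_nonneg_of_ae hnonneg)
    rw [integral_sub (hint h) (hint f), ← norm_sq_eq_integral_norm_sq,
      ← norm_sq_eq_integral_norm_sq]
    exact sub_nonpos.2 (pow_le_pow_left₀ (norm_nonneg _) hnorm 2)
  filter_upwards [(integral_eq_zero_iff_of_nonneg_ae hnonneg ((hint h).sub (hint f))).1 hzero]
    with x hx
  exact (pow_left_inj₀ (norm_nonneg _) (norm_nonneg _) two_ne_zero).1 (sub_eq_zero.1 hx).symm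

theorem exists_mem_graph_mulOp_inv_one_add_abs {g : α → ℝ} (hg : Measurable g) (e : Lp ℂ 2 μ) :
    ∃ f h, (f, h) ∈ (mulOp μ g).graph ∧ ∀ᵐ x ∂μ, f x = ((1 + |g x|)⁻¹ : ℝ) * e x := by
  have hw : ∀ x, 0 < 1 + |g x| := fun x => by positivity
  obtain ⟨f, hf⟩ := exists_mem_graph_mulOp_of_bounded (g := fun x => (1 + |g x|)⁻¹) (C := 1)
    (by fun_prop) (fun x => by
      rw [abs_inv, abs_of_pos (hw x)]
      exact inv_le_one_of_one_le₀ (by linarith [abs_nonneg (g x)])) e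
  obtain ⟨h, hh⟩ := exists_mem_graph_mulOp_of_bounded (g := fun x => g x * (1 + |g x|)⁻¹) (C := 1)
    (by fun_prop) (fun x => by
      rw [abs_mul, abs_inv, abs_of_pos (hw x), ← div_eq_mul_inv, div_le_one (hw x)]
      linarith) e
  rw [mem_graph_mulOp_iff] at hf hh
  refine ⟨f, h, mem_graph_mulOp_iff.2 ?_, hf⟩
  filter_upwards [hf, hh] with x hfx hhx
  rw [hfx, hhx]
  push_cast
  ring

theorem ae_abs_le_of_mulOp_bounded [SigmaFinite μ] {g : α → ℝ} (hg : Measurable g) {M : ℝ}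
    (hM : ∀ f h, (f, h) ∈ (mulOp μ g).graph → ‖h‖ ≤ M * ‖f‖) : ∀ᵐ x ∂μ, |g x| ≤ |M| := by
  by_contra hae
  obtain ⟨t, ht_meas, ht_sub, ht_pos, ht_fin⟩ := Measure.exists_subset_measure_lt_top
    (measurableSet_lt measurable_const hg.abs) (pos_iff_ne_zero.2 fun h0 =>
      hae ((ae_iff.2 (by simpa using h0) : ∀ᵐ x ∂μ, |g x| ≤ |M|)))
  let e : Lp ℂ 2 μ := indicatorConstLp 2 ht_meas ht_fin.ne 1
  have hw : ∀ x, 0 < 1 + |g x| := fun x => by positivity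
  obtain ⟨f, h, hfh, hf⟩ := exists_mem_graph_mulOp_inv_one_add_abs hg e
  have hnorm : ∀ᵐ x ∂μ, ‖(M • f) x‖ = |M| * (1 + |g x|)⁻¹ * ‖e x‖ ∧
      ‖h x‖ = |g x| * (1 + |g x|)⁻¹ * ‖e x‖ := by
    filter_upwards [hf, mem_graph_mulOp_iff.1 hfh, Lp.coeFn_smul M f] with x hfx hhx hMx
    simp only [hMx, hhx, Pi.smul_apply, hfx, norm_smul, norm_mul, Complex.norm_real,
      Real.norm_eq_abs, abs_inv, abs_of_pos (hw x), mul_assoc, and_self]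
  have he : ∀ᵐ x ∂μ, e x = t.indicator (fun _ => 1) x := indicatorConstLp_coeFn
  have hle : ∀ᵐ x ∂μ, ‖(M • f) x‖ ≤ ‖h x‖ := by
    filter_upwards [hnorm, he] with x ⟨hMx, hhx⟩ hex
    rw [hMx, hhx, hex]
    by_cases hx : x ∈ t
    · have hMg : |M| < |g x| := ht_sub hx
      have := hw x
      gcongr
    · simp [hx]
  have heq := norm_ae_eq_of_norm_le hle ((hM f h hfh).trans (by
    rw [norm_smul, Real.norm_eq_abs]
    gcongr
    exact le_abs_self M))
  refine ht_pos.ne' (measure_mono_null ?_ (ae_iff.1 (heq.and (hnorm.and he))))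
  rintro x hxt ⟨hx, ⟨hMx, hhx⟩, hex⟩
  have hMg : |M| < |g x| := ht_sub hxt
  rw [hMx, hhx, hex, Set.indicator_of_mem hxt, norm_one, mul_one, mul_one] at hx
  exact hMg.ne (mul_right_cancel₀ (inv_ne_zero (hw x).ne') hx)

theorem ae_eq_pow_mul_of_mem_graph_mulOp {g : α → ℝ} {z : ℕ → Lp ℂ 2 μ}
    (hz : ∀ m, (z m, z (m + 1)) ∈ (mulOp μ g).graph) (m : ℕ) :
    z m =ᵐ[μ] fun x => (g x : ℂ) ^ m * z 0 x := by
  induction m with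
  | zero => simp
  | succ m ih =>
    filter_upwards [ih, mem_graph_mulOp_iff.1 (hz m)] with x h1 h2
    rw [h2, h1, pow_succ]
    ring

theorem summable_inv_factorial_smul {E : Type*} [NormedAddCommGroup E] [NormedSpace ℂ E]
    [CompleteSpace E] {z : ℕ → E} {c M : ℝ} (hz : ∀ m, ‖z m‖ ≤ c * M ^ m) :
    Summable fun m : ℕ => (m.factorial : ℂ)⁻¹ • z m := by
  refine Summable.of_norm_bounded (g := fun m => c * (M ^ m / m.factorial))
    ((Real.summable_pow_div_factorial M).mul_left c) fun m => ?_
  rw [norm_smul, norm_inv, Complex.norm_natCast, mul_div_assoc', div_eq_inv_mul]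
  gcongr
  exact hz m

theorem coeFn_sum_smul_ae_eq {ι : Type*} (s : Finset ι) (c : ι → ℂ) (z : ι → Lp ℂ 2 μ) :
    (∑ m ∈ s, c m • z m : Lp ℂ 2 μ) =ᵐ[μ] fun x => ∑ m ∈ s, c m * z m x := by
  classical
  induction s using Finset.induction_on with
  | empty => exact Lp.coeFn_zero ℂ 2 μ
  | insert m s hm ih =>
    rw [Finset.sum_insert hm]
    filter_upwards [ih, Lp.coeFn_add (c m • z m) (∑ m ∈ s, c m • z m),
      Lp.coeFn_smul (c m) (z m)] with x hs hadd hsmul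
    rw [hadd, Pi.add_apply, hsmul, Pi.smul_apply, hs, smul_eq_mul, Finset.sum_insert hm]

theorem mem_graph_mulOp_exp_tsum {g : α → ℝ} {z : ℕ → Lp ℂ 2 μ} {c M : ℝ}
    (hz : ∀ m, (z m, z (m + 1)) ∈ (mulOp μ g).graph) (hzM : ∀ m, ‖z m‖ ≤ c * M ^ m) :
    (z 0, ∑' m : ℕ, (m.factorial : ℂ)⁻¹ • z m) ∈ (mulOp μ fun x => Real.exp (g x)).graph := by
  have hpart (n : ℕ) : ∀ᵐ x ∂μ, (∑ m ∈ Finset.range n, (m.factorial : ℂ)⁻¹ • z m : Lp ℂ 2 μ) x =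
      (∑ m ∈ Finset.range n, (g x : ℂ) ^ m / m.factorial) * z 0 x := by
    filter_upwards [coeFn_sum_smul_ae_eq (Finset.range n) (fun m => (m.factorial : ℂ)⁻¹) z,
      ae_all_iff.2 (ae_eq_pow_mul_of_mem_graph_mulOp hz)] with x hsum hpow
    rw [hsum, Finset.sum_mul]
    refine Finset.sum_congr rfl fun m _ => ?_
    rw [hpow, div_eq_inv_mul, mul_assoc]
  obtain ⟨ns, hns, hns_lim⟩ := (tendstoInMeasure_of_tendsto_Lp
    (summable_inv_factorial_smul hzM).hasSum.tendsto_sum_nat).exists_seq_tendsto_ae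
  rw [mem_graph_mulOp_iff]
  filter_upwards [hns_lim, ae_all_iff.2 hpart] with x hlim hx
  refine tendsto_nhds_unique hlim ?_
  simp only [hx]
  have hexp := (NormedSpace.expSeries_div_hasSum_exp (g x : ℂ)).tendsto_sum_nat.comp
    hns.tendsto_atTop
  rw [← Complex.exp_eq_exp_ℂ, ← Complex.ofReal_exp] at hexp
  exact hexp.mul_const _

theorem exists_powers_of_truncated {g : α → ℝ} (hg : Measurable g) {u : Lp ℂ 2 μ} {c : ℝ}
    (hu : ∀ᵐ x ∂μ, u x ≠ 0 → |g x| ≤ c) :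
    ∃ z : ℕ → Lp ℂ 2 μ, z 0 = u ∧ (∀ m, (z m, z (m + 1)) ∈ (mulOp μ g).graph) ∧
      ∀ m, ‖z m‖ ≤ ‖u‖ * c ^ m := by
  have hle : ∀ m, ∀ᵐ x ∂μ, ‖(g x : ℂ) ^ m * u x‖ ≤ c ^ m * ‖u x‖ := fun m => by
    filter_upwards [hu] with x hx
    by_cases h0 : u x = 0
    · simp [h0]
    · rw [norm_mul, norm_pow, Complex.norm_real, Real.norm_eq_abs]
      gcongr
      exact hx h0
  have hmem : ∀ m, MemLp (fun x => (g x : ℂ) ^ m * u x) 2 μ := fun m =>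
    MemLp.of_le_mul (Lp.memLp u) (((Complex.measurable_ofReal.comp hg).pow_const
      m).aestronglyMeasurable.mul (Lp.aestronglyMeasurable u)) (hle m)
  refine ⟨fun m => (hmem m).toLp _, Lp.ext ?_, fun m => ?_, fun m => ?_⟩
  · filter_upwards [(hmem 0).coeFn_toLp] with x hx
    rw [hx, pow_zero, one_mul]
  · rw [mem_graph_mulOp_iff]
    filter_upwards [(hmem m).coeFn_toLp, (hmem (m + 1)).coeFn_toLp] with x h1 h2
    rw [h1, h2, pow_succ]
    ring
  · rw [mul_comm]
    refine Lp.norm_le_mul_norm_of_ae_le_mul ?_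
    filter_upwards [(hmem m).coeFn_toLp, hle m] with x h1 h2
    rwa [h1]

end MulOp

section ExpUnique

variable {E : Type*} [NormedAddCommGroup E] [InnerProductSpace ℂ E]

-- Truncations of `U' v` are entire vectors of `K`, and on these both exponentials are given by the
-- same power series; symmetry transfers the identity to all of the graph.
theorem IsFunctionOf.exp_graph_le {K S S' : E →ₗ.[ℂ] E} (h : IsFunctionOf Real.exp K S)
    (h' : IsFunctionOf Real.exp K S') : S.graph ≤ S'.graph := by
  rintro ⟨f, k⟩ hfk
  obtain ⟨α, _, μ, _, g, U, -, hK, hS⟩ := h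
  obtain ⟨β, _, ν, _, g', U', hg', hK', hS'⟩ := h'
  rw [hS']
  refine mem_graph_mulOp_of_truncated (Real.measurable_exp.comp hg') hg'
    (fun n => ⟨Real.exp n, fun x hx => ?_⟩) fun u v huv ⟨n, hn⟩ => ?_
  · rw [Function.comp_apply, Real.abs_exp]
    exact Real.exp_le_exp.2 ((le_abs_self _).trans hx)
  obtain ⟨z, rfl, hz, hzn⟩ := exists_powers_of_truncated hg' hn
  let W : Lp ℂ 2 ν ≃ₗᵢ[ℂ] Lp ℂ 2 μ := U'.symm.trans U
  have hW (m : ℕ) : (W (z m), W (z (m + 1))) ∈ (mulOp μ g).graph := by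
    rw [LinearIsometryEquiv.trans_apply, LinearIsometryEquiv.trans_apply, ← hK, hK',
      U'.apply_symm_apply, U'.apply_symm_apply]
    exact hz m
  have hv : v = ∑' m : ℕ, (m.factorial : ℂ)⁻¹ • z m :=
    LinearPMap.mem_graph_snd_inj _ huv (mem_graph_mulOp_exp_tsum hz hzn) rfl
  have hWv : (W (z 0), W v) ∈ (mulOp μ fun x => Real.exp (g x)).graph := by
    have hsum : W v = ∑' m : ℕ, (m.factorial : ℂ)⁻¹ • W (z m) := by
      rw [hv]
      exact W.toContinuousLinearEquiv.map_tsum.trans (tsum_congr fun m => map_smul W _ _)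
    rw [hsum]
    exact mem_graph_mulOp_exp_tsum hW fun m => by rw [W.norm_map]; exact hzn m
  have hinner (w : Lp ℂ 2 ν) (e : E) : inner ℂ (W w) (U e) = inner ℂ w (U' e) := by
    rw [LinearIsometryEquiv.trans_apply, U.inner_map_map, ← U'.inner_map_map, U'.apply_symm_apply]
  rw [← hinner, ← hinner]
  exact inner_mulOp_comm ((hS f k).1 hfk) hWv

theorem IsFunctionOf.exp_unique {K S S' : E →ₗ.[ℂ] E} (h : IsFunctionOf Real.exp K S)
    (h' : IsFunctionOf Real.exp K S') : S = S' :=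
  LinearPMap.eq_of_eq_graph (le_antisymm (h.exp_graph_le h') (h'.exp_graph_le h))

end ExpUnique

section ExpGroup

variable {E : Type*} [NormedAddCommGroup E] [InnerProductSpace ℂ E]
  {α : Type*} [MeasurableSpace α] {μ : Measure α} {U : E ≃ₗᵢ[ℂ] Lp ℂ 2 μ} {g : α → ℝ}

/-- The operator `exp (t K)`, for the operator `K` that the unitary map `U` turns into
multiplication by `g`. -/
def expGroup (U : E ≃ₗᵢ[ℂ] Lp ℂ 2 μ) (g : α → ℝ) (t : ℝ) : E →ₗ.[ℂ] E :=
  pullback U (mulOp μ fun x => Real.exp (t * g x))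

theorem mem_graph_expGroup_iff {t : ℝ} {f h : E} : (f, h) ∈ (expGroup U g t).graph ↔
    U h =ᵐ[μ] fun x => (Real.exp (t * g x) : ℂ) * U f x := by
  rw [expGroup, mem_graph_pullback_iff, mem_graph_mulOp_iff]

theorem isSelfAdjoint_expGroup [CompleteSpace E] (U : E ≃ₗᵢ[ℂ] Lp ℂ 2 μ) (hg : Measurable g)
    (t : ℝ) : IsSelfAdjoint (expGroup U g t) :=
  isSelfAdjoint_pullback U (isSelfAdjoint_mulOp (by fun_prop))

theorem inner_expGroup_comm {t : ℝ} {f h u v : E} (hfh : (f, h) ∈ (expGroup U g t).graph)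
    (huv : (u, v) ∈ (expGroup U g t).graph) : inner ℂ v f = inner ℂ u h := by
  rw [← U.inner_map_map, ← U.inner_map_map u]
  exact inner_mulOp_comm (mem_graph_pullback_iff.1 hfh) (mem_graph_pullback_iff.1 huv)

theorem mem_graph_expGroup_add {s t : ℝ} {f h k : E} (hfh : (f, h) ∈ (expGroup U g s).graph)
    (hhk : (h, k) ∈ (expGroup U g t).graph) : (f, k) ∈ (expGroup U g (s + t)).graph := by
  rw [mem_graph_expGroup_iff] at *
  filter_upwards [hfh, hhk] with x h1 h2
  rw [h2, h1, ← mul_assoc, ← Complex.ofReal_mul, ← Real.exp_add, ← add_mul, add_comm]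

theorem mem_graph_expGroup_neg_iff {t : ℝ} {f h : E} :
    (f, h) ∈ (expGroup U g (-t)).graph ↔ (h, f) ∈ (expGroup U g t).graph := by
  simp only [mem_graph_expGroup_iff]
  refine ⟨fun hfh => ?_, fun hfh => ?_⟩ <;>
  · filter_upwards [hfh] with x hx
    rw [hx, ← mul_assoc, ← Complex.ofReal_mul, ← Real.exp_add]
    simp

theorem ker_expGroup (U : E ≃ₗᵢ[ℂ] Lp ℂ 2 μ) (g : α → ℝ) (t : ℝ) :
    LinearMap.ker (expGroup U g t).toFun = ⊥ :=
  ker_eq_bot_of_graph fun _ hf =>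
    LinearPMap.graph_fst_eq_zero_snd _ (mem_graph_expGroup_neg_iff.2 hf) rfl

theorem inverse_expGroup (U : E ≃ₗᵢ[ℂ] Lp ℂ 2 μ) (g : α → ℝ) (t : ℝ) :
    (expGroup U g t).inverse = expGroup U g (-t) :=
  linearPMap_ext_graph fun f h => by
    rw [mem_graph_inverse_iff (ker_expGroup U g t), mem_graph_expGroup_neg_iff]

theorem memLp_exp_mul_of_mem_graph (hg : Measurable g) {s t : ℝ} (hst : 0 ≤ s * t) {f h : E}
    (hfh : (f, h) ∈ (expGroup U g (s + t)).graph) :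
    MemLp (fun x => (Real.exp (s * g x) : ℂ) * U f x) 2 μ := by
  refine MemLp.mono' (g := fun x => ‖U f x‖ + ‖U h x‖)
    ((Lp.memLp (U f)).norm.add (Lp.memLp (U h)).norm)
    ((Complex.measurable_ofReal.comp (by fun_prop)).aestronglyMeasurable.mul
      (Lp.aestronglyMeasurable _)) ?_
  filter_upwards [mem_graph_expGroup_iff.1 hfh] with x hx
  have hexp : Real.exp (s * g x) ≤ 1 + Real.exp ((s + t) * g x) := by
    rcases le_or_gt (s * g x) 0 with hneg | hpos
    · linarith [Real.exp_le_one_iff.2 hneg, Real.exp_pos ((s + t) * g x)]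
    · have htg : 0 ≤ t * g x := nonneg_of_mul_nonneg_right (a := s * g x)
        (by nlinarith [mul_nonneg hst (sq_nonneg (g x))]) hpos
      linarith [Real.exp_le_exp.2 (show s * g x ≤ (s + t) * g x by linarith)]
  rw [hx, norm_mul, norm_mul, Complex.norm_real, Complex.norm_real, Real.norm_eq_abs,
    Real.norm_eq_abs, Real.abs_exp, Real.abs_exp, ← one_add_mul]
  gcongr

theorem opMul_expGroup (U : E ≃ₗᵢ[ℂ] Lp ℂ 2 μ) (hg : Measurable g) {s t : ℝ} (hst : 0 ≤ s * t) :
    opMul (expGroup U g t) (expGroup U g s) = expGroup U g (s + t) := by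
  refine linearPMap_ext_graph fun f k => ⟨fun hfk => ?_, fun hfk => ?_⟩
  · obtain ⟨h, hfh, hhk⟩ := mem_graph_opMul_iff.1 hfk
    exact mem_graph_expGroup_add hfh hhk
  · have hmem := memLp_exp_mul_of_mem_graph hg hst hfk
    have hfh : (f, U.symm (hmem.toLp _)) ∈ (expGroup U g s).graph := by
      rw [mem_graph_expGroup_iff, U.apply_symm_apply]
      exact hmem.coeFn_toLp
    refine mem_graph_opMul_iff.2 ⟨_, hfh, ?_⟩
    have := mem_graph_expGroup_add (mem_graph_expGroup_neg_iff.2 hfh) hfk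
    rwa [neg_add_cancel_left] at this

theorem isFunctionOf_expGroup {α : Type} [MeasurableSpace α] {μ : Measure α} [SigmaFinite μ]
    {g : α → ℝ} (hg : Measurable g) (U : E ≃ₗᵢ[ℂ] Lp ℂ 2 μ) {K : E →ₗ.[ℂ] E} {t : ℝ}
    (hK : ∀ f h, (f, h) ∈ K.graph ↔ (U f, U h) ∈ (mulOp μ fun x => t * g x).graph) :
    IsFunctionOf Real.exp K (expGroup U g t) :=
  ⟨α, _, μ, inferInstance, fun x => t * g x, U, hg.const_mul t, hK,
    fun _ _ => mem_graph_pullback_iff⟩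

theorem ae_le_of_expGroup_one_bounded [SigmaFinite μ] (hg : Measurable g) {M : ℝ}
    (hM : ∀ f h, (f, h) ∈ (expGroup U g 1).graph → ‖h‖ ≤ M * ‖f‖) :
    ∀ᵐ x ∂μ, g x ≤ |M| := by
  have hbdd : ∀ᵐ x ∂μ, |Real.exp (1 * g x)| ≤ |M| :=
    ae_abs_le_of_mulOp_bounded (by fun_prop) fun f h hfh => by
      rw [← U.symm.norm_map h, ← U.symm.norm_map f]
      exact hM _ _ (mem_graph_pullback_iff.2 (by simpa using hfh))
  filter_upwards [hbdd] with x hx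
  rw [one_mul, Real.abs_exp] at hx
  linarith [Real.add_one_le_exp (g x)]

end ExpGroup

/-! ### Schwartz functions given by exponentials -/

section Exponentials

open scoped ContDiff Nat

variable {V : Type*} [NormedAddCommGroup V] [NormedSpace ℝ V]

theorem norm_iteratedFDeriv_cexp (n : ℕ) (z : ℂ) :
    ‖iteratedFDeriv ℝ n Complex.exp z‖ = Real.exp z.re := by
  have h : ContDiffAt ℂ n Complex.exp z := Complex.contDiff_exp.contDiffAt
  rw [← h.restrictScalars_iteratedFDeriv (𝕜 := ℝ), Function.comp_apply,
    ContinuousMultilinearMap.norm_restrictScalars, norm_iteratedFDeriv_eq_norm_iteratedDeriv,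
    iteratedDeriv_eq_iterate, Complex.iter_deriv_exp, Complex.norm_exp]

theorem exists_norm_iteratedFDeriv_cexp_comp_le {q : V → ℂ} (hq : q.HasTemperateGrowth) (n : ℕ) :
    ∃ (k : ℕ) (C : ℝ), 0 ≤ C ∧ ∀ x, ‖iteratedFDeriv ℝ n (fun x => Complex.exp (q x)) x‖ ≤
      C * (1 + ‖x‖) ^ k * Real.exp (q x).re := by
  obtain ⟨k, C, hC, h⟩ := hq.norm_iteratedFDeriv_le_uniform n
  refine ⟨k * n, n ! * (1 + C) ^ n, by positivity, fun x => ?_⟩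
  have h1 : (1 : ℝ) ≤ (1 + C) * (1 + ‖x‖) ^ k :=
    one_le_mul_of_one_le_of_one_le (by linarith) (one_le_pow₀ (by simp))
  have := norm_iteratedFDeriv_comp_le (𝕜 := ℝ) (g := Complex.exp) (N := ∞) (n := n)
    Complex.contDiff_exp hq.1 (mod_cast le_top) x (C := Real.exp (q x).re)
    (D := (1 + C) * (1 + ‖x‖) ^ k) (fun i _ => (norm_iteratedFDeriv_cexp i _).le)
    (fun i hi hin => (h i hin x).trans (le_trans
      (mul_le_mul_of_nonneg_right (by linarith) (by positivity)) (le_self_pow₀ h1 (by omega))))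
  refine this.trans_eq ?_
  rw [mul_pow, ← pow_mul]
  ring

theorem hasTemperateGrowth_cexp {q : V → ℂ} (hq : q.HasTemperateGrowth) (hre : ∀ x, (q x).re ≤ 0) :
    (fun x => Complex.exp (q x)).HasTemperateGrowth := by
  refine ⟨Complex.contDiff_exp.comp hq.1, fun n => ?_⟩
  obtain ⟨k, C, hC, h⟩ := exists_norm_iteratedFDeriv_cexp_comp_le hq n
  refine ⟨k, C, fun x => (h x).trans ?_⟩
  exact mul_le_of_le_one_right (by positivity) (Real.exp_le_one_iff.2 (hre x))

theorem one_add_pow_mul_exp_neg_sq_le (m : ℕ) {δ r : ℝ} (hδ : 0 < δ) (hr : 0 ≤ r) :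
    (1 + r) ^ m * Real.exp (-δ * r ^ 2) ≤ m ! * Real.exp (1 + 1 / (4 * δ)) := by
  have h1 : (1 + r) ^ m ≤ m ! * Real.exp (1 + r) := by
    have := Real.pow_div_factorial_le_exp (1 + r) (by linarith) m
    rwa [div_le_iff₀' (by positivity)] at this
  have h2 : r - δ * r ^ 2 ≤ 1 / (4 * δ) := by
    rw [le_div_iff₀ (by positivity)]
    nlinarith [sq_nonneg (2 * δ * r - 1)]
  calc (1 + r) ^ m * Real.exp (-δ * r ^ 2) ≤ m ! * Real.exp (1 + r) * Real.exp (-δ * r ^ 2) := by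
        gcongr
    _ = m ! * Real.exp (1 + (r - δ * r ^ 2)) := by
        rw [mul_assoc, ← Real.exp_add]
        ring_nf
    _ ≤ _ := by gcongr

/-- `exp ∘ q` as a Schwartz function, if `q` is of temperate growth and `Re q` tends to `-∞`
quadratically. -/
def expSchwartz (q : V → ℂ) (hq : q.HasTemperateGrowth)
    (hre : ∃ M δ : ℝ, 0 < δ ∧ ∀ x, (q x).re ≤ M - δ * ‖x‖ ^ 2) : 𝓢(V, ℂ) where
  toFun x := Complex.exp (q x)
  smooth' := Complex.contDiff_exp.comp hq.1
  decay' l n := by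
    obtain ⟨k, C, hC, h⟩ := exists_norm_iteratedFDeriv_cexp_comp_le hq n
    obtain ⟨M, δ, hδ, hM⟩ := hre
    refine ⟨C * Real.exp M * ((l + k) ! * Real.exp (1 + 1 / (4 * δ))), fun x => ?_⟩
    calc ‖x‖ ^ l * ‖iteratedFDeriv ℝ n (fun x => Complex.exp (q x)) x‖
        ≤ (1 + ‖x‖) ^ l * (C * (1 + ‖x‖) ^ k * Real.exp (M - δ * ‖x‖ ^ 2)) := by
          gcongr
          · linarith
          · exact (h x).trans (by gcongr; exact hM x)
      _ = C * Real.exp M * ((1 + ‖x‖) ^ (l + k) * Real.exp (-δ * ‖x‖ ^ 2)) := by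
          rw [sub_eq_add_neg, Real.exp_add, pow_add]
          ring_nf
      _ ≤ _ := by
          exact mul_le_mul_of_nonneg_left (one_add_pow_mul_exp_neg_sq_le _ hδ (norm_nonneg x))
            (by positivity)

end Exponentials

section Gaussian

variable {V : Type*} [NormedAddCommGroup V] [InnerProductSpace ℝ V] {z : ℂ}

/-- The exponent `-(z/2) ‖y‖² + L y` of a Gaussian, with a complex linear term `L`. -/
def quadExponent (z : ℂ) (L : V →L[ℝ] ℂ) (y : V) : ℂ := -(z / 2) * ((‖y‖ ^ 2 : ℝ) : ℂ) + L y

theorem hasTemperateGrowth_quadExponent (z : ℂ) (L : V →L[ℝ] ℂ) :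
    (quadExponent z L).HasTemperateGrowth := by
  unfold quadExponent
  fun_prop

theorem exists_re_quadExponent_le (hz : 0 < z.re) (L : V →L[ℝ] ℂ) :
    ∃ M δ : ℝ, 0 < δ ∧ ∀ y, (quadExponent z L y).re ≤ M - δ * ‖y‖ ^ 2 := by
  refine ⟨‖L‖ ^ 2 / z.re, z.re / 4, by positivity, fun y => ?_⟩
  have hL : (L y).re ≤ ‖L‖ * ‖y‖ := (Complex.re_le_norm _).trans (L.le_opNorm y)
  have hre : (quadExponent z L y).re = -(z.re / 2) * ‖y‖ ^ 2 + (L y).re := by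
    rw [quadExponent, Complex.add_re, Complex.re_mul_ofReal, Complex.neg_re, Complex.div_ofNat_re]
  have hsq : 0 ≤ (‖L‖ - z.re / 2 * ‖y‖) ^ 2 / z.re := by positivity
  have hexpand : (‖L‖ - z.re / 2 * ‖y‖) ^ 2 / z.re =
      ‖L‖ ^ 2 / z.re - ‖L‖ * ‖y‖ + z.re / 4 * ‖y‖ ^ 2 := by
    field_simp
    ring
  linarith

/-- The Schwartz function `exp (-(z/2) ‖y‖² + L y)`, for `0 < Re z`. -/
def gaussian (z : ℂ) (hz : 0 < z.re) (L : V →L[ℝ] ℂ) : 𝓢(V, ℂ) :=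
  expSchwartz (quadExponent z L) (hasTemperateGrowth_quadExponent z L)
    (exists_re_quadExponent_le hz L)

theorem gaussian_apply (hz : 0 < z.re) (L : V →L[ℝ] ℂ) (y : V) :
    gaussian z hz L y = Complex.exp (quadExponent z L y) := rfl

theorem hasFDerivAt_quadExponent (z : ℂ) (L : V →L[ℝ] ℂ) (y : V) :
    HasFDerivAt (quadExponent z L) (-z • Complex.ofRealCLM ∘L innerSL ℝ y + L) y := by
  have hsq := (Complex.ofRealCLM.hasFDerivAt.comp y
    (hasStrictFDerivAt_norm_sq y).hasFDerivAt).const_mul (-(z / 2))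
  convert! hsq.add L.hasFDerivAt using 1
  ext v
  simp
  ring

end Gaussian

/-! ### Position, momentum and ladder operators on Schwartz functions -/

section Weyl

variable {V : Type*} [NormedAddCommGroup V] [InnerProductSpace ℝ V]

theorem hasTemperateGrowth_ofReal_inner (v : V) :
    (fun y : V => ((inner ℝ y v : ℝ) : ℂ)).HasTemperateGrowth := by
  fun_prop

/-- The position operator in the direction `v`, multiplication by `⟪y, v⟫`. -/
def position (v : V) : Module.End ℂ 𝓢(V, ℂ) :=
  (SchwartzMap.smulLeftCLM ℂ fun y => ((inner ℝ y v : ℝ) : ℂ)).toLinearMap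

/-- The momentum operator `-i ∂_v` in the direction `v`. -/
def momentum (v : V) : Module.End ℂ 𝓢(V, ℂ) :=
  -Complex.I • (LineDeriv.lineDerivOpCLM ℂ 𝓢(V, ℂ) v).toLinearMap

theorem position_apply (v : V) (f : 𝓢(V, ℂ)) (y : V) :
    position v f y = (inner ℝ y v : ℝ) * f y :=
  SchwartzMap.smulLeftCLM_apply_apply (hasTemperateGrowth_ofReal_inner v) f y

theorem momentum_apply (v : V) (f : 𝓢(V, ℂ)) (y : V) :
    momentum v f y = -Complex.I * fderiv ℝ f y v := by
  rw [← SchwartzMap.lineDerivOp_apply_eq_fderiv]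
  rfl

theorem position_add (v w : V) : position (v + w) = position v + position w := by
  ext f y
  simp only [position_apply, LinearMap.add_apply, add_apply, inner_add_right]
  push_cast
  ring

theorem momentum_add (v w : V) : momentum (v + w) = momentum v + momentum w := by
  ext f y
  simp only [momentum_apply, LinearMap.add_apply, add_apply, map_add, mul_add]

theorem momentum_apply_of_hasFDerivAt {f : 𝓢(V, ℂ)} {f' : V →L[ℝ] ℂ} {y : V}
    (h : HasFDerivAt f f' y) (v : V) : momentum v f y = -Complex.I * f' v := by
  rw [momentum_apply, h.fderiv]

theorem lie_position_position (v w : V) : ⁅position v, position w⁆ = 0 := by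
  ext f y
  simp only [Ring.lie_def, LinearMap.sub_apply, Module.End.mul_apply, sub_apply, position_apply,
    LinearMap.zero_apply, zero_apply]
  ring

theorem lie_momentum_position (v w : V) :
    ⁅momentum v, position w⁆ = (-Complex.I * (inner ℝ v w : ℝ)) • 1 := by
  ext f y
  have hlin : HasFDerivAt (fun y : V => ((inner ℝ y w : ℝ) : ℂ))
      (Complex.ofRealCLM ∘L (innerSL ℝ).flip w) y :=
    (Complex.ofRealCLM ∘L (innerSL ℝ).flip w).hasFDerivAt
  have hmul := (hlin.mul f.differentiableAt.hasFDerivAt).congr_of_eventuallyEq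
    (Filter.Eventually.of_forall fun y => position_apply w f y)
  simp only [Ring.lie_def, LinearMap.sub_apply, Module.End.mul_apply, sub_apply,
    momentum_apply_of_hasFDerivAt hmul, position_apply, momentum_apply, LinearMap.smul_apply,
    Module.End.one_apply, smul_apply, add_apply, smul_eq_mul, ContinuousLinearMap.comp_apply,
    ContinuousLinearMap.flip_apply, innerSL_apply_apply, Complex.ofRealCLM_apply]
  ring

theorem lie_momentum_momentum (v w : V) : ⁅momentum v, momentum w⁆ = 0 := by
  have hsecond (v w : V) (f : 𝓢(V, ℂ)) (y : V) :
      momentum v (momentum w f) y = -fderiv ℝ (fderiv ℝ f) y v w := by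
    have hf : DifferentiableAt ℝ (fderiv ℝ f) y :=
      ((f.smooth 2).fderiv_right (m := 1) (by norm_num)).differentiable (by norm_num) y
    have h := ((((ContinuousLinearMap.apply ℝ ℂ w).hasFDerivAt.comp y hf.hasFDerivAt).const_mul
      (-Complex.I))).congr_of_eventuallyEq
        (Filter.Eventually.of_forall fun y => momentum_apply w f y)
    rw [momentum_apply_of_hasFDerivAt h]
    simp [← mul_assoc]
  ext f y
  have hsymm := ((f.smooth 2).contDiffAt (x := y)).isSymmSndFDerivAt (by simp) v w
  rw [Ring.lie_def, LinearMap.sub_apply, Module.End.mul_apply, Module.End.mul_apply, sub_apply,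
    hsecond, hsecond, hsymm, sub_self, LinearMap.zero_apply, zero_apply]

/-- The lowering operator `(x_v + i p_v + α) / √2`, shifted by the constant `α`. -/
def lowering (v : V) (α : ℂ) : Module.End ℂ 𝓢(V, ℂ) :=
  (1 / (√2 : ℝ) : ℂ) • (position v + Complex.I • momentum v + α • 1)

/-- The raising operator `(x_v - i p_v + β) / √2`, shifted by the constant `β`. -/
def raising (v : V) (β : ℂ) : Module.End ℂ 𝓢(V, ℂ) :=
  (1 / (√2 : ℝ) : ℂ) • (position v - Complex.I • momentum v + β • 1)

theorem inv_sqrt_two_mul_self : (1 / (√2 : ℝ) : ℂ) * (1 / (√2 : ℝ) : ℂ) = 1 / 2 := by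
  rw [div_mul_div_comm, one_mul, ← Complex.ofReal_mul, Real.mul_self_sqrt zero_le_two]
  norm_num

theorem momentum_position (v w : V) (f : 𝓢(V, ℂ)) : momentum v (position w f) =
    position w (momentum v f) - (Complex.I * (inner ℝ v w : ℝ)) • f := by
  have h := LinearMap.congr_fun (lie_momentum_position v w) f
  rw [Ring.lie_def, LinearMap.sub_apply, sub_eq_iff_eq_add'] at h
  rw [← Module.End.mul_apply, h, LinearMap.smul_apply, neg_mul, neg_smul, sub_eq_add_neg]
  rfl

theorem lowering_apply (v : V) (α : ℂ) (f : 𝓢(V, ℂ)) : lowering v α f =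
    (1 / (√2 : ℝ) : ℂ) • (position v f + Complex.I • momentum v f + α • f) := rfl

theorem raising_apply (v : V) (β : ℂ) (f : 𝓢(V, ℂ)) : raising v β f =
    (1 / (√2 : ℝ) : ℂ) • (position v f - Complex.I • momentum v f + β • f) := rfl

theorem position_comm (v w : V) (f : 𝓢(V, ℂ)) :
    position v (position w f) = position w (position v f) :=
  sub_eq_zero.1 (LinearMap.congr_fun (lie_position_position v w) f)

theorem momentum_comm (v w : V) (f : 𝓢(V, ℂ)) :
    momentum v (momentum w f) = momentum w (momentum v f) :=
  sub_eq_zero.1 (LinearMap.congr_fun (lie_momentum_momentum v w) f)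

theorem lie_lowering_raising (v w : V) (α β : ℂ) :
    ⁅lowering v α, raising w β⁆ = ((inner ℝ v w : ℝ) : ℂ) • 1 := by
  ext1 f
  simp only [Ring.lie_def, LinearMap.sub_apply, Module.End.mul_apply, lowering_apply,
    raising_apply, map_smul, map_add, map_sub, momentum_position, position_comm v w,
    momentum_comm v w, LinearMap.smul_apply, Module.End.one_apply]
  rw [real_inner_comm v w]
  match_scalars
  any_goals ring1
  linear_combination (-2 * Complex.I ^ 2 * (inner ℝ v w : ℝ)) * inv_sqrt_two_mul_self -
    ((inner ℝ v w : ℝ) : ℂ) * Complex.I_sq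

theorem lie_lowering_lowering (v w : V) (α β : ℂ) : ⁅lowering v α, lowering w β⁆ = 0 := by
  ext1 f
  simp only [Ring.lie_def, LinearMap.sub_apply, Module.End.mul_apply, lowering_apply, map_smul,
    map_add, momentum_position, position_comm v w, momentum_comm v w, LinearMap.zero_apply]
  rw [real_inner_comm v w]
  module

theorem lie_raising_raising (v w : V) (α β : ℂ) : ⁅raising v α, raising w β⁆ = 0 := by
  ext1 f
  simp only [Ring.lie_def, LinearMap.sub_apply, Module.End.mul_apply, raising_apply, map_smul,
    map_add, map_sub, momentum_position, position_comm v w, momentum_comm v w,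
    LinearMap.zero_apply]
  rw [real_inner_comm v w]
  module

theorem raising_lowering (v : V) (α β : ℂ) (f : 𝓢(V, ℂ)) : raising v β (lowering v α f) =
    (1 / 2 : ℂ) • (momentum v (momentum v f) + position v (position v f)) +
      ((α + β) / 2) • position v f + (Complex.I * (β - α) / 2) • momentum v f +
      ((α * β - (‖v‖ ^ 2 : ℝ)) / 2) • f := by
  simp only [raising_apply, lowering_apply, map_smul, map_add, momentum_position,
    real_inner_self_eq_norm_sq]
  have h2 := inv_sqrt_two_mul_self
  match_scalars
  · linear_combination h2
  · ring
  · linear_combination (Complex.I ^ 2 * (‖v‖ : ℂ) ^ 2 + α * β) * h2 +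
      (‖v‖ : ℂ) ^ 2 / 2 * Complex.I_sq
  · linear_combination (α + β) * h2
  · linear_combination (-Complex.I ^ 2) * h2 - 1 / 2 * Complex.I_sq
  · linear_combination Complex.I * (β - α) * h2

section Gaussian

variable {z : ℂ} {L : V →L[ℝ] ℂ}

theorem momentum_gaussian (hz : 0 < z.re) (L : V →L[ℝ] ℂ) (v : V) :
    momentum v (gaussian z hz L) =
      (Complex.I * z) • position v (gaussian z hz L) - (Complex.I * L v) • gaussian z hz L := by
  ext y
  rw [momentum_apply_of_hasFDerivAt (hasFDerivAt_quadExponent z L y).cexp]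
  simp only [add_apply, sub_apply, smul_apply, smul_eq_mul, position_apply, gaussian_apply,
    ContinuousLinearMap.comp_apply, innerSL_apply_apply, Complex.ofRealCLM_apply]
  ring

-- `h e^{-q}`, with `q` the exponent of the Gaussian, has vanishing derivative.
theorem exists_eq_const_mul_exp_quadExponent {h : 𝓢(V, ℂ)}
    (hh : ∀ v, momentum v h = (Complex.I * z) • position v h - (Complex.I * L v) • h) :
    ∃ N : ℂ, ∀ y, h y = N * Complex.exp (quadExponent z L y) := by
  have hder (y : V) : HasFDerivAt (fun y => h y * Complex.exp (-quadExponent z L y))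
      (0 : V →L[ℝ] ℂ) y := by
    convert! h.differentiableAt.hasFDerivAt.mul (hasFDerivAt_quadExponent z L y).neg.cexp using 1
    ext v
    have hv := DFunLike.congr_fun (hh v) y
    simp only [momentum_apply, position_apply, sub_apply, smul_apply, smul_eq_mul] at hv
    simp only [zero_apply, add_apply, neg_apply, smul_apply, smul_eq_mul,
      ContinuousLinearMap.comp_apply, innerSL_apply_apply, Complex.ofRealCLM_apply]
    linear_combination (-Complex.I * Complex.exp (-quadExponent z L y)) * hv -
      (z * (inner ℝ y v : ℝ) * h y - h y * L v + fderiv ℝ h y v) *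
        Complex.exp (-quadExponent z L y) * Complex.I_sq
  refine ⟨h 0 * Complex.exp (-quadExponent z L 0), fun y => ?_⟩
  have hconst := is_const_of_fderiv_eq_zero (𝕜 := ℝ) (fun y => (hder y).differentiableAt)
    (fun y => (hder y).fderiv) 0 y
  rw [hconst, mul_assoc, ← Complex.exp_add, neg_add_cancel, Complex.exp_zero, mul_one]

theorem lowering_gaussian (L : V →L[ℝ] ℂ) (v : V) :
    lowering v (-L v) (gaussian 1 (by simp) L) = 0 := by
  rw [lowering_apply, momentum_gaussian]
  match_scalars
  · linear_combination (1 / (√2 : ℝ) : ℂ) * Complex.I_sq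
  · linear_combination (-(1 / (√2 : ℝ) : ℂ) * L v) * Complex.I_sq

end Gaussian

end Weyl

/-! ### Schwartz functions in `L²` -/

section SchwartzL2

variable {V : Type*} [NormedAddCommGroup V] [InnerProductSpace ℝ V] [FiniteDimensional ℝ V]
  [MeasurableSpace V] [BorelSpace V]

variable (V) in
/-- The embedding of `𝒮(V)` in `L²(V)`; for `V = ℝ²` it is `embed` by definition. -/
def schwartzToL2 : 𝓢(V, ℂ) →ₗ[ℂ] Lp ℂ 2 (volume : Measure V) :=
  (SchwartzMap.toLpCLM ℂ ℂ 2 volume).toLinearMap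

theorem coeFn_schwartzToL2 (f : 𝓢(V, ℂ)) : schwartzToL2 V f =ᵐ[volume] f :=
  f.coeFn_toLp 2 volume

theorem denseRange_schwartzToL2 : DenseRange (schwartzToL2 V) :=
  SchwartzMap.denseRange_toLpCLM (by simp)

theorem schwartzToL2_injective : Function.Injective (schwartzToL2 V) :=
  SchwartzMap.injective_toLp 2 volume

theorem inner_schwartzToL2_left (w : 𝓢(V, ℂ)) (f : Lp ℂ 2 (volume : Measure V)) :
    inner ℂ (schwartzToL2 V w) f = ∫ y, starRingEnd ℂ (w y) * f y := by
  rw [L2.inner_def]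
  refine integral_congr_ae ?_
  filter_upwards [coeFn_schwartzToL2 w] with y hy
  rw [hy, RCLike.inner_apply, mul_comm]

theorem inner_schwartzToL2 (f g : 𝓢(V, ℂ)) :
    inner ℂ (schwartzToL2 V f) (schwartzToL2 V g) = ∫ y, starRingEnd ℂ (f y) * g y := by
  rw [inner_schwartzToL2_left]
  refine integral_congr_ae ?_
  filter_upwards [coeFn_schwartzToL2 g] with y hy
  rw [hy]

theorem integrable_schwartz_mul (w : 𝓢(V, ℂ)) (f : Lp ℂ 2 (volume : Measure V)) :
    Integrable (fun y => w y * f y) volume :=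
  (w.memLp 2 volume).integrable_mul (Lp.memLp f)

theorem inner_momentum_left (v : V) (f g : 𝓢(V, ℂ)) :
    inner ℂ (schwartzToL2 V (momentum v f)) (schwartzToL2 V g) =
      inner ℂ (schwartzToL2 V f) (schwartzToL2 V (momentum v g)) := by
  have hparts : ∫ y, starRingEnd ℂ (f y) * ∂_{v} g y = -∫ y, starRingEnd ℂ (∂_{v} f y) * g y :=
    SchwartzMap.integral_bilinear_lineDerivOp_right_eq_neg_left f g
      ((ContinuousLinearMap.mul ℝ ℂ).comp Complex.conjCLE.toContinuousLinearMap) v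
  calc inner ℂ (schwartzToL2 V (momentum v f)) (schwartzToL2 V g)
      = Complex.I * ∫ y, starRingEnd ℂ (∂_{v} f y) * g y := by
        change inner ℂ (schwartzToL2 V (-Complex.I • ∂_{v} f)) _ = _
        rw [map_smul, inner_smul_left, inner_schwartzToL2, map_neg, Complex.conj_I, neg_neg]
    _ = -Complex.I * ∫ y, starRingEnd ℂ (f y) * ∂_{v} g y := by
        rw [hparts, neg_mul_neg]
    _ = _ := by
        change _ = inner ℂ _ (schwartzToL2 V (-Complex.I • ∂_{v} g))
        rw [map_smul, inner_smul_right, inner_schwartzToL2]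

theorem mem_graph_mulOp_schwartzToL2_iff {g : V → ℝ} (hg : Continuous g) {f h : 𝓢(V, ℂ)} :
    (schwartzToL2 V f, schwartzToL2 V h) ∈ (mulOp volume g).graph ↔ ∀ y, h y = g y * f y := by
  rw [mem_graph_mulOp_iff]
  constructor
  · intro hfh
    have hae : h =ᵐ[volume] fun y => (g y : ℂ) * f y := by
      filter_upwards [hfh, coeFn_schwartzToL2 f, coeFn_schwartzToL2 h] with y hy hf hh
      rw [← hh, hy, hf]
    exact congrFun ((Continuous.ae_eq_iff_eq volume h.continuous (by fun_prop)).1 hae)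
  · intro hfh
    filter_upwards [coeFn_schwartzToL2 f, coeFn_schwartzToL2 h] with y hf hh
    rw [hh, hf, hfh]

theorem mem_graph_mulOp_position (v : V) (f : 𝓢(V, ℂ)) :
    (schwartzToL2 V f, schwartzToL2 V (position v f)) ∈
      (mulOp volume fun y => inner ℝ y v).graph :=
  (mem_graph_mulOp_schwartzToL2_iff (by fun_prop)).2 (position_apply v f)

theorem ae_eq_zero_of_integral_schwartz_mul {h : V → ℂ} (hh : LocallyIntegrable h volume)
    (H : ∀ ψ : 𝓢(V, ℂ), (∀ y, starRingEnd ℂ (ψ y) = ψ y) → ∫ y, ψ y * h y = 0) :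
    ∀ᵐ y, h y = 0 := by
  refine ae_eq_zero_of_integral_contDiff_smul_eq_zero hh fun g hg hgc => ?_
  have hc : HasCompactSupport fun y => (g y : ℂ) := hgc.comp_left Complex.ofReal_zero
  exact H (hc.toSchwartzMap (Complex.ofRealCLM.contDiff.comp hg)) fun y => Complex.conj_ofReal (g y)

section Core

variable {g : V → ℝ} (hg : (fun y => (g y : ℂ)).HasTemperateGrowth)

include hg in
theorem mem_graph_mulOp_of_inner_schwartz {f h : Lp ℂ 2 (volume : Measure V)}
    (H : ∀ w : 𝓢(V, ℂ), inner ℂ (schwartzToL2 V w) h =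
      inner ℂ (schwartzToL2 V (SchwartzMap.smulLeftCLM ℂ (fun y => (g y : ℂ)) w)) f) :
    (f, h) ∈ (mulOp volume g).graph := by
  have hgf : LocallyIntegrable (fun y => (g y : ℂ) * f y) volume :=
    ((Lp.memLp f).locallyIntegrable one_le_two).continuous_mul hg.1.continuous
  rw [mem_graph_mulOp_iff]
  have hzero : ∀ᵐ y, h y - (g y : ℂ) * f y = 0 := by
    refine ae_eq_zero_of_integral_schwartz_mul
      (((Lp.memLp h).locallyIntegrable one_le_two).sub hgf) fun ψ hψ => ?_
    have hint := integrable_schwartz_mul (SchwartzMap.smulLeftCLM ℂ (fun y => (g y : ℂ)) ψ) f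
    have hψgf := H ψ
    simp only [inner_schwartzToL2_left, SchwartzMap.smulLeftCLM_apply_apply hg, smul_eq_mul,
      map_mul, Complex.conj_ofReal, hψ] at hψgf hint
    rw [← sub_eq_zero, ← integral_sub (integrable_schwartz_mul ψ h) hint] at hψgf
    rw [← hψgf]
    exact integral_congr_ae (Filter.Eventually.of_forall fun y => by ring)
  filter_upwards [hzero] with y hy
  exact sub_eq_zero.1 hy

include hg in
/-- A vector orthogonal to the range of `g + i` on Schwartz functions satisfies `g k = i k`
weakly, hence vanishes. -/
theorem dense_range_mul_add_I_smul :
    DenseRange fun w => schwartzToL2 V (SchwartzMap.smulLeftCLM ℂ (fun y => (g y : ℂ)) w) +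
      Complex.I • schwartzToL2 V w := by
  set R : 𝓢(V, ℂ) →ₗ[ℂ] Lp ℂ 2 (volume : Measure V) :=
    schwartzToL2 V ∘ₗ (SchwartzMap.smulLeftCLM ℂ fun y => (g y : ℂ)).toLinearMap +
      Complex.I • schwartzToL2 V
  suffices Dense (LinearMap.range R : Set (Lp ℂ 2 (volume : Measure V))) from this
  rw [Submodule.dense_iff_topologicalClosure_eq_top, Submodule.topologicalClosure_eq_top_iff,
    Submodule.eq_bot_iff]
  intro k hk
  have hgk : (k, Complex.I • k) ∈ (mulOp volume g).graph := by
    refine mem_graph_mulOp_of_inner_schwartz hg fun w => ?_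
    have horth : inner ℂ (schwartzToL2 V (SchwartzMap.smulLeftCLM ℂ (fun y => (g y : ℂ)) w) +
        Complex.I • schwartzToL2 V w) k = 0 := (Submodule.mem_orthogonal _ _).1 hk _ ⟨w, rfl⟩
    rw [inner_add_left, inner_smul_left, Complex.conj_I] at horth
    rw [inner_smul_right]
    linear_combination -horth
  rw [mem_graph_mulOp_iff] at hgk
  rw [Lp.eq_zero_iff_ae_eq_zero]
  filter_upwards [hgk, Lp.coeFn_smul Complex.I k] with y hy hsmul
  rw [hsmul, Pi.smul_apply, smul_eq_mul, ← sub_eq_zero, ← sub_mul] at hy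
  refine (mul_eq_zero.1 hy).resolve_left fun h => ?_
  simpa using congrArg Complex.im h

include hg in
theorem graph_mulOp_le_topologicalClosure_schwartz :
    (mulOp volume g).graph ≤ (LinearMap.range ((schwartzToL2 V).prod
      (schwartzToL2 V ∘ₗ (SchwartzMap.smulLeftCLM ℂ fun y => (g y : ℂ)).toLinearMap))
      ).topologicalClosure := by
  have hgc : Continuous g := Complex.continuous_re.comp hg.1.continuous
  refine graph_le_topologicalClosure_of_dense (graph_mulOp_le_adjoint g) ?_ ?_
  · rintro _ ⟨w, rfl⟩
    exact (mem_graph_mulOp_schwartzToL2_iff hgc).2 (SchwartzMap.smulLeftCLM_apply_apply hg w)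
  · refine (dense_range_mul_add_I_smul hg).mono ?_
    rintro _ ⟨w, rfl⟩
    exact ⟨_, ⟨w, rfl⟩, rfl⟩

end Core

end SchwartzL2

/-! ### The operators of the model on Schwartz functions -/

section Model

theorem denseRange_embed : DenseRange embed :=
  denseRange_schwartzToL2

theorem conj_constC (A B : ℝ) : starRingEnd ℂ (constC A B) = -constD A B := by
  simp only [constC, constD, map_sub, map_mul, Complex.conj_I, Complex.conj_ofReal]
  ring

theorem conj_constD (A B : ℝ) : starRingEnd ℂ (constD A B) = -constC A B := by
  rw [← neg_eq_iff_eq_neg, ← map_neg, ← conj_constC, Complex.conj_conj]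

theorem mem_graph_ofSchwartz_iff {ℓ : Module.End ℂ 𝓢(Plane, ℂ)} {u v : Hil} :
    (u, v) ∈ (ofSchwartz ℓ).graph ↔ ∃ f, embed f = u ∧ embed (ℓ f) = v := by
  have happly (f : 𝓢(Plane, ℂ)) : ofSchwartz ℓ ⟨embed f, f, rfl⟩ = embed (ℓ f) :=
    congrArg (embed ∘ ℓ) ((LinearEquiv.ofInjective embed embed_injective).symm_apply_apply f)
  rw [mem_graph_iff_exists_apply_eq]
  constructor
  · rintro ⟨⟨f, rfl⟩, rfl⟩
    exact ⟨f, rfl, (happly f).symm⟩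
  · rintro ⟨f, rfl, rfl⟩
    exact ⟨⟨f, rfl⟩, happly f⟩

theorem actsAs_ofSchwartz {ℓ ℓ' : Module.End ℂ 𝓢(Plane, ℂ)}
    (hℓ : ∀ f g, inner ℂ (embed (ℓ f)) (embed g) = inner ℂ (embed f) (embed (ℓ' g))) :
    ActsAs embed (ofSchwartz ℓ) ℓ ℓ' where
  mem_graph f := mem_graph_ofSchwartz_iff.2 ⟨f, rfl, rfl⟩
  mem_adjoint g := mem_adjoint_iff_inner_eq.2 fun u v huv => by
    obtain ⟨f, rfl, rfl⟩ := mem_graph_ofSchwartz_iff.1 huv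
    exact hℓ f g

theorem isClosable_ofSchwartz {ℓ : Module.End ℂ 𝓢(Plane, ℂ)}
    (hℓ : ∀ f g, inner ℂ (embed (ℓ f)) (embed g) = inner ℂ (embed f) (embed (ℓ g))) :
    (ofSchwartz ℓ).IsClosable := by
  refine isClosable_of_graph_le_adjoint denseRange_embed ?_
  rintro ⟨_, _⟩ hg
  obtain ⟨g, rfl, rfl⟩ := mem_graph_ofSchwartz_iff.1 hg
  exact (actsAs_ofSchwartz hℓ).mem_adjoint g

/-- The standard basis vector of the plane along the `j`-th coordinate. -/
abbrev axis (j : Fin 2) : Plane := EuclideanSpace.single j 1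

theorem inner_axis_right (y : Plane) (j : Fin 2) : inner ℝ y (axis j) = y j := by
  simp [EuclideanSpace.inner_single_right]

theorem inner_axis_axis (j k : Fin 2) : inner ℝ (axis j) (axis k) = if j = k then 1 else 0 := by
  rw [inner_axis_right, PiLp.single_apply]
  exact ite_congr (propext eq_comm) (fun _ => rfl) fun _ => rfl

theorem actsAs_xOp (j : Fin 2) :
    ActsAs embed (xOp j) (position (axis j)) (position (axis j)) := by
  have hgraph (f : 𝓢(Plane, ℂ)) : (embed f, embed (position (axis j) f)) ∈ (xOp j).graph := by
    have h := mem_graph_mulOp_position (axis j) f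
    simp only [inner_axis_right] at h
    exact h
  exact ⟨hgraph, fun f => graph_mulOp_le_adjoint _ (hgraph f)⟩

theorem actsAs_pOp (j : Fin 2) :
    ActsAs embed (pOp j) (momentum (axis j)) (momentum (axis j)) :=
  (actsAs_ofSchwartz (inner_momentum_left (axis j))).closure
    (isClosable_ofSchwartz (inner_momentum_left (axis j)))

theorem actsAs_aOp (A B : ℝ) (j : Fin 2) : ActsAs embed (aOp A B j)
    (lowering (axis j) (constC A B)) (raising (axis j) (-constD A B)) := by
  have h := (((actsAs_xOp j).add ((actsAs_pOp j).smul Complex.I)).add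
    (ActsAs.scalarOp embed (constC A B))).smul (1 / (√2 : ℝ))
  rw [conj_constC, Complex.conj_I, neg_smul, ← sub_eq_add_neg, map_div₀, map_one,
    Complex.conj_ofReal] at h
  exact h

theorem actsAs_bOp (A B : ℝ) (j : Fin 2) : ActsAs embed (bOp A B j)
    (raising (axis j) (constD A B)) (lowering (axis j) (-constC A B)) := by
  have h := (((actsAs_xOp j).sub ((actsAs_pOp j).smul Complex.I)).add
    (ActsAs.scalarOp embed (constD A B))).smul (1 / (√2 : ℝ))
  rw [conj_constD, Complex.conj_I, neg_smul, sub_neg_eq_add, map_div₀, map_one,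
    Complex.conj_ofReal] at h
  exact h

theorem cOp_eq_aOp_zero (j : Fin 2) : cOp j = aOp 0 0 j := by
  have hconst : constC 0 0 = 0 := by simp [constC]
  have hscalar : scalarOp 0 = (0 : Hil →ₗ.[ℂ] Hil) :=
    LinearPMap.ext rfl fun f _ _ => zero_smul ℂ f
  rw [aOp, hconst, hscalar, add_zero]
  rfl

theorem lie_lowering_raising_axis (α β : ℂ) (j k : Fin 2) :
    ⁅lowering (axis j) α, raising (axis k) β⁆ = if j = k then 1 else 0 := by
  rw [lie_lowering_raising, inner_axis_axis]
  split_ifs <;> simp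

theorem isPseudoBosonic_map_embed (A B : ℝ) {p : Submodule ℂ 𝓢(Plane, ℂ)}
    (hp : Dense (p.map embed : Set Hil))
    (hlowering : ∀ j α, ∀ f ∈ p, lowering (axis j) α f ∈ p)
    (hraising : ∀ j β, ∀ f ∈ p, raising (axis j) β f ∈ p) :
    IsPseudoBosonic (p.map embed) (aOp A B) (bOp A B) :=
  isPseudoBosonic_map denseRange_embed (actsAs_aOp A B) (actsAs_bOp A B)
    (lie_lowering_raising_axis _ _) (fun _ _ => lie_lowering_lowering _ _ _ _)
    (fun _ _ => lie_raising_raising _ _ _ _) hp (fun j => hlowering j _) (fun j => hraising j _)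
    (fun j => hraising j _) (fun j => hlowering j _)

theorem isPseudoBosonic_schwartz (A B : ℝ) : IsPseudoBosonic schwartz (aOp A B) (bOp A B) := by
  have hmap : (⊤ : Submodule ℂ 𝓢(Plane, ℂ)).map embed = schwartz := Submodule.map_top embed
  rw [← hmap]
  exact isPseudoBosonic_map_embed A B (by rw [hmap]; exact denseRange_embed)
    (fun _ _ _ _ => trivial) (fun _ _ _ _ => trivial)

theorem hamiltonian_eq_raising_mul_lowering (A B : ℝ) :
    (1 / 2 : ℂ) • (momentum (axis 0) * momentum (axis 0) + position (axis 0) * position (axis 0)) +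
      (1 / 2 : ℂ) •
        (momentum (axis 1) * momentum (axis 1) + position (axis 1) * position (axis 1)) +
      Complex.I • ((A : ℂ) • (position (axis 0) + position (axis 1)) +
        (B : ℂ) • (momentum (axis 0) + momentum (axis 1))) =
    raising (axis 0) (constD A B) * lowering (axis 0) (constC A B) +
      raising (axis 1) (constD A B) * lowering (axis 1) (constC A B) +
      ((A : ℂ) ^ 2 + (B : ℂ) ^ 2 + 1) • 1 := by
  have hmul : constC A B * constD A B = -((A : ℂ) ^ 2 + (B : ℂ) ^ 2) := by
    rw [constC, constD]
    linear_combination (A : ℂ) ^ 2 * Complex.I_sq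
  have hadd : (constC A B + constD A B) / 2 = Complex.I * A := by
    rw [constC, constD]
    ring
  have hsub : Complex.I * (constD A B - constC A B) / 2 = Complex.I * B := by
    rw [constC, constD]
    ring
  have hnorm (j : Fin 2) : ‖axis j‖ ^ 2 = 1 := by simp
  ext1 f
  simp only [LinearMap.add_apply, LinearMap.smul_apply, Module.End.mul_apply, raising_lowering,
    Module.End.one_apply, hmul, hadd, hsub, hnorm, Complex.ofReal_one]
  module

theorem hamiltonian_eq_num (A B : ℝ) : ∀ f ∈ schwartz, ∃ g, (f, g) ∈ (hamiltonian A B).graph ∧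
    (f, g) ∈ (num A B 0 + num A B 1 + scalarOp ((A : ℂ) ^ 2 + (B : ℂ) ^ 2 + 1)).graph := by
  rintro _ ⟨f, rfl⟩
  have hx := actsAs_xOp
  have hp := actsAs_pOp
  have hnum (j : Fin 2) := (actsAs_bOp A B j).opMul (actsAs_aOp A B j)
  have hH := ((((hp 0).opMul (hp 0)).add ((hx 0).opMul (hx 0))).smul (1 / 2)).add
    ((((hp 1).opMul (hp 1)).add ((hx 1).opMul (hx 1))).smul (1 / 2)) |>.add
    (((((hx 0).add (hx 1)).smul A).add (((hp 0).add (hp 1)).smul B)).smul Complex.I)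
  have hN := ((hnum 0).add (hnum 1)).add
    (ActsAs.scalarOp embed ((A : ℂ) ^ 2 + (B : ℂ) ^ 2 + 1))
  rw [hamiltonian_eq_raising_mul_lowering] at hH
  exact ⟨_, hH.mem_graph f, hN.mem_graph f⟩

end Model

/-! ### Ladders -/

section Ladder

theorem mul_pow_succ_of_lie_eq_one {A : Type*} [Ring A] {l r : A} (hlr : ⁅l, r⁆ = 1) (n : ℕ) :
    l * r ^ (n + 1) = r ^ (n + 1) * l + (n + 1) • r ^ n := by
  have hswap : l * r = r * l + 1 := sub_eq_iff_eq_add'.1 hlr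
  induction n with
  | zero => simpa using hswap
  | succ n ih =>
    rw [pow_succ, ← mul_assoc, ih, add_mul, mul_assoc, hswap, smul_mul_assoc, ← pow_succ, mul_add,
      mul_one, ← mul_assoc, ← pow_succ, add_assoc, ← succ_nsmul']

variable {S E : Type*} [AddCommGroup S] [Module ℂ S] [NormedAddCommGroup E]
  [InnerProductSpace ℂ E] {ι : S →ₗ[ℂ] E}

theorem pow_mem_of_stable {p : Submodule ℂ S} {r : Module.End ℂ S} (hr : ∀ f ∈ p, r f ∈ p)
    (n : ℕ) {f : S} (hf : f ∈ p) : (r ^ n) f ∈ p := by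
  induction n with
  | zero => exact hf
  | succ n ih =>
    rw [pow_succ', Module.End.mul_apply]
    exact hr _ ih

theorem lowering_pow_succ_raising {l r : Module.End ℂ S} (hlr : ⁅l, r⁆ = 1) {f : S}
    (hf : l f = 0) (n : ℕ) : l ((r ^ (n + 1)) f) = (n + 1 : ℂ) • (r ^ n) f := by
  have h := LinearMap.congr_fun (mul_pow_succ_of_lie_eq_one hlr n) f
  simpa [hf, ← Nat.cast_smul_eq_nsmul ℂ] using h

theorem inner_pow_raising {l r : Module.End ℂ S} (hlr : ⁅l, r⁆ = 1)
    (hadj : ∀ f g, inner ℂ (ι (l f)) (ι g) = inner ℂ (ι f) (ι (r g))) {f g : S}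
    (hf : l f = 0) (hg : l g = 0) (m n : ℕ) : inner ℂ (ι ((r ^ m) f)) (ι ((r ^ n) g)) =
      if m = n then m.factorial * inner ℂ (ι f) (ι g) else 0 := by
  have hadj' (f g : S) : inner ℂ (ι (r f)) (ι g) = inner ℂ (ι f) (ι (l g)) := by
    rw [← inner_conj_symm, ← hadj, inner_conj_symm]
  induction m generalizing n with
  | zero =>
    cases n with
    | zero => simp
    | succ n => simp [pow_succ', ← hadj, hf]
  | succ m ih =>
    rw [pow_succ', Module.End.mul_apply, hadj']
    cases n with
    | zero => simp [hg]
    | succ n =>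
      rw [lowering_pow_succ_raising hlr hg, map_smul, inner_smul_right, ih]
      rcases eq_or_ne m n with rfl | hmn
      · simp only [if_true, Nat.factorial_succ]
        push_cast
        ring
      · simp [hmn]

/-- The vectors `(n₁! n₂!)^{-1/2} r₁^{n₁} r₂^{n₂} f`: the counterpart of `tower` for everywhere
defined linear maps. -/
def ladder (r : Fin 2 → Module.End ℂ S) (f : S) (n : ℕ × ℕ) : S :=
  (1 / (√(n.1.factorial * n.2.factorial) : ℝ) : ℂ) • (r 0 ^ n.1) ((r 1 ^ n.2) f)

variable {r : Fin 2 → Module.End ℂ S} {f : S}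

theorem tower_map {ι : S →ₗ[ℂ] Hil} {L : Fin 2 → (Hil →ₗ.[ℂ] Hil)} {r' : Fin 2 → Module.End ℂ S}
    (hL : ∀ j, ActsAs ι (L j) (r j) (r' j)) (f : S) (n : ℕ × ℕ) :
    tower L (ι f) n = ι (ladder r f n) := by
  rw [tower, ladder, map_smul, (hL 1).app_iterate, (hL 0).app_iterate]

theorem ladder_zero : ladder r f 0 = f := by
  simp [ladder]

theorem ladder_smul (c : ℂ) (n : ℕ × ℕ) : ladder r (c • f) n = c • ladder r f n := by
  simp only [ladder, map_smul, smul_comm c]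

theorem ladder_mem {p : Submodule ℂ S} (hr : ∀ j, ∀ f ∈ p, r j f ∈ p) (hf : f ∈ p)
    (n : ℕ × ℕ) : ladder r f n ∈ p :=
  p.smul_mem _ (pow_mem_of_stable (hr 0) _ (pow_mem_of_stable (hr 1) _ hf))

theorem ladder_mem_of_pair_stable {T : Type*} [AddCommGroup T] [Module ℂ T]
    {r' : Fin 2 → Module.End ℂ T} {h : T} {G : Submodule ℂ (S × T)}
    (hG : ∀ j, ∀ x ∈ G, (r j x.1, r' j x.2) ∈ G) (hfh : (f, h) ∈ G) (n : ℕ × ℕ) :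
    (ladder r f n, ladder r' h n) ∈ G := by
  have hpow (j : Fin 2) (m : ℕ) (x : S × T) (hx : x ∈ G) :
      ((r j ^ m) x.1, (r' j ^ m) x.2) ∈ G := by
    induction m with
    | zero => exact hx
    | succ m ih =>
      rw [pow_succ', pow_succ']
      exact hG j _ ih
  exact G.smul_mem _ (hpow 0 n.1 _ (hpow 1 n.2 _ hfh))

theorem span_range_ladder : Submodule.span ℂ (Set.range (ladder r f)) =
    Submodule.span ℂ (Set.range fun n : ℕ × ℕ => (r 0 ^ n.1) ((r 1 ^ n.2) f)) := by
  apply le_antisymm <;> rw [Submodule.span_le]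
  · rintro _ ⟨n, rfl⟩
    exact Submodule.smul_mem _ _ (Submodule.subset_span ⟨n, rfl⟩)
  · rintro _ ⟨n, rfl⟩
    have hne : (1 / (√(n.1.factorial * n.2.factorial) : ℝ) : ℂ) ≠ 0 := by
      have hpos : (0 : ℝ) < √(n.1.factorial * n.2.factorial) := by positivity
      exact one_div_ne_zero (Complex.ofReal_ne_zero.2 hpos.ne')
    exact (Submodule.smul_mem_iff _ hne).1 (Submodule.subset_span ⟨n, rfl⟩)

theorem raising_mem_span_ladder (hr : Commute (r 0) (r 1)) (j : Fin 2) {g : S}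
    (hg : g ∈ Submodule.span ℂ (Set.range (ladder r f))) :
    r j g ∈ Submodule.span ℂ (Set.range (ladder r f)) := by
  rw [span_range_ladder] at hg ⊢
  refine (Submodule.map_span_le (r j) _ _).2 ?_ (Submodule.mem_map_of_mem hg)
  rintro _ ⟨⟨m, n⟩, rfl⟩
  fin_cases j
  · refine Submodule.subset_span ⟨(m + 1, n), ?_⟩
    simp only [pow_succ', Module.End.mul_apply, Fin.zero_eta]
  · refine Submodule.subset_span ⟨(m, n + 1), ?_⟩
    simp only [pow_succ', Module.End.mul_apply, Fin.mk_one]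
    exact (LinearMap.congr_fun (hr.symm.pow_right m).eq _).symm

section Canonical

variable {l : Fin 2 → Module.End ℂ S} (hlr : ∀ j k, ⁅l j, r k⁆ = if j = k then 1 else 0)
  (hf : ∀ j, l j f = 0)
include hlr hf

theorem lowering_pow_raising_of_ne {j k : Fin 2} (hjk : j ≠ k) (n : ℕ) :
    l j ((r k ^ n) f) = 0 := by
  have hcomm : Commute (l j) (r k) := sub_eq_zero.1 ((hlr j k).trans (if_neg hjk))
  rw [← Module.End.mul_apply, (hcomm.pow_right n).eq, Module.End.mul_apply, hf, map_zero]

theorem orthonormal_ladder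
    (hadj : ∀ j f g, inner ℂ (ι (l j f)) (ι g) = inner ℂ (ι f) (ι (r j g)))
    (hnorm : inner ℂ (ι f) (ι f) = 1) : Orthonormal ℂ fun n => ι (ladder r f n) := by
  have hself (j : Fin 2) : ⁅l j, r j⁆ = 1 := (hlr j j).trans (if_pos rfl)
  have hzero := lowering_pow_raising_of_ne hlr hf zero_ne_one
  rw [orthonormal_iff_ite]
  rintro ⟨m, n⟩ ⟨m', n'⟩
  have hinner := inner_pow_raising (hself 0) (hadj 0) (hzero n) (hzero n') m m'
  rw [inner_pow_raising (hself 1) (hadj 1) (hf 1) (hf 1), hnorm] at hinner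
  rw [ladder, ladder, map_smul, map_smul, inner_smul_left, inner_smul_right, hinner, map_div₀,
    map_one, Complex.conj_ofReal]
  rcases eq_or_ne m m' with rfl | hm
  · rcases eq_or_ne n n' with rfl | hn
    · have hpos : (0 : ℝ) < m.factorial * n.factorial := by positivity
      rw [if_pos rfl, if_pos rfl, if_pos rfl, mul_one, ← mul_assoc, div_mul_div_comm, one_mul,
        ← Complex.ofReal_mul, Real.mul_self_sqrt hpos.le]
      exact_mod_cast one_div_mul_cancel hpos.ne'
    · simp [hn]
  · simp [hm]

theorem lowering_mem_span_ladder (j : Fin 2) {g : S}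
    (hg : g ∈ Submodule.span ℂ (Set.range (ladder r f))) :
    l j g ∈ Submodule.span ℂ (Set.range (ladder r f)) := by
  have hself (j : Fin 2) : ⁅l j, r j⁆ = 1 := (hlr j j).trans (if_pos rfl)
  have hcomm : Commute (l 1) (r 0) := sub_eq_zero.1 ((hlr 1 0).trans (if_neg one_ne_zero))
  rw [span_range_ladder] at hg ⊢
  refine (Submodule.map_span_le (l j) _ _).2 ?_ (Submodule.mem_map_of_mem hg)
  rintro _ ⟨⟨m, n⟩, rfl⟩
  fin_cases j
  · have hzero := lowering_pow_raising_of_ne hlr hf zero_ne_one n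
    obtain _ | m := m
    · exact hzero ▸ Submodule.zero_mem _
    · refine lowering_pow_succ_raising (hself 0) hzero m ▸ Submodule.smul_mem _ _ ?_
      exact Submodule.subset_span ⟨(m, n), rfl⟩
  · have hswap (g : S) : l 1 ((r 0 ^ m) g) = (r 0 ^ m) (l 1 g) :=
      LinearMap.congr_fun (hcomm.pow_right m).eq g
    simp only [Fin.mk_one, hswap]
    obtain _ | n := n
    · simp [hf]
    · rw [lowering_pow_succ_raising (hself 1) (hf 1), map_smul]
      exact Submodule.smul_mem _ _ (Submodule.subset_span ⟨(m, n), rfl⟩)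

end Canonical

end Ladder

/-! ### Completeness of polynomials times a Gaussian -/

section Completeness

theorem integral_cexp_mul_eq_zero_of_integral_pow_mul {α : Type*} [MeasurableSpace α]
    {μ : Measure α} {u : α → ℝ} {h : α → ℂ} (hu : AEStronglyMeasurable u μ)
    (hh : AEStronglyMeasurable h μ) (hint : Integrable (fun y => Real.exp |u y| * ‖h y‖) μ)
    (hzero : ∀ n : ℕ, ∫ y, (u y : ℂ) ^ n * h y ∂μ = 0) :
    ∫ y, Complex.exp (u y * Complex.I) * h y ∂μ = 0 := by
  have hterm (n : ℕ) : ∫ y, (u y * Complex.I) ^ n / n.factorial * h y ∂μ = 0 := by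
    rw [← mul_zero (Complex.I ^ n / n.factorial), ← hzero n, ← integral_const_mul]
    exact integral_congr_ae (Filter.Eventually.of_forall fun y => by ring)
  have hexp (r : ℝ) : HasSum (fun n : ℕ => r ^ n / n.factorial) (Real.exp r) := by
    rw [Real.exp_eq_exp_ℝ]
    exact NormedSpace.expSeries_div_hasSum_exp r
  have hcexp (z : ℂ) : HasSum (fun n : ℕ => z ^ n / n.factorial) (Complex.exp z) := by
    rw [Complex.exp_eq_exp_ℂ]
    exact NormedSpace.expSeries_div_hasSum_exp z
  have hmeas (n : ℕ) :
      AEStronglyMeasurable (fun y => ((u y : ℂ) * Complex.I) ^ n / n.factorial * h y) μ :=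
    ((by fun_prop : Continuous fun r : ℝ => ((r : ℂ) * Complex.I) ^ n / n.factorial)
      |>.comp_aestronglyMeasurable hu).mul hh
  have hbound (n : ℕ) (y : α) : ‖((u y : ℂ) * Complex.I) ^ n / n.factorial * h y‖ ≤
      |u y| ^ n / n.factorial * ‖h y‖ := by
    rw [norm_mul, norm_div, norm_pow, norm_mul, Complex.norm_I, mul_one, Complex.norm_real,
      Real.norm_eq_abs, Complex.norm_natCast]
  have hsum : HasSum (fun n : ℕ => ∫ y, ((u y : ℂ) * Complex.I) ^ n / n.factorial * h y ∂μ)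
      (∫ y, Complex.exp (u y * Complex.I) * h y ∂μ) := by
    refine hasSum_integral_of_dominated_convergence
      (fun n y => |u y| ^ n / n.factorial * ‖h y‖) hmeas
      (fun n => Filter.Eventually.of_forall (hbound n))
      (Filter.Eventually.of_forall fun y => ((hexp |u y|).mul_right ‖h y‖).summable)
      (hint.congr (Filter.Eventually.of_forall fun y => ?_))
      (Filter.Eventually.of_forall fun y => (hcexp (u y * Complex.I)).mul_right (h y))
    exact ((hexp |u y|).mul_right ‖h y‖).tsum_eq.symm
  simp only [hterm] at hsum
  exact hsum.unique hasSum_zero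

variable {V : Type*} [NormedAddCommGroup V] [InnerProductSpace ℝ V] [FiniteDimensional ℝ V]
  [MeasurableSpace V] [BorelSpace V]

theorem ae_eq_zero_of_fourier_eq_zero {h : V → ℂ} (hh : Integrable h)
    (hF : ∀ ξ, FourierTransform.fourier h ξ = 0) : ∀ᵐ y, h y = 0 := by
  refine ae_eq_zero_of_integral_schwartz_mul hh.locallyIntegrable fun ψ _ => ?_
  obtain ⟨χ, rfl⟩ : ∃ χ : 𝓢(V, ℂ), FourierTransform.fourier χ = ψ :=
    ⟨FourierTransformInv.fourierInv ψ, by simp⟩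
  have hflip : ∫ ξ, FourierTransform.fourier χ ξ • h ξ =
      ∫ x, χ x • FourierTransform.fourier h x := by
    simpa using! VectorFourier.integral_fourierIntegral_smul_eq_flip (μ := volume) (ν := volume)
      (L := innerₗ V) Real.continuous_fourierChar continuous_inner χ.integrable hh
  simp only [hF, smul_zero, integral_zero] at hflip
  exact hflip

theorem ae_eq_zero_of_moments_eq_zero {h : V → ℂ} (hh : AEStronglyMeasurable h)
    (hint : ∀ t, Integrable fun y => Real.exp |inner ℝ y t| * ‖h y‖)
    (hzero : ∀ t (n : ℕ), ∫ y, ((inner ℝ y t : ℝ) : ℂ) ^ n * h y = 0) : ∀ᵐ y, h y = 0 := by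
  have hh' : Integrable h := by
    rw [← integrable_norm_iff hh]
    simpa using hint 0
  refine ae_eq_zero_of_fourier_eq_zero hh' fun ξ => ?_
  have hcont : Continuous fun y => inner ℝ y ((-2 * Real.pi) • ξ) := by fun_prop
  rw [Real.fourier_eq', ← integral_cexp_mul_eq_zero_of_integral_pow_mul
    hcont.aestronglyMeasurable hh (hint ((-2 * Real.pi) • ξ)) (hzero _)]
  simp only [inner_smul_right, smul_eq_mul]

variable {z : ℂ} (hz : 0 < z.re) (L : V →L[ℝ] ℂ)

theorem integrable_exp_abs_inner_mul_gaussian (f : Lp ℂ 2 (volume : Measure V)) (t : V) :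
    Integrable fun y => Real.exp |inner ℝ y t| * ‖gaussian z hz L y * f y‖ := by
  have hexp (s : ℝ) :
      Integrable fun y => Real.exp (s * inner ℝ y t) * ‖gaussian z hz L y * f y‖ := by
    refine (integrable_schwartz_mul (gaussian z hz
      (L + s • Complex.ofRealCLM ∘L innerSL ℝ t)) f).norm.congr
      (Filter.Eventually.of_forall fun y => ?_)
    simp only [norm_mul, gaussian_apply, Complex.norm_exp, quadExponent, ← mul_assoc,
      ← Real.exp_add]
    congr 2
    simp [real_inner_comm t y]
    ring
  refine ((hexp 1).add (hexp (-1))).mono' ?_ (Filter.Eventually.of_forall fun y => ?_)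
  · exact (Continuous.aestronglyMeasurable (by fun_prop)).mul
      (integrable_schwartz_mul _ f).norm.aestronglyMeasurable
  · rw [Real.norm_eq_abs, abs_of_nonneg (by positivity), Pi.add_apply, ← add_mul, one_mul,
      neg_one_mul]
    gcongr
    exact Real.exp_abs_le _

/-- Orthogonality to all polynomials times a Gaussian kills the moments of a function with
exponential decay, hence its Fourier transform. -/
theorem dense_map_of_gaussian_mem {p : Submodule ℂ 𝓢(V, ℂ)} (hp : gaussian z hz L ∈ p)
    (hposition : ∀ v, ∀ f ∈ p, position v f ∈ p) :
    Dense (p.map (schwartzToL2 V) : Set (Lp ℂ 2 (volume : Measure V))) := by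
  rw [Submodule.dense_iff_topologicalClosure_eq_top, Submodule.topologicalClosure_eq_top_iff,
    Submodule.eq_bot_iff]
  intro f hf
  set w := gaussian z hz L
  have hmeas : AEStronglyMeasurable (fun y => starRingEnd ℂ (w y) * f y) :=
    (Continuous.aestronglyMeasurable (by fun_prop)).mul (Lp.aestronglyMeasurable f)
  have hzero : ∀ᵐ y, starRingEnd ℂ (w y) * f y = 0 := by
    refine ae_eq_zero_of_moments_eq_zero hmeas (fun t => ?_) fun t n => ?_
    · simpa using integrable_exp_abs_inner_mul_gaussian hz L f t
    · have hpow (y : V) : (position t ^ n) w y = ((inner ℝ y t : ℝ) : ℂ) ^ n * w y := by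
        induction n with
        | zero => simp
        | succ n ih =>
          rw [pow_succ', Module.End.mul_apply, position_apply, ih, pow_succ', mul_assoc]
      have horth := (Submodule.mem_orthogonal _ _).1 hf _
        (Submodule.mem_map_of_mem (pow_mem_of_stable (hposition t) n hp))
      rw [inner_schwartzToL2_left] at horth
      simpa only [hpow, map_mul, map_pow, Complex.conj_ofReal, mul_assoc] using horth
  rw [Lp.eq_zero_iff_ae_eq_zero]
  filter_upwards [hzero] with y hy
  exact (mul_eq_zero.1 hy).resolve_left ((map_ne_zero _).2 (Complex.exp_ne_zero _))

end Completeness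

/-! ### Linear canonical transformations -/

section Chirp

variable {V : Type*} [NormedAddCommGroup V] [InnerProductSpace ℝ V]

theorem re_quadExponent_I_mul (r : ℝ) (y : V) : (quadExponent (Complex.I * r) 0 y).re = 0 := by
  rw [quadExponent, Complex.add_re, Complex.re_mul_ofReal]
  simp

theorem hasTemperateGrowth_chirp (r : ℝ) :
    (fun y : V => Complex.exp (quadExponent (Complex.I * r) 0 y)).HasTemperateGrowth :=
  hasTemperateGrowth_cexp (hasTemperateGrowth_quadExponent _ _)
    fun y => (re_quadExponent_I_mul r y).le

variable (V) in
/-- Multiplication by the chirp `exp(-i r ‖y‖² / 2)`, which adds `r x` to the momentum. -/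
def chirpMul (r : ℝ) : Module.End ℂ 𝓢(V, ℂ) :=
  (SchwartzMap.smulLeftCLM ℂ fun y => Complex.exp (quadExponent (Complex.I * r) 0 y)).toLinearMap

theorem chirpMul_apply (r : ℝ) (f : 𝓢(V, ℂ)) (y : V) :
    chirpMul V r f y = Complex.exp (quadExponent (Complex.I * r) 0 y) * f y :=
  SchwartzMap.smulLeftCLM_apply_apply (hasTemperateGrowth_chirp r) f y

theorem chirpMul_neg_chirpMul (r : ℝ) (f : 𝓢(V, ℂ)) : chirpMul V (-r) (chirpMul V r f) = f := by
  ext y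
  rw [chirpMul_apply, chirpMul_apply, ← mul_assoc, ← Complex.exp_add]
  simp [quadExponent, neg_div]

theorem norm_chirpMul_apply (r : ℝ) (f : 𝓢(V, ℂ)) (y : V) : ‖chirpMul V r f y‖ = ‖f y‖ := by
  rw [chirpMul_apply, norm_mul, Complex.norm_exp, re_quadExponent_I_mul, Real.exp_zero, one_mul]

theorem chirpMul_momentum (r : ℝ) (v : V) (f : 𝓢(V, ℂ)) :
    chirpMul V r (momentum v f) =
      (r : ℂ) • position v (chirpMul V r f) + momentum v (chirpMul V r f) := by
  ext y
  have h := ((hasFDerivAt_quadExponent (Complex.I * r) 0 y).cexp.mul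
    f.differentiableAt.hasFDerivAt).congr_of_eventuallyEq
      (Filter.Eventually.of_forall fun y => chirpMul_apply r f y)
  rw [add_apply, momentum_apply_of_hasFDerivAt h]
  simp only [chirpMul_apply, momentum_apply, position_apply, smul_apply, add_apply, smul_eq_mul,
    ContinuousLinearMap.comp_apply, innerSL_apply_apply, Complex.ofRealCLM_apply, zero_apply]
  linear_combination (-(r * Complex.exp (quadExponent (Complex.I * r) 0 y) *
    (inner ℝ y v : ℝ) * f y)) * Complex.I_sq

theorem position_eq_smulLeftCLM_inner (v : V) (f : 𝓢(V, ℂ)) :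
    position v f = SchwartzMap.smulLeftCLM ℂ (inner ℝ · v : V → ℝ) f := by
  ext y
  rw [position_apply, SchwartzMap.smulLeftCLM_apply_apply (by fun_prop), Complex.real_smul]

end Chirp

section LinearCanonicalTransform

variable {V : Type*} [NormedAddCommGroup V] [InnerProductSpace ℝ V] [FiniteDimensional ℝ V]
  [MeasurableSpace V] [BorelSpace V]

variable (V) in
/-- A bijection of `𝒮(V)` that preserves the `L²` norm and maps position and momentum to the
combinations `a x + b p` and `c x + d p` with `a d - b c = 1`. -/
structure LinearCanonicalTransform where
  toEquiv : 𝓢(V, ℂ) ≃ₗ[ℂ] 𝓢(V, ℂ)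
  norm_map : ∀ f, ‖schwartzToL2 V (toEquiv f)‖ = ‖schwartzToL2 V f‖
  a : ℝ
  b : ℝ
  c : ℝ
  d : ℝ
  det : a * d - b * c = 1
  map_position : ∀ v f, toEquiv (position v f) =
    (a : ℂ) • position v (toEquiv f) + (b : ℂ) • momentum v (toEquiv f)
  map_momentum : ∀ v f, toEquiv (momentum v f) =
    (c : ℂ) • position v (toEquiv f) + (d : ℂ) • momentum v (toEquiv f)

theorem norm_schwartzToL2_congr {f g : 𝓢(V, ℂ)} (h : ∀ y, ‖f y‖ = ‖g y‖) :
    ‖schwartzToL2 V f‖ = ‖schwartzToL2 V g‖ := by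
  rw [Lp.norm_def, Lp.norm_def]
  refine congrArg ENNReal.toReal (eLpNorm_congr_norm_ae ?_)
  filter_upwards [coeFn_schwartzToL2 f, coeFn_schwartzToL2 g] with y hf hg
  rw [hf, hg, h]

theorem two_pi_ne_zero : (2 * Real.pi : ℂ) ≠ 0 := by
  simp [Real.pi_ne_zero]

theorem fourier_momentum (v : V) (f : 𝓢(V, ℂ)) :
    FourierTransform.fourierEquiv ℂ 𝓢(V, ℂ) (momentum v f) =
      (2 * Real.pi : ℂ) • position v (FourierTransform.fourierEquiv ℂ 𝓢(V, ℂ) f) := by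
  set F := FourierTransform.fourierEquiv ℂ 𝓢(V, ℂ)
  have h : F (∂_{v} f) = (2 * Real.pi * Complex.I) • position v (F f) := by
    rw [position_eq_smulLeftCLM_inner]
    exact SchwartzMap.fourier_lineDerivOp_eq f v
  change F (-Complex.I • ∂_{v} f) = _
  rw [map_smul, h, smul_smul]
  congr 1
  linear_combination (-(2 * Real.pi : ℂ)) * Complex.I_sq

theorem fourier_position (v : V) (f : 𝓢(V, ℂ)) :
    FourierTransform.fourierEquiv ℂ 𝓢(V, ℂ) (position v f) =
      (-(1 / (2 * Real.pi)) : ℂ) • momentum v (FourierTransform.fourierEquiv ℂ 𝓢(V, ℂ) f) := by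
  set F := FourierTransform.fourierEquiv ℂ 𝓢(V, ℂ)
  have h : ∂_{v} (F f) = -(2 * Real.pi * Complex.I) • F (position v f) := by
    rw [position_eq_smulLeftCLM_inner, ← map_smul]
    exact SchwartzMap.lineDerivOp_fourier_eq f v
  change _ = _ • (-Complex.I • ∂_{v} (F f))
  have := two_pi_ne_zero
  rw [h, smul_smul, smul_smul, eq_comm]
  convert! one_smul ℂ _ using 2
  field_simp
  linear_combination -Complex.I_sq

namespace LinearCanonicalTransform

variable (V) in
/-- The identity. -/
def refl : LinearCanonicalTransform V where
  toEquiv := LinearEquiv.refl ℂ _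
  norm_map _ := rfl
  a := 1
  b := 0
  c := 0
  d := 1
  det := by norm_num
  map_position v f := by simp
  map_momentum v f := by simp

variable (V) in
/-- Multiplication by the chirp `exp(-i r ‖y‖² / 2)`. -/
def chirp (r : ℝ) : LinearCanonicalTransform V where
  toEquiv := { chirpMul V r with
    invFun := chirpMul V (-r)
    left_inv := chirpMul_neg_chirpMul r
    right_inv := fun f => by simpa using chirpMul_neg_chirpMul (-r) f }
  norm_map f := norm_schwartzToL2_congr (norm_chirpMul_apply r f)
  a := 1
  b := 0
  c := r
  d := 1
  det := by ring
  map_position v f := by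
    ext y
    simp [chirpMul_apply, position_apply, mul_left_comm]
  map_momentum v f := by
    rw [Complex.ofReal_one, one_smul]
    exact chirpMul_momentum r v f

variable (V) in
/-- The Fourier transform. -/
def fourier : LinearCanonicalTransform V where
  toEquiv := FourierTransform.fourierEquiv ℂ 𝓢(V, ℂ)
  norm_map f := SchwartzMap.norm_fourier_toL2_eq f
  a := 0
  b := -(1 / (2 * Real.pi))
  c := 2 * Real.pi
  d := 0
  det := by
    have := Real.pi_ne_zero
    field_simp
    ring
  map_position v f := by
    rw [fourier_position]
    push_cast
    module
  map_momentum v f := by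
    rw [fourier_momentum]
    push_cast
    module

/-- The composition, `W₁` being applied first. -/
def trans (W₁ W₂ : LinearCanonicalTransform V) : LinearCanonicalTransform V where
  toEquiv := W₁.toEquiv.trans W₂.toEquiv
  norm_map f := (W₂.norm_map _).trans (W₁.norm_map f)
  a := W₁.a * W₂.a + W₁.b * W₂.c
  b := W₁.a * W₂.b + W₁.b * W₂.d
  c := W₁.c * W₂.a + W₁.d * W₂.c
  d := W₁.c * W₂.b + W₁.d * W₂.d
  det := by linear_combination (W₁.a * W₁.d - W₁.b * W₁.c) * W₂.det + W₁.det
  map_position v f := by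
    simp only [LinearEquiv.trans_apply, map_position, map_momentum, map_add, map_smul]
    push_cast
    module
  map_momentum v f := by
    simp only [LinearEquiv.trans_apply, map_position, map_momentum, map_add, map_smul]
    push_cast
    module

theorem exists_mul_b_eq_mul_d (A B : ℝ) : ∃ W : LinearCanonicalTransform V, B * W.b = A * W.d := by
  rcases eq_or_ne A 0 with rfl | hA
  · exact ⟨refl V, by simp [refl]⟩
  · refine ⟨(chirp V (B / A)).trans (fourier V), ?_⟩
    simp only [trans, chirp, fourier]
    field_simp
    ring

end LinearCanonicalTransform
end LinearCanonicalTransform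

/-! ### The exponentials of `-A p + B x` -/

section LinearForm

variable {V : Type*} [NormedAddCommGroup V] [InnerProductSpace ℝ V]

/-- The functional `k ⟪u, ·⟫`. -/
def linearForm (k : ℂ) (u : V) : V →L[ℝ] ℂ := k • (Complex.ofRealCLM ∘L innerSL ℝ u)

theorem linearForm_apply (k : ℂ) (u v : V) : linearForm k u v = k * (inner ℝ u v : ℝ) := rfl

theorem exists_eq_smul_gaussian {L : V →L[ℝ] ℂ} {h : 𝓢(V, ℂ)}
    (hh : ∀ v, lowering v (-L v) h = 0) : ∃ N : ℂ, h = N • gaussian 1 (by simp) L := by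
  obtain ⟨N, hN⟩ := exists_eq_const_mul_exp_quadExponent (z := 1) (L := L) (h := h) fun v => by
    have hv := hh v
    rw [lowering_apply, smul_eq_zero_iff_right (by simp)] at hv
    have h2 := congrArg (fun k => Complex.I • k) hv
    rw [smul_zero, smul_add, smul_add, smul_smul, Complex.I_mul_I] at h2
    rw [← sub_eq_zero, ← neg_eq_zero, ← h2]
    module
  exact ⟨N, SchwartzMap.ext hN⟩

end LinearForm

namespace LinearCanonicalTransform

variable {V : Type*} [NormedAddCommGroup V] [InnerProductSpace ℝ V] [FiniteDimensional ℝ V]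
  [MeasurableSpace V] [BorelSpace V] (W : LinearCanonicalTransform V)

/-- The extension of `W` to `L²(V)`. -/
def unitary : Lp ℂ 2 (volume : Measure V) ≃ₗᵢ[ℂ] Lp ℂ 2 (volume : Measure V) :=
  W.toEquiv.extendOfIsometry (schwartzToL2 V) (schwartzToL2 V) denseRange_schwartzToL2
    denseRange_schwartzToL2 W.norm_map

theorem unitary_schwartzToL2 (f : 𝓢(V, ℂ)) :
    W.unitary (schwartzToL2 V f) = schwartzToL2 V (W.toEquiv f) :=
  LinearEquiv.extendOfIsometry_eq W.toEquiv _ _ denseRange_schwartzToL2 denseRange_schwartzToL2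
    W.norm_map f

theorem sub_I_mul_ne_zero : (W.d - Complex.I * W.b : ℂ) ≠ 0 := by
  intro h
  have hd : W.d = 0 := by simpa using congrArg Complex.re h
  have hb : W.b = 0 := by simpa using congrArg Complex.im h
  simpa [hd, hb] using W.det

theorem momentum_eq_smul_position {f : 𝓢(V, ℂ)} {v : V} (hf : lowering v 0 f = 0) :
    momentum v (W.toEquiv f) =
      (Complex.I * ((W.a + Complex.I * W.c) / (W.d - Complex.I * W.b))) •
        position v (W.toEquiv f) := by
  have hne := W.sub_I_mul_ne_zero
  rw [lowering_apply, smul_eq_zero_iff_right (by simp), zero_smul, add_zero] at hf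
  have hWf := congrArg W.toEquiv hf
  rw [map_add, map_smul, map_zero, W.map_position, W.map_momentum] at hWf
  rw [← smul_right_inj hne, ← sub_eq_zero, ← smul_zero (-Complex.I), ← hWf]
  match_scalars
  · field_simp
    linear_combination W.d * Complex.I_sq
  · field_simp

theorem re_div_pos : 0 < ((W.a + Complex.I * W.c) / (W.d - Complex.I * W.b) : ℂ).re := by
  have hne := W.sub_I_mul_ne_zero
  have hre : ((W.a + Complex.I * W.c) / (W.d - Complex.I * W.b) : ℂ).re =
      1 / Complex.normSq (W.d - Complex.I * W.b) := by
    rw [Complex.div_re, ← add_div, ← W.det]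
    simp only [Complex.add_re, Complex.add_im, Complex.sub_re, Complex.sub_im, Complex.mul_re,
      Complex.mul_im, Complex.I_re, Complex.I_im, Complex.ofReal_re, Complex.ofReal_im]
    ring
  rw [hre]
  exact one_div_pos.2 (Complex.normSq_pos.2 hne)

variable (A B : ℝ) (u : V)

/-- The real function by which `W` represents `-A p_u + B x_u`, provided that `B b = A d`. -/
def symbol (y : V) : ℝ := (B * W.a - A * W.c) * inner ℝ u y

/-- `exp(t(-A p_u + B x_u))`, provided that `B b = A d`. -/
abbrev weylExp (t : ℝ) : Lp ℂ 2 (volume : Measure V) →ₗ.[ℂ] Lp ℂ 2 (volume : Measure V) :=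
  expGroup W.unitary (W.symbol A B u) t

variable {A B u}

theorem continuous_symbol : Continuous (W.symbol A B u) := by
  unfold symbol
  fun_prop

theorem isSelfAdjoint_weylExp (t : ℝ) : IsSelfAdjoint (W.weylExp A B u t) :=
  isSelfAdjoint_expGroup _ W.continuous_symbol.measurable t

theorem inverse_weylExp (t : ℝ) : (W.weylExp A B u t).inverse = W.weylExp A B u (-t) :=
  inverse_expGroup _ _ t

theorem weylExp_neg_two : W.weylExp A B u (-2) =
    opMul (W.weylExp A B u 1).inverse (W.weylExp A B u 1).inverse := by
  rw [inverse_weylExp, weylExp, weylExp,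
    opMul_expGroup _ W.continuous_symbol.measurable (by norm_num)]
  norm_num

theorem mem_graph_weylExp_schwartzToL2_iff {t : ℝ} {f h : 𝓢(V, ℂ)} :
    (schwartzToL2 V f, schwartzToL2 V h) ∈ (W.weylExp A B u t).graph ↔
      ∀ y, W.toEquiv h y = (Real.exp (t * W.symbol A B u y) : ℝ) * W.toEquiv f y := by
  have := W.continuous_symbol (A := A) (B := B) (u := u)
  rw [weylExp, expGroup, mem_graph_pullback_iff, unitary_schwartzToL2, unitary_schwartzToL2,
    mem_graph_mulOp_schwartzToL2_iff (by fun_prop)]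

variable {W} {t : ℝ} {f h : 𝓢(V, ℂ)}

theorem momentum_of_mem_graph_weylExp
    (hfh : (schwartzToL2 V f, schwartzToL2 V h) ∈ (W.weylExp A B u t).graph) (v y : V) :
    momentum v (W.toEquiv h) y = (Real.exp (t * W.symbol A B u y) : ℝ) *
      (momentum v (W.toEquiv f) y -
        Complex.I * t * (B * W.a - A * W.c) * (inner ℝ u v : ℝ) * W.toEquiv f y) := by
  have hlin : HasFDerivAt (fun y => ((t * W.symbol A B u y : ℝ) : ℂ))
      (linearForm (t * (B * W.a - A * W.c)) u) y := by
    convert! (linearForm (t * (B * W.a - A * W.c)) u).hasFDerivAt (x := y) using 2 with y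
    rw [linearForm_apply, symbol]
    push_cast
    ring
  have hder : HasFDerivAt (W.toEquiv h) _ y :=
    (hlin.cexp.mul (W.toEquiv f).differentiableAt.hasFDerivAt).congr_of_eventuallyEq
      (Filter.Eventually.of_forall fun y => by
        rw [W.mem_graph_weylExp_schwartzToL2_iff.1 hfh, Complex.ofReal_exp, Pi.mul_apply])
  rw [momentum_apply_of_hasFDerivAt hder, momentum_apply, Complex.ofReal_exp]
  simp only [add_apply, smul_apply, smul_eq_mul, linearForm_apply]
  ring

variable (hW : B * W.b = A * W.d)
include hW

theorem b_mul_slope : W.b * (B * W.a - A * W.c) = A := by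
  linear_combination A * W.det + W.a * hW

theorem d_mul_slope : W.d * (B * W.a - A * W.c) = B := by
  linear_combination B * W.det + W.c * hW

theorem mem_graph_weylExp_position
    (hfh : (schwartzToL2 V f, schwartzToL2 V h) ∈ (W.weylExp A B u t).graph) (v : V) :
    (schwartzToL2 V (position v f),
      schwartzToL2 V (position v h + (Complex.I * (t * A * (inner ℝ u v : ℝ))) • h)) ∈
        (W.weylExp A B u t).graph := by
  rw [mem_graph_weylExp_schwartzToL2_iff]
  intro y
  have hslope : (W.b * (B * W.a - A * W.c) : ℂ) = A := mod_cast b_mul_slope hW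
  simp only [map_add, map_smul, W.map_position, add_apply, smul_apply, smul_eq_mul,
    position_apply, momentum_of_mem_graph_weylExp hfh,
    W.mem_graph_weylExp_schwartzToL2_iff.1 hfh y]
  linear_combination (-(Complex.I * t * (inner ℝ u v : ℝ) *
    (Real.exp (t * W.symbol A B u y) : ℝ) * W.toEquiv f y)) * hslope

theorem mem_graph_weylExp_momentum
    (hfh : (schwartzToL2 V f, schwartzToL2 V h) ∈ (W.weylExp A B u t).graph) (v : V) :
    (schwartzToL2 V (momentum v f),
      schwartzToL2 V (momentum v h + (Complex.I * (t * B * (inner ℝ u v : ℝ))) • h)) ∈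
        (W.weylExp A B u t).graph := by
  rw [mem_graph_weylExp_schwartzToL2_iff]
  intro y
  have hslope : (W.d * (B * W.a - A * W.c) : ℂ) = B := mod_cast d_mul_slope hW
  simp only [map_add, map_smul, W.map_momentum, add_apply, smul_apply, smul_eq_mul,
    position_apply, momentum_of_mem_graph_weylExp hfh,
    W.mem_graph_weylExp_schwartzToL2_iff.1 hfh y]
  linear_combination (-(Complex.I * t * (inner ℝ u v : ℝ) *
    (Real.exp (t * W.symbol A B u y) : ℝ) * W.toEquiv f y)) * hslope

theorem mem_graph_weylExp_lowering
    (hfh : (schwartzToL2 V f, schwartzToL2 V h) ∈ (W.weylExp A B u t).graph) (v : V) (α : ℂ) :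
    (schwartzToL2 V (lowering v α f),
      schwartzToL2 V (lowering v (α + t * constC A B * (inner ℝ u v : ℝ)) h)) ∈
        (W.weylExp A B u t).graph := by
  have hsum := (W.weylExp A B u t).graph.smul_mem (1 / (√2 : ℝ) : ℂ)
    (add_mem (add_mem (mem_graph_weylExp_position hW hfh v)
      (Submodule.smul_mem _ Complex.I (mem_graph_weylExp_momentum hW hfh v)))
      (Submodule.smul_mem _ α hfh))
  simp only [Prod.smul_mk, Prod.mk_add_mk, ← map_smul (schwartzToL2 V), ← map_add] at hsum
  convert! hsum using 3
  simp only [lowering_apply, constC]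
  match_scalars
  · ring
  · ring
  · linear_combination (-(1 / (√2 : ℝ) : ℂ) * (t * B * (inner ℝ u v : ℝ))) * Complex.I_sq

theorem mem_graph_weylExp_raising
    (hfh : (schwartzToL2 V f, schwartzToL2 V h) ∈ (W.weylExp A B u t).graph) (v : V) (β : ℂ) :
    (schwartzToL2 V (raising v β f),
      schwartzToL2 V (raising v (β + t * constD A B * (inner ℝ u v : ℝ)) h)) ∈
        (W.weylExp A B u t).graph := by
  have hsum := (W.weylExp A B u t).graph.smul_mem (1 / (√2 : ℝ) : ℂ)
    (add_mem (sub_mem (mem_graph_weylExp_position hW hfh v)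
      (Submodule.smul_mem _ Complex.I (mem_graph_weylExp_momentum hW hfh v)))
      (Submodule.smul_mem _ β hfh))
  simp only [Prod.smul_mk, Prod.mk_add_mk, Prod.mk_sub_mk, ← map_smul (schwartzToL2 V), ← map_add,
    ← map_sub] at hsum
  convert! hsum using 3
  simp only [raising_apply, constD]
  match_scalars
  · ring
  · ring
  · linear_combination ((1 / (√2 : ℝ) : ℂ) * (t * B * (inner ℝ u v : ℝ))) * Complex.I_sq

theorem exists_mem_graph_weylExp_gaussian (t : ℝ) : ∃ N : ℂ,
    (schwartzToL2 V (gaussian 1 (by simp) 0),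
      schwartzToL2 V (N • gaussian 1 (by simp) (linearForm (-(t * constC A B)) u))) ∈
        (W.weylExp A B u t).graph := by
  have hlow (v : V) : lowering v 0 (gaussian 1 (by simp) 0) = 0 := by
    simpa using lowering_gaussian (0 : V →L[ℝ] ℂ) v
  obtain ⟨N, hN⟩ := exists_eq_const_mul_exp_quadExponent (L := 0)
    (z := (W.a + Complex.I * W.c) / (W.d - Complex.I * W.b))
    (h := W.toEquiv (gaussian 1 (by simp) 0)) fun v => by
    rw [W.momentum_eq_smul_position (hlow v), zero_apply, mul_zero, zero_smul, sub_zero]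
  set h : 𝓢(V, ℂ) := W.toEquiv.symm
    (N • gaussian _ W.re_div_pos (linearForm (t * (B * W.a - A * W.c)) u)) with hh
  have hmem : (schwartzToL2 V (gaussian 1 (by simp) 0), schwartzToL2 V h) ∈
      (W.weylExp A B u t).graph := by
    rw [mem_graph_weylExp_schwartzToL2_iff]
    intro y
    rw [hN, hh, LinearEquiv.apply_symm_apply, smul_apply, gaussian_apply, smul_eq_mul,
      mul_left_comm, Complex.ofReal_exp, ← Complex.exp_add, quadExponent, quadExponent,
      linearForm_apply, symbol, zero_apply]
    push_cast
    ring_nf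
  obtain ⟨N', hN'⟩ := exists_eq_smul_gaussian (L := linearForm (-(t * constC A B)) u) (h := h)
    fun v => by
      have hv := mem_graph_weylExp_lowering hW hmem v 0
      rw [hlow, map_zero, zero_add] at hv
      rw [linearForm_apply, neg_mul, neg_neg]
      exact schwartzToL2_injective
        ((LinearPMap.graph_fst_eq_zero_snd _ hv rfl).trans (map_zero _).symm)
  exact ⟨N', hN' ▸ hmem⟩

end LinearCanonicalTransform

/-! ### The invariant space of Schwartz functions -/

namespace LinearCanonicalTransform

variable {V : Type*} [NormedAddCommGroup V] [InnerProductSpace ℝ V] [FiniteDimensional ℝ V]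
  [MeasurableSpace V] [BorelSpace V] (W : LinearCanonicalTransform V) (A B : ℝ) (u : V)

/-- The Schwartz functions that all `exp(t(-A p_u + B x_u))` map to Schwartz functions. -/
def invariantSchwartz : Submodule ℂ 𝓢(V, ℂ) where
  carrier := {f | ∀ t, ∃ h, (schwartzToL2 V f, schwartzToL2 V h) ∈ (W.weylExp A B u t).graph}
  add_mem' hf hg t := by
    obtain ⟨h, hh⟩ := hf t
    obtain ⟨k, hk⟩ := hg t
    exact ⟨h + k, by simpa only [map_add, Prod.mk_add_mk] using add_mem hh hk⟩
  zero_mem' t := ⟨0, by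
    rw [map_zero]
    exact (W.weylExp A B u t).graph.zero_mem⟩
  smul_mem' c f hf t := by
    obtain ⟨h, hh⟩ := hf t
    exact ⟨c • h, by simpa only [map_smul, Prod.smul_mk] using Submodule.smul_mem _ c hh⟩

variable {W A B u} {s t : ℝ} {f h : 𝓢(V, ℂ)}

theorem mem_invariantSchwartz_of_mem_graph (hf : f ∈ W.invariantSchwartz A B u)
    (hfh : (schwartzToL2 V f, schwartzToL2 V h) ∈ (W.weylExp A B u s).graph) :
    h ∈ W.invariantSchwartz A B u := fun t => by
  obtain ⟨k, hk⟩ := hf (s + t)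
  have hhk := mem_graph_expGroup_add (mem_graph_expGroup_neg_iff.2 hfh) hk
  rw [neg_add_cancel_left] at hhk
  exact ⟨k, hhk⟩

theorem stableUnder_weylExp (t : ℝ) :
    StableUnder ((W.invariantSchwartz A B u).map (schwartzToL2 V)) (W.weylExp A B u t) := by
  rintro _ ⟨f, hf, rfl⟩
  obtain ⟨h, hh⟩ := hf t
  exact ⟨_, ⟨h, mem_invariantSchwartz_of_mem_graph hf hh, rfl⟩, hh⟩

theorem map_invariantSchwartz_le_domain (t : ℝ) :
    (W.invariantSchwartz A B u).map (schwartzToL2 V) ≤ (W.weylExp A B u t).domain := by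
  intro f hf
  obtain ⟨g, -, hg⟩ := stableUnder_weylExp t f hf
  exact LinearPMap.mem_domain_of_mem_graph hg

variable (hW : B * W.b = A * W.d)
include hW

theorem position_mem_invariantSchwartz (v : V) (hf : f ∈ W.invariantSchwartz A B u) :
    position v f ∈ W.invariantSchwartz A B u := fun t => by
  obtain ⟨h, hh⟩ := hf t
  exact ⟨_, mem_graph_weylExp_position hW hh v⟩

theorem lowering_mem_invariantSchwartz (v : V) (α : ℂ) (hf : f ∈ W.invariantSchwartz A B u) :
    lowering v α f ∈ W.invariantSchwartz A B u := fun t => by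
  obtain ⟨h, hh⟩ := hf t
  exact ⟨_, mem_graph_weylExp_lowering hW hh v α⟩

theorem raising_mem_invariantSchwartz (v : V) (β : ℂ) (hf : f ∈ W.invariantSchwartz A B u) :
    raising v β f ∈ W.invariantSchwartz A B u := fun t => by
  obtain ⟨h, hh⟩ := hf t
  exact ⟨_, mem_graph_weylExp_raising hW hh v β⟩

theorem gaussian_zero_mem_invariantSchwartz :
    gaussian 1 (by simp) 0 ∈ W.invariantSchwartz A B u := fun t => by
  obtain ⟨N, hN⟩ := exists_mem_graph_weylExp_gaussian hW t
  exact ⟨_, hN⟩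

theorem gaussian_mem_invariantSchwartz (s : ℝ) :
    gaussian 1 (by simp) (linearForm (-(s * constC A B)) u) ∈ W.invariantSchwartz A B u := by
  obtain ⟨N, hN⟩ := exists_mem_graph_weylExp_gaussian (u := u) hW s
  have hN0 : N ≠ 0 := by
    rintro rfl
    rw [zero_smul, map_zero, ← mem_graph_expGroup_neg_iff] at hN
    have h0 := schwartzToL2_injective
      ((LinearPMap.graph_fst_eq_zero_snd _ hN rfl).trans (map_zero _).symm)
    exact Complex.exp_ne_zero _ (congrArg (fun k : 𝓢(V, ℂ) => k 0) h0)
  exact (Submodule.smul_mem_iff _ hN0).1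
    (mem_invariantSchwartz_of_mem_graph (gaussian_zero_mem_invariantSchwartz hW) hN)

theorem dense_map_invariantSchwartz :
    Dense ((W.invariantSchwartz A B u).map (schwartzToL2 V) :
      Set (Lp ℂ 2 (volume : Measure V))) :=
  dense_map_of_gaussian_mem _ _ (gaussian_zero_mem_invariantSchwartz hW)
    fun v _ => position_mem_invariantSchwartz hW v

theorem eq_zero_of_weylExp_one_bounded (hu : u ≠ 0) {M : ℝ}
    (hM : ∀ f h, (f, h) ∈ (W.weylExp A B u 1).graph → ‖h‖ ≤ M * ‖f‖) : A = 0 ∧ B = 0 := by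
  have hle (y : V) : W.symbol A B u y ≤ |M| := by
    have hdense := Measure.dense_of_ae
      (ae_le_of_expGroup_one_bounded W.continuous_symbol.measurable hM)
    have hclosed : IsClosed {y | W.symbol A B u y ≤ |M|} :=
      isClosed_le W.continuous_symbol continuous_const
    exact hclosed.closure_subset (hdense y)
  have hslope : B * W.a - A * W.c = 0 := by
    by_contra hne
    have h := hle (((|M| + 1) / ((B * W.a - A * W.c) * inner ℝ u u)) • u)
    have hu' : inner ℝ u u ≠ 0 := inner_self_ne_zero.2 hu
    rw [symbol, inner_smul_right] at h
    field_simp at h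
    linarith
  exact ⟨by rw [← b_mul_slope hW, hslope, mul_zero], by rw [← d_mul_slope hW, hslope, mul_zero]⟩

omit hW in
theorem hasTemperateGrowth_symbol : (fun y => (W.symbol A B u y : ℂ)).HasTemperateGrowth := by
  unfold symbol
  fun_prop

theorem map_generator_eq_smulLeftCLM (f : 𝓢(V, ℂ)) :
    W.toEquiv ((-A : ℂ) • momentum u f + (B : ℂ) • position u f) =
      SchwartzMap.smulLeftCLM ℂ (fun y => (W.symbol A B u y : ℂ)) (W.toEquiv f) := by
  ext y
  have hbd : (B * W.b : ℂ) = A * W.d := mod_cast hW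
  rw [SchwartzMap.smulLeftCLM_apply_apply hasTemperateGrowth_symbol, map_add, map_smul, map_smul,
    W.map_momentum, W.map_position]
  simp only [add_apply, smul_apply, smul_eq_mul, position_apply, symbol, real_inner_comm u]
  push_cast
  linear_combination (momentum u (W.toEquiv f) y) * hbd

theorem graph_pullback_symbol_le_topologicalClosure :
    (pullback W.unitary (mulOp volume (W.symbol A B u))).graph ≤
      (LinearMap.range ((schwartzToL2 V).prod (schwartzToL2 V ∘ₗ
        ((-A : ℂ) • momentum u + (B : ℂ) • position u)))).topologicalClosure := by
  set K : Module.End ℂ 𝓢(V, ℂ) := (-A : ℂ) • momentum u + (B : ℂ) • position u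
  set S : Module.End ℂ 𝓢(V, ℂ) :=
    (SchwartzMap.smulLeftCLM ℂ fun y => (W.symbol A B u y : ℂ)).toLinearMap
  have hmaps : Set.MapsTo (Prod.map W.unitary.symm W.unitary.symm)
      (LinearMap.range ((schwartzToL2 V).prod (schwartzToL2 V ∘ₗ S)) : Set (_ × _))
      (LinearMap.range ((schwartzToL2 V).prod (schwartzToL2 V ∘ₗ K)) : Set (_ × _)) := by
    rintro _ ⟨k, rfl⟩
    have hk :=
      congrArg (schwartzToL2 V) (map_generator_eq_smulLeftCLM (u := u) hW (W.toEquiv.symm k))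
    rw [← unitary_schwartzToL2, LinearEquiv.apply_symm_apply] at hk
    exact ⟨W.toEquiv.symm k, Prod.ext (by simp [LinearIsometryEquiv.eq_symm_apply,
      unitary_schwartzToL2]) (W.unitary.eq_symm_apply.2 hk)⟩
  rintro ⟨f, h⟩ hfh
  have hcore : (W.unitary f, W.unitary h) ∈
      closure (LinearMap.range ((schwartzToL2 V).prod (schwartzToL2 V ∘ₗ S)) : Set (_ × _)) :=
    graph_mulOp_le_topologicalClosure_schwartz hasTemperateGrowth_symbol
      (mem_graph_pullback_iff.1 hfh)
  have hmem := map_mem_closure (by fun_prop) hcore hmaps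
  rwa [Prod.map_apply, LinearIsometryEquiv.symm_apply_apply, LinearIsometryEquiv.symm_apply_apply]
    at hmem

end LinearCanonicalTransform

/-! ### Quasi bases and intertwining relations -/

section QuasiBases

variable {E : Type*} [NormedAddCommGroup E] [InnerProductSpace ℂ E] {T : E →ₗ.[ℂ] E}

theorem hasSum_inner_mul_inner_of_mem_graph {ι : Type*} (e : HilbertBasis ι ℂ E)
    (hT : T.graph ≤ T.graph.adjoint) {φ ψ : ι → E} (hφ : ∀ n, (e n, φ n) ∈ T.graph)
    (hψ : ∀ n, (ψ n, e n) ∈ T.graph) {f f' g g' : E} (hf : (f, f') ∈ T.graph)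
    (hg : (g', g) ∈ T.graph) :
    HasSum (fun n => inner ℂ f (φ n) * inner ℂ (ψ n) g) (inner ℂ f g) := by
  have hsymm {u v w z : E} (huv : (u, v) ∈ T.graph) (hwz : (w, z) ∈ T.graph) :
      inner ℂ v w = inner ℂ u z :=
    mem_adjoint_iff_inner_eq.1 (hT hwz) u v huv
  simpa only [hsymm hf (hφ _), hsymm (hψ _) hg, hsymm hf hg] using
    e.hasSum_inner_mul_inner f' g'

theorem isQuasiBases_of_hilbertBasis {ι : Type*} (e : HilbertBasis ι ℂ E)
    (hT : T.graph ≤ T.graph.adjoint) (hker : LinearMap.ker T.toFun = ⊥)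
    (hdense : Dense ((T.domain ⊓ T.inverse.domain : Submodule ℂ E) : Set E)) {φ ψ : ι → E}
    (hφ : ∀ n, (e n, φ n) ∈ T.graph) (hψ : ∀ n, (e n, ψ n) ∈ T.inverse.graph)
    (hφ_mem : ∀ n, φ n ∈ T.domain) (hψ_mem : ∀ n, ψ n ∈ T.inverse.domain) :
    IsQuasiBases (T.domain ⊓ T.inverse.domain) φ ψ := by
  have hψ' (n : ι) := (mem_graph_inverse_iff hker).1 (hψ n)
  have hsum {f g : E} (hf : f ∈ T.domain) (hg : g ∈ T.inverse.domain) :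
      HasSum (fun n => inner ℂ f (φ n) * inner ℂ (ψ n) g) (inner ℂ f g) :=
    hasSum_inner_mul_inner_of_mem_graph e hT hφ hψ' (T.mem_graph ⟨f, hf⟩)
      ((mem_graph_inverse_iff hker).1 (T.inverse.mem_graph ⟨g, hg⟩))
  exact {
    dense := hdense
    mem_left := fun n => ⟨hφ_mem n,
      LinearPMap.mem_domain_of_mem_graph ((mem_graph_inverse_iff hker).2 (hφ n))⟩
    mem_right := fun n => ⟨LinearPMap.mem_domain_of_mem_graph (hψ' n), hψ_mem n⟩
    hasSum_left := fun f hf g hg => hsum hf.1 hg.2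
    hasSum_right := fun f hf g hg => by
      simpa only [← starRingEnd_apply, map_mul, inner_conj_symm, mul_comm]
        using (hsum hg.1 hf.2).star }

theorem IsQuasiBases.smul {ι : Type*} {𝒢 : Submodule ℂ E} {φ ψ : ι → E}
    (h : IsQuasiBases 𝒢 φ ψ) {c c' : ℂ} (hc : starRingEnd ℂ c * c' = 1) :
    IsQuasiBases 𝒢 (fun n => c • φ n) fun n => c' • ψ n where
  dense := h.dense
  mem_left n := 𝒢.smul_mem c (h.mem_left n)
  mem_right n := 𝒢.smul_mem c' (h.mem_right n)
  hasSum_left f hf g hg := by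
    have hc' : starRingEnd ℂ c' * c = 1 := by simpa [mul_comm] using congrArg (starRingEnd ℂ) hc
    convert h.hasSum_left f hf g hg using 2 with n
    rw [inner_smul_right, inner_smul_left]
    linear_combination (inner ℂ f (φ n) * inner ℂ (ψ n) g) * hc'
  hasSum_right f hf g hg := by
    convert h.hasSum_right f hf g hg using 2 with n
    rw [inner_smul_right, inner_smul_left]
    linear_combination (inner ℂ f (ψ n) * inner ℂ (φ n) g) * hc

theorem intertwines_of_mem_graph {L M : E →ₗ.[ℂ] E} {f g u v : E}
    (hker : LinearMap.ker T.toFun = ⊥) (hfg : (f, g) ∈ T.graph) (hL : (f, u) ∈ L.graph)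
    (hM : (g, v) ∈ M.graph) (huv : (u, v) ∈ T.graph) : Intertwines T L M f :=
  ⟨u, hL, mem_graph_opMul_iff.2
    ⟨v, mem_graph_opMul_iff.2 ⟨g, hfg, hM⟩, (mem_graph_inverse_iff hker).2 huv⟩⟩

end QuasiBases

/-! ### The three families of vectors -/

section Families

/-- The vector `(1, 1)`, for which `x₁ + x₂` and `p₁ + p₂` are the position and the momentum along
it. -/
def diagonal : Plane := axis 0 + axis 1

theorem inner_diagonal_left (y : Plane) : inner ℝ diagonal y = y 0 + y 1 := by
  rw [real_inner_comm, diagonal, inner_add_right, inner_axis_right, inner_axis_right]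

theorem inner_diagonal_axis (j : Fin 2) : inner ℝ diagonal (axis j) = 1 := by
  rw [inner_diagonal_left]
  fin_cases j <;> simp

theorem diagonal_ne_zero : diagonal ≠ 0 := fun h => by
  simpa [h] using inner_diagonal_axis 0

/-- The Schwartz function `exp(-½(x₁² + x₂²) - k(x₁ + x₂))`. -/
def vacuum (k : ℂ) : 𝓢(Plane, ℂ) := gaussian 1 (by simp) (linearForm (-k) diagonal)

theorem vacuum_zero : vacuum 0 = gaussian 1 (by simp) 0 := by
  have hform : linearForm 0 diagonal = 0 := by
    ext y
    exact zero_mul _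
  rw [vacuum, neg_zero, hform]

theorem vacuum_apply (k : ℂ) (y : Plane) : vacuum k y = gaussFun 1 k y := by
  rw [vacuum, gaussian_apply, quadExponent, linearForm_apply, inner_diagonal_left, gaussFun,
    EuclideanSpace.real_norm_sq_eq, Fin.sum_univ_two, one_mul]
  push_cast
  ring_nf

theorem gauss_eq_embed (N k : ℂ) : gauss N k = embed (N • vacuum k) := by
  refine Lp.ext ((memLp_gaussFun N k).coeFn_toLp.trans (.trans ?_ (coeFn_schwartzToL2 _).symm))
  refine Filter.Eventually.of_forall fun y => ?_
  simp only [smul_apply, vacuum_apply, gaussFun, smul_eq_mul, one_mul]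

theorem lowering_vacuum (k : ℂ) (j : Fin 2) : lowering (axis j) k (vacuum k) = 0 := by
  have h := lowering_gaussian (linearForm (-k) diagonal) (axis j)
  rwa [linearForm_apply, inner_diagonal_axis, Complex.ofReal_one, mul_one, neg_neg] at h

/-- The family obtained from the oscillator eigenfunctions (`s = 0`) by the action of
`exp(s(-A(p₁ + p₂) + B(x₁ + x₂)))`, up to a constant; `s = 1` gives `φ_n` and `s = -1` gives
`Ψ_n`. -/
def displacedLadder (A B s : ℝ) : ℕ × ℕ → 𝓢(Plane, ℂ) :=
  ladder (fun j => raising (axis j) (s * constD A B)) (vacuum (s * constC A B))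

theorem phi_eq_embed (A B : ℝ) (N : ℂ) (n : ℕ × ℕ) :
    phi A B N n = N • embed (displacedLadder A B 1 n) := by
  rw [phi, gauss_eq_embed, tower_map (actsAs_bOp A B), ladder_smul, map_smul, displacedLadder,
    Complex.ofReal_one, one_mul, one_mul]

theorem psi_eq_embed (A B : ℝ) (N : ℂ) (n : ℕ × ℕ) :
    psi A B N n = N • embed (displacedLadder A B (-1) n) := by
  rw [psi, gauss_eq_embed, tower_map fun j => (actsAs_aOp A B j).adjoint denseRange_embed,
    ladder_smul, map_smul, displacedLadder, conj_constD, Complex.ofReal_neg, Complex.ofReal_one,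
    neg_one_mul, neg_one_mul]

/-- The oscillator eigenfunctions `Φ_n` as Schwartz functions. -/
def hermite : ℕ × ℕ → 𝓢(Plane, ℂ) :=
  ladder (fun j => raising (axis j) 0) ((1 / (√Real.pi : ℝ) : ℂ) • vacuum 0)

theorem actsAs_cOp (j : Fin 2) :
    ActsAs embed (cOp j) (lowering (axis j) 0) (raising (axis j) 0) := by
  have h := actsAs_aOp 0 0 j
  rw [← cOp_eq_aOp_zero] at h
  simpa [constC, constD] using h

theorem bigPhi_eq_embed (n : ℕ × ℕ) : bigPhi n = embed (hermite n) := by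
  rw [bigPhi, gauss_eq_embed, tower_map fun j => (actsAs_cOp j).adjoint denseRange_embed, hermite]

theorem phi_mul (A B : ℝ) (c N : ℂ) (n : ℕ × ℕ) : phi A B (c * N) n = c • phi A B N n := by
  rw [phi_eq_embed, phi_eq_embed, mul_smul]

theorem psi_mul (A B : ℝ) (c N : ℂ) (n : ℕ × ℕ) : psi A B (c * N) n = c • psi A B N n := by
  rw [psi_eq_embed, psi_eq_embed, mul_smul]

theorem ne_zero_of_inner_phi_psi_eq_one {A B : ℝ} {N N' : ℂ} {m n : ℕ × ℕ}
    (h : inner ℂ (phi A B N m) (psi A B N' n) = 1) : N ≠ 0 ∧ N' ≠ 0 := by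
  constructor <;> rintro rfl <;> simp [phi_eq_embed, psi_eq_embed] at h

theorem phi_mem_schwartz (A B : ℝ) (N : ℂ) (n : ℕ × ℕ) : phi A B N n ∈ schwartz :=
  phi_eq_embed A B N n ▸ schwartz.smul_mem N ⟨_, rfl⟩

theorem psi_mem_schwartz (A B : ℝ) (N : ℂ) (n : ℕ × ℕ) : psi A B N n ∈ schwartz :=
  psi_eq_embed A B N n ▸ schwartz.smul_mem N ⟨_, rfl⟩

theorem mem_graph_vacuum_zero {L : Hil →ₗ.[ℂ] Hil} {k : ℂ} {j : Fin 2}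
    {ℓ' : Module.End ℂ 𝓢(Plane, ℂ)} (hL : ActsAs embed L (lowering (axis j) k) ℓ') (c : ℂ) :
    (c • embed (vacuum k), 0) ∈ L.graph := by
  have h := L.graph.smul_mem c (hL.mem_graph (vacuum k))
  rwa [lowering_vacuum, map_zero, Prod.smul_mk, smul_zero] at h

theorem displacedLadder_zero (A B s : ℝ) : displacedLadder A B s 0 = vacuum (s * constC A B) :=
  ladder_zero

theorem phi_zero_mem_graph_aOp (A B : ℝ) (N : ℂ) (j : Fin 2) :
    (phi A B N 0, 0) ∈ (aOp A B j).graph := by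
  rw [phi_eq_embed, displacedLadder_zero, Complex.ofReal_one, one_mul]
  exact mem_graph_vacuum_zero (actsAs_aOp A B j) N

theorem psi_zero_mem_graph_bOp_adjoint (A B : ℝ) (N : ℂ) (j : Fin 2) :
    (psi A B N 0, 0) ∈ ((bOp A B j)†).graph := by
  rw [psi_eq_embed, displacedLadder_zero, Complex.ofReal_neg, Complex.ofReal_one, neg_one_mul]
  exact mem_graph_vacuum_zero ((actsAs_bOp A B j).adjoint denseRange_embed) N

theorem bigPhi_zero_mem_graph_cOp (j : Fin 2) : (bigPhi 0, 0) ∈ (cOp j).graph := by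
  rw [bigPhi_eq_embed, hermite, ladder_zero, map_smul]
  exact mem_graph_vacuum_zero (actsAs_cOp j) _

end Families

/-! ### The oscillator eigenfunctions -/

section Hermite

theorem inner_normalized_vacuum :
    inner ℂ (embed ((1 / (√Real.pi : ℝ) : ℂ) • vacuum 0))
      (embed ((1 / (√Real.pi : ℝ) : ℂ) • vacuum 0)) = 1 := by
  have hgauss (y : Plane) : starRingEnd ℂ (vacuum 0 y) * vacuum 0 y =
      (Real.exp (-1 * ‖y‖ ^ 2) : ℝ) := by
    have hreal : vacuum 0 y = (Real.exp (-(‖y‖ ^ 2 / 2)) : ℝ) := by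
      rw [vacuum, gaussian_apply, quadExponent, linearForm_apply, Complex.ofReal_exp]
      push_cast
      ring_nf
    rw [hreal, Complex.conj_ofReal, ← Complex.ofReal_mul, ← Real.exp_add]
    ring_nf
  have hint : inner ℂ (embed (vacuum 0)) (embed (vacuum 0)) = (Real.pi : ℂ) := by
    refine (inner_schwartzToL2 _ _).trans ?_
    simp only [hgauss]
    rw [integral_complex_ofReal, GaussianFourier.integral_rexp_neg_mul_sq_norm one_pos]
    simp
  have hpi : (√Real.pi : ℂ) * √Real.pi = Real.pi := by
    rw [← Complex.ofReal_mul, Real.mul_self_sqrt Real.pi_pos.le]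
  rw [map_smul, inner_smul_left, inner_smul_right, hint, map_div₀, map_one, Complex.conj_ofReal,
    ← hpi]
  have hne : (√Real.pi : ℂ) ≠ 0 := Complex.ofReal_ne_zero.2 (Real.sqrt_ne_zero'.2 Real.pi_pos)
  field_simp

theorem lowering_normalized_vacuum (j : Fin 2) :
    lowering (axis j) 0 ((1 / (√Real.pi : ℝ) : ℂ) • vacuum 0) = 0 := by
  rw [map_smul, lowering_vacuum, smul_zero]

theorem orthonormal_bigPhi : Orthonormal ℂ bigPhi := by
  rw [funext bigPhi_eq_embed]
  exact orthonormal_ladder (lie_lowering_raising_axis 0 0) lowering_normalized_vacuum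
    (fun j => (actsAs_cOp j).inner_map_left) inner_normalized_vacuum

theorem position_eq_sum_axis (v : Plane) : position v = ∑ j, (v j : ℂ) • position (axis j) := by
  ext f y
  rw [Fin.sum_univ_two]
  simp only [LinearMap.add_apply, LinearMap.smul_apply, add_apply, smul_apply, position_apply,
    inner_axis_right, smul_eq_mul]
  rw [PiLp.inner_apply, Fin.sum_univ_two]
  simp only [RCLike.inner_apply, conj_trivial]
  push_cast
  ring

theorem position_eq_lowering_add_raising (v : Plane) :
    position v = (1 / (√2 : ℝ) : ℂ) • (lowering v 0 + raising v 0) := by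
  ext1 f
  rw [LinearMap.smul_apply, LinearMap.add_apply, lowering_apply, raising_apply]
  have h2 := inv_sqrt_two_mul_self
  match_scalars
  · linear_combination (-2) * h2
  · ring
  · ring

theorem dense_span_bigPhi : Dense (Submodule.span ℂ (Set.range bigPhi) : Set Hil) := by
  have hspan : Submodule.span ℂ (Set.range bigPhi) =
      (Submodule.span ℂ (Set.range hermite)).map embed := by
    rw [Submodule.map_span, ← Set.range_comp]
    exact congrArg (fun e => Submodule.span ℂ (Set.range e)) (funext bigPhi_eq_embed)
  have hne : (1 / (√Real.pi : ℝ) : ℂ) ≠ 0 :=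
    one_div_ne_zero (Complex.ofReal_ne_zero.2 (Real.sqrt_ne_zero'.2 Real.pi_pos))
  have hcomm : Commute (raising (axis 0) 0) (raising (axis 1) 0) :=
    sub_eq_zero.1 (lie_raising_raising _ _ _ _)
  rw [hspan]
  refine dense_map_of_gaussian_mem _ _
    ((Submodule.smul_mem_iff _ hne).1 (Submodule.subset_span ⟨0, ladder_zero⟩)) fun v f hf => ?_
  rw [position_eq_sum_axis, LinearMap.sum_apply]
  refine Submodule.sum_mem _ fun j _ => Submodule.smul_mem _ _ ?_
  rw [position_eq_lowering_add_raising]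
  exact Submodule.smul_mem _ _ (add_mem
    (lowering_mem_span_ladder (lie_lowering_raising_axis 0 0) lowering_normalized_vacuum j hf)
    (raising_mem_span_ladder hcomm j hf))

theorem exists_hilbertBasis_bigPhi : ∃ e : HilbertBasis (ℕ × ℕ) ℂ Hil, ∀ n, e n = bigPhi n :=
  ⟨.mk orthonormal_bigPhi
    (Submodule.dense_iff_topologicalClosure_eq_top.1 dense_span_bigPhi).ge,
    congrFun (HilbertBasis.coe_mk _ _)⟩

end Hermite

/-! ### The operators `T` and `Θ` -/

section Model

variable {A B : ℝ} {W : LinearCanonicalTransform Plane} (hW : B * W.b = A * W.d)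
include hW

theorem displacedLadder_mem_invariantSchwartz (s : ℝ) (n : ℕ × ℕ) :
    displacedLadder A B s n ∈ W.invariantSchwartz A B diagonal :=
  ladder_mem (fun _ _ hf => LinearCanonicalTransform.raising_mem_invariantSchwartz hW _ _ hf)
    (LinearCanonicalTransform.gaussian_mem_invariantSchwartz hW s) n

theorem phi_mem_invariantSchwartz (N : ℂ) (n : ℕ × ℕ) :
    phi A B N n ∈ (W.invariantSchwartz A B diagonal).map embed :=
  phi_eq_embed A B N n ▸ Submodule.smul_mem _ N
    (Submodule.mem_map_of_mem (displacedLadder_mem_invariantSchwartz hW 1 n))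

theorem psi_mem_invariantSchwartz (N : ℂ) (n : ℕ × ℕ) :
    psi A B N n ∈ (W.invariantSchwartz A B diagonal).map embed :=
  psi_eq_embed A B N n ▸ Submodule.smul_mem _ N
    (Submodule.mem_map_of_mem (displacedLadder_mem_invariantSchwartz hW (-1) n))

theorem isPseudoBosonic_invariantSchwartz :
    IsPseudoBosonic ((W.invariantSchwartz A B diagonal).map embed) (aOp A B) (bOp A B) :=
  isPseudoBosonic_map_embed A B (LinearCanonicalTransform.dense_map_invariantSchwartz hW)
    (fun _ _ _ => LinearCanonicalTransform.lowering_mem_invariantSchwartz hW _ _)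
    (fun _ _ _ => LinearCanonicalTransform.raising_mem_invariantSchwartz hW _ _)

theorem generator_eq_pullback :
    generator A B = pullback W.unitary (mulOp volume (W.symbol A B diagonal)) := by
  have hgen := (((actsAs_pOp 0).add (actsAs_pOp 1)).smul (-A)).add
    (((actsAs_xOp 0).add (actsAs_xOp 1)).smul B)
  rw [map_neg, Complex.conj_ofReal, Complex.conj_ofReal, ← momentum_add, ← position_add] at hgen
  exact hgen.closure_eq
    (isSelfAdjoint_pullback _ (isSelfAdjoint_mulOp W.continuous_symbol.measurable))
    (LinearCanonicalTransform.graph_pullback_symbol_le_topologicalClosure hW)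

theorem isFunctionOf_weylExp (t : ℝ) :
    IsFunctionOf Real.exp (generator (t * A) (t * B)) (W.weylExp A B diagonal t) := by
  have hsymbol : W.symbol (t * A) (t * B) diagonal = fun y => t * W.symbol A B diagonal y := by
    funext y
    simp only [LinearCanonicalTransform.symbol]
    ring
  refine isFunctionOf_expGroup W.continuous_symbol.measurable W.unitary fun f h => ?_
  rw [generator_eq_pullback (W := W) (by linear_combination t * hW), mem_graph_pullback_iff,
    hsymbol]

theorem exists_mem_graph_weylExp_displacedLadder (t : ℝ) : ∃ N : ℂ, ∀ n,
    (bigPhi n, N • embed (displacedLadder A B t n)) ∈ (W.weylExp A B diagonal t).graph := by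
  obtain ⟨N, hN⟩ := LinearCanonicalTransform.exists_mem_graph_weylExp_gaussian
    (u := diagonal) hW t
  rw [← vacuum_zero] at hN
  refine ⟨(1 / (√Real.pi : ℝ) : ℂ) * N, fun n => ?_⟩
  rw [bigPhi_eq_embed, hermite, displacedLadder, ← map_smul, mul_smul, ← ladder_smul,
    ← ladder_smul]
  refine ladder_mem_of_pair_stable
    (G := (W.weylExp A B diagonal t).graph.comap (embed.prodMap embed)) (fun j x hx => ?_) ?_ n
  · have h := LinearCanonicalTransform.mem_graph_weylExp_raising hW hx (axis j) 0
    rw [inner_diagonal_axis, Complex.ofReal_one, mul_one, zero_add] at h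
    exact h
  · rw [Submodule.mem_comap, LinearMap.prodMap_apply, map_smul, map_smul]
    exact Submodule.smul_mem _ _ hN

theorem exists_normalization : ∃ N N' : ℂ, inner ℂ (phi A B N 0) (psi A B N' 0) = 1 ∧
    ∀ n, (bigPhi n, phi A B N n) ∈ (W.weylExp A B diagonal 1).graph ∧
      (bigPhi n, psi A B N' n) ∈ (W.weylExp A B diagonal 1).inverse.graph ∧
      (phi A B N n, psi A B N' n) ∈ (W.weylExp A B diagonal (-2)).graph := by
  obtain ⟨N, hN⟩ := exists_mem_graph_weylExp_displacedLadder hW 1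
  obtain ⟨N', hN'⟩ := exists_mem_graph_weylExp_displacedLadder hW (-1)
  simp only [← phi_eq_embed, ← psi_eq_embed] at hN hN'
  refine ⟨N, N', ?_, fun n => ⟨hN n, ?_, ?_⟩⟩
  case refine_2 =>
    rw [W.inverse_weylExp]
    exact hN' n
  case refine_3 =>
    rw [show (-2 : ℝ) = -1 + -1 by norm_num]
    exact mem_graph_expGroup_add (mem_graph_expGroup_neg_iff.2 (hN n)) (hN' n)
  rw [inner_expGroup_comm (mem_graph_expGroup_neg_iff.1 (hN' 0)) (hN 0),
    inner_self_eq_norm_sq_to_K, orthonormal_bigPhi.1]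
  simp

theorem isQuasiBases_phi_psi {N N' : ℂ} (h : inner ℂ (phi A B N 0) (psi A B N' 0) = 1) :
    IsQuasiBases ((W.weylExp A B diagonal 1).domain ⊓ (W.weylExp A B diagonal 1).inverse.domain)
      (phi A B N) (psi A B N') := by
  obtain ⟨e, he⟩ := exists_hilbertBasis_bigPhi
  obtain ⟨N₀, N₀', h₀, hT⟩ := exists_normalization hW
  obtain ⟨hN₀, hN₀'⟩ := ne_zero_of_inner_phi_psi_eq_one h₀
  obtain ⟨c, rfl⟩ : ∃ c, N = c * N₀ := ⟨N / N₀, (div_mul_cancel₀ _ hN₀).symm⟩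
  obtain ⟨c', rfl⟩ : ∃ c', N' = c' * N₀' := ⟨N' / N₀', (div_mul_cancel₀ _ hN₀').symm⟩
  have hc : starRingEnd ℂ c * c' = 1 := by
    rwa [phi_mul, psi_mul, inner_smul_left, inner_smul_right, h₀, mul_one] at h
  have hinv := W.inverse_weylExp (A := A) (B := B) (u := diagonal) 1
  have hle := W.map_invariantSchwartz_le_domain (A := A) (B := B) (u := diagonal)
  rw [funext (phi_mul A B c N₀), funext (psi_mul A B c' N₀')]
  refine (isQuasiBases_of_hilbertBasis e ?_ (ker_expGroup _ _ _) ?_ ?_ ?_ ?_ ?_).smul hc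
  · exact (graph_adjoint_of_isSelfAdjoint (W.isSelfAdjoint_weylExp 1)).ge
  · rw [hinv]
    exact (LinearCanonicalTransform.dense_map_invariantSchwartz hW).mono (le_inf (hle 1) (hle (-1)))
  · exact fun n => he n ▸ (hT n).1
  · exact fun n => he n ▸ (hT n).2.1
  · exact fun n => hle 1 (phi_mem_invariantSchwartz hW _ n)
  · exact fun n => hinv ▸ hle (-1) (psi_mem_invariantSchwartz hW _ n)

theorem not_bounded_weylExp_one (h : A ≠ 0 ∨ B ≠ 0) :
    ¬ ∃ M : ℝ, ∀ f : (W.weylExp A B diagonal 1).domain,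
      ‖W.weylExp A B diagonal 1 f‖ ≤ M * ‖f‖ := by
  rintro ⟨M, hM⟩
  obtain ⟨hA, hB⟩ := LinearCanonicalTransform.eq_zero_of_weylExp_one_bounded hW diagonal_ne_zero
    (M := M) fun f k hfk => by
      obtain ⟨hf, rfl⟩ := mem_graph_iff_exists_apply_eq.1 hfk
      exact hM ⟨f, hf⟩
  exact h.elim (· hA) (· hB)

theorem mem_graph_weylExp_neg_two_lowering {f g : 𝓢(Plane, ℂ)}
    (hfg : (embed f, embed g) ∈ (W.weylExp A B diagonal (-2)).graph) (j : Fin 2) :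
    (embed (lowering (axis j) (constC A B) f), embed (lowering (axis j) (-constC A B) g)) ∈
      (W.weylExp A B diagonal (-2)).graph := by
  have h := LinearCanonicalTransform.mem_graph_weylExp_lowering hW hfg (axis j) (constC A B)
  have hconst : constC A B + ((-2 : ℝ) : ℂ) * constC A B * ((1 : ℝ) : ℂ) = -constC A B := by
    push_cast
    ring
  rwa [inner_diagonal_axis, hconst] at h

theorem mem_graph_weylExp_neg_two_raising {f g : 𝓢(Plane, ℂ)}
    (hfg : (embed f, embed g) ∈ (W.weylExp A B diagonal (-2)).graph) (j : Fin 2) :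
    (embed (raising (axis j) (constD A B) f), embed (raising (axis j) (-constD A B) g)) ∈
      (W.weylExp A B diagonal (-2)).graph := by
  have h := LinearCanonicalTransform.mem_graph_weylExp_raising hW hfg (axis j) (constD A B)
  have hconst : constD A B + ((-2 : ℝ) : ℂ) * constD A B * ((1 : ℝ) : ℂ) = -constD A B := by
    push_cast
    ring
  rwa [inner_diagonal_axis, hconst] at h

theorem intertwines_aOp {f g : 𝓢(Plane, ℂ)}
    (hfg : (embed f, embed g) ∈ (W.weylExp A B diagonal (-2)).graph) (j : Fin 2) :
    Intertwines (W.weylExp A B diagonal (-2)) (aOp A B j) (bOp A B j)† (embed f) :=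
  intertwines_of_mem_graph (ker_expGroup _ _ _) hfg ((actsAs_aOp A B j).mem_graph f)
    (((actsAs_bOp A B j).adjoint denseRange_embed).mem_graph g)
    (mem_graph_weylExp_neg_two_lowering hW hfg j)

theorem intertwines_num {f g : 𝓢(Plane, ℂ)}
    (hfg : (embed f, embed g) ∈ (W.weylExp A B diagonal (-2)).graph) (j : Fin 2) :
    Intertwines (W.weylExp A B diagonal (-2)) (num A B j) (num A B j)† (embed f) :=
  have hnum := (actsAs_bOp A B j).opMul (actsAs_aOp A B j)
  intertwines_of_mem_graph (ker_expGroup _ _ _) hfg (hnum.mem_graph f)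
    ((hnum.adjoint denseRange_embed).mem_graph g)
    (mem_graph_weylExp_neg_two_raising hW (mem_graph_weylExp_neg_two_lowering hW hfg j) j)

theorem isConjugate_invariantSchwartz (j : Fin 2) :
    IsConjugate ((W.invariantSchwartz A B diagonal).map embed) (W.weylExp A B diagonal (-2))
      (aOp A B j) (bOp A B j)† where
  selfAdjoint := W.isSelfAdjoint_weylExp _
  injective := ker_expGroup _ _ _
  stable := W.stableUnder_weylExp _
  stable_inv := by
    rw [W.inverse_weylExp]
    exact W.stableUnder_weylExp _
  conj := by
    rintro _ ⟨f, hf, rfl⟩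
    obtain ⟨g, hg⟩ := hf (-2)
    exact intertwines_aOp hW hg j

end Model

end PB

end

theorem mainTheorem2 (A B : ℝ) :
    -- `a_j`, `b_j` are `𝒟`-pseudo-bosons for `𝒟 = 𝒮(ℝ²)`
    IsPseudoBosonic schwartz (aOp A B) (bOp A B) ∧
    -- the vacua and all the vectors built on them
    (∃ N N' : ℂ, inner ℂ (phi A B N 0) (psi A B N' 0) = 1) ∧
    (∀ N N' : ℂ, inner ℂ (phi A B N 0) (psi A B N' 0) = 1 →
      phi A B N 0 ≠ 0 ∧ psi A B N' 0 ≠ 0 ∧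
      (∀ j, (phi A B N 0, 0) ∈ (aOp A B j).graph ∧ (psi A B N' 0, 0) ∈ ((bOp A B j)†).graph) ∧
      (∀ n, phi A B N n ∈ schwartz ∧ psi A B N' n ∈ schwartz)) ∧
    -- `H = N₁ + N₂ + (A² + B² + 1) 𝟙` on `𝒟`
    (∀ f ∈ schwartz, ∃ g, (f, g) ∈ (hamiltonian A B).graph ∧
      (f, g) ∈ (num A B 0 + num A B 1 + scalarOp ((A : ℂ) ^ 2 + (B : ℂ) ^ 2 + 1)).graph) ∧
    -- the oscillator eigenfunctions
    (∀ j, (bigPhi 0, 0) ∈ (cOp j).graph) ∧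
    (∃ e : HilbertBasis (ℕ × ℕ) ℂ Hil, ∀ n, e n = bigPhi n) ∧
    -- `T = e^{-A(p₁+p₂)+B(x₁+x₂)}`
    ∃ T : Hil →ₗ.[ℂ] Hil,
      IsFunctionOf Real.exp (generator A B) T ∧
      (∀ T', IsFunctionOf Real.exp (generator A B) T' → T' = T) ∧
      IsSelfAdjoint T ∧ LinearMap.ker T.toFun = ⊥ ∧ Dense (T.inverse.domain : Set Hil) ∧
      ((A ≠ 0 ∨ B ≠ 0) → ¬ ∃ M : ℝ, ∀ f : T.domain, ‖T f‖ ≤ M * ‖f‖) ∧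
      -- quasi bases
      (∀ N N' : ℂ, inner ℂ (phi A B N 0) (psi A B N' 0) = 1 →
        IsQuasiBases (T.domain ⊓ T.inverse.domain) (phi A B N) (psi A B N')) ∧
      -- `φ_n = T Φ_n`, `Ψ_n = T⁻¹ Φ_n` and `Ψ_n = Θ φ_n` with `Θ = T⁻²`
      (∃ N N' : ℂ, inner ℂ (phi A B N 0) (psi A B N' 0) = 1 ∧
        ∀ n, (bigPhi n, phi A B N n) ∈ T.graph ∧
          (bigPhi n, psi A B N' n) ∈ T.inverse.graph ∧
          (phi A B N n, psi A B N' n) ∈ (opMul T.inverse T.inverse).graph) ∧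
      -- `Θ = T⁻² = e^{2A(p₁+p₂)-2B(x₁+x₂)}`
      ∃ Θ : Hil →ₗ.[ℂ] Hil, Θ = opMul T.inverse T.inverse ∧
        IsFunctionOf Real.exp (generator (-2 * A) (-2 * B)) Θ ∧
        IsSelfAdjoint Θ ∧ LinearMap.ker Θ.toFun = ⊥ ∧
        -- `a_j f = Θ⁻¹ b_j† Θ f` and `N_j f = Θ⁻¹ N_j† Θ f` for all `f ∈ 𝒟` that `Θ` maps into `𝒟`
        (∀ f ∈ schwartz, ∀ g ∈ schwartz, (f, g) ∈ Θ.graph → ∀ j,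
          Intertwines Θ (aOp A B j) (bOp A B j)† f ∧
          Intertwines Θ (num A B j) (num A B j)† f) ∧
        -- `Θ`-conjugacy on a dense subspace of `𝒟` invariant under `Θ` and `Θ⁻¹`
        ∃ 𝒟₀ : Submodule ℂ Hil, 𝒟₀ ≤ schwartz ∧
          (∀ N n, phi A B N n ∈ 𝒟₀ ∧ psi A B N n ∈ 𝒟₀) ∧
          IsPseudoBosonic 𝒟₀ (aOp A B) (bOp A B) ∧
          ∀ j, IsConjugate 𝒟₀ Θ (aOp A B j) (bOp A B j)† := by
  obtain ⟨W, hW⟩ := LinearCanonicalTransform.exists_mul_b_eq_mul_d (V := Plane) A B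
  have hT : IsFunctionOf Real.exp (generator A B) (W.weylExp A B diagonal 1) := by
    simpa only [one_mul] using isFunctionOf_weylExp hW 1
  obtain ⟨N, N', hN, hNT⟩ := exists_normalization hW
  refine ⟨isPseudoBosonic_schwartz A B, ⟨N, N', hN⟩, fun N N' h => ⟨?_, ?_, fun j =>
    ⟨phi_zero_mem_graph_aOp A B N j, psi_zero_mem_graph_bOp_adjoint A B N' j⟩,
    fun n => ⟨phi_mem_schwartz A B N n, psi_mem_schwartz A B N' n⟩⟩, hamiltonian_eq_num A B,
    bigPhi_zero_mem_graph_cOp, exists_hilbertBasis_bigPhi, W.weylExp A B diagonal 1, hT,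
    fun T' hT' => hT'.exp_unique hT, W.isSelfAdjoint_weylExp 1, ker_expGroup _ _ _, ?_,
    not_bounded_weylExp_one hW, fun N N' h => isQuasiBases_phi_psi hW h, ⟨N, N', hN, ?_⟩,
    W.weylExp A B diagonal (-2), W.weylExp_neg_two, isFunctionOf_weylExp hW (-2),
    W.isSelfAdjoint_weylExp _, ker_expGroup _ _ _, ?_,
    (W.invariantSchwartz A B diagonal).map embed, LinearMap.map_le_range,
    fun N n => ⟨phi_mem_invariantSchwartz hW N n, psi_mem_invariantSchwartz hW N n⟩,
    isPseudoBosonic_invariantSchwartz hW, isConjugate_invariantSchwartz hW⟩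
  · intro h0
    simp [h0] at h
  · intro h0
    simp [h0] at h
  · rw [W.inverse_weylExp]
    exact (W.isSelfAdjoint_weylExp _).dense_domain
  · rwa [← W.weylExp_neg_two]
  · rintro _ ⟨f, rfl⟩ _ ⟨g, rfl⟩ hfg j
    exact ⟨intertwines_aOp hW hfg j, intertwines_num hW hfg j⟩
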